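/- Let $\mathrm{Aut}(\mathbb Q,<)$ be the group of order-preserving bijections of $\mathbb Q$, with the topology of pointwise convergence ($\mathbb Q$ being discrete), in which it is a Polish group. For a Polish group $G$, a Borel set $B\subseteq G$ is called Haar null if there is a Borel probability measure $\mu$ on $G$ with $\mu(gBh)=0$ for all $g,h\in G$, and an arbitrary set is called Haar null if it is contained in a Borel Haar null set; a property holds for almost every element of $G$ if the set of elements without it is Haar null. A set $A\subseteq G$ is a compact catcher if for every compact $K\subseteq G$ there are $g,h\in G$ with $gKh\subseteq A$; it is compact biter if for every nonempty compact $K\subseteq G$ there are an open set $U\subseteq G$ and $g,h\in G$ with $U\cap K\neq\emptyset$ and $g(U\cap K)h\subseteq A$. For $f\in\mathrm{Aut}(\mathbb Q,<)$, the orbitals of $f$ are the convex hulls in $\mathbb Q$ of the orbits $\{f^n(r):n\in\mathbb Z\}$, $r\in\mathbb Q$. They form a partition of $\mathbb Q$; for distinct orbitals write $O_1<O_2$ if $p_1<p_2$ for some (equivalently, all) $p_1\in O_1$, $p_2\in O_2$. The parity $s_f(O)$ of an orbital $O$ is $1$ if $f(p)>p$ for some (equivalently, all) $p\in O$, it is $-1$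 if $f(p)<p$ for some (equivalently, all) $p\in O$, and it is $0$ if $O$ consists of a fixed point of $f$. Consider the following two properties of $f\in\mathrm{Aut}(\mathbb Q,<)$. 1. For all orbitals $O_1<O_2$ of $f$ with $s_f(O_1)=s_f(O_2)=1$ or $s_f(O_1)=s_f(O_2)=-1$ there is an orbital $O_3$ of $f$ with $O_1<O_3<O_2$ and $s_f(O_3)\neq s_f(O_1)$. 2. $f$ has only finitely many fixed points in $\mathbb Q$. **Theorem.** (a) Almost every $f\in\mathrm{Aut}(\mathbb Q,<)$ has properties 1 and 2. (b) For every conjugacy class $C$ of $\mathrm{Aut}(\mathbb Q,<)$ the following are equivalent: $C$ is not Haar null; every element of $C$ has properties 1 and 2; some element of $C$ has properties 1 and 2. (c) The union of all Haar null conjugacy classes of $\mathrm{Aut}(\mathbb Q,<)$ is Haar null. (d) Every conjugacy class that is not Haar null is compact biter, and every conjugacy class that is not Haar null and whose elements have no fixed points in $\mathbb Q$ is a compact catcher. -/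

import Mathlib

open MeasureTheory Set

section HaarNull

variable {G : Type*} [Group G] [TopologicalSpace G]

/-- The two-sided translate `g S h = {g x h : x ∈ S}`. -/
def bitranslate (g : G) (S : Set G) (h : G) : Set G :=
  (fun x => g * x * h) '' S

/-- A Borel set `B` is Haar null if some Borel probability measure vanishes on all its two-sided
translates. -/
def IsBorelHaarNull [MeasurableSpace G] [BorelSpace G] (B : Set G) : Prop :=
  MeasurableSet B ∧
    ∃ μ : Measure G, IsProbabilityMeasure μ ∧ ∀ g h : G, μ (bitranslate g B h) = 0

/-- An arbitrary set is Haar null (in the sense of Christensen) if it is contained in a Borel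
Haar null set. -/
def IsHaarNull [MeasurableSpace G] [BorelSpace G] (S : Set G) : Prop :=
  ∃ B : Set G, S ⊆ B ∧ IsBorelHaarNull B

/-- Almost every element of `G` has property `P`: the set of elements with `P` is co-Haar null. -/
def HaarAlmostEvery [MeasurableSpace G] [BorelSpace G] (P : G → Prop) : Prop :=
  IsHaarNull {g : G | P g}ᶜ

/-- Every compact set has a two-sided translate inside `A`. -/
def IsCompactCatcher (A : Set G) : Prop :=
  ∀ K : Set G, IsCompact K → ∃ g h : G, bitranslate g K h ⊆ A

/-- Every nonempty compact set has a nonempty relatively open part with a two-sided translate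
inside `A`. -/
def IsCompactBiter (A : Set G) : Prop :=
  ∀ K : Set G, IsCompact K → K.Nonempty →
    ∃ (U : Set G) (g h : G), IsOpen U ∧ (U ∩ K).Nonempty ∧ bitranslate g (U ∩ K) h ⊆ A

end HaarNull

/-- The automorphism group of `(ℚ, <)`; multiplication is composition. -/
abbrev AutQ : Type := ℚ ≃o ℚ

/-- The topology of pointwise convergence on `AutQ`, where the target `ℚ` is discrete
(and does not carry its usual metric topology). -/
instance AutQ.instTopologicalSpace : TopologicalSpace AutQ :=
  TopologicalSpace.induced (fun (f : AutQ) (q : ℚ) => f q)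
    (@Pi.topologicalSpace ℚ (fun _ => ℚ) (fun _ => ⊥))

/-- The Borel σ-algebra of `AutQ`. -/
instance AutQ.instMeasurableSpace : MeasurableSpace AutQ := borel AutQ

instance AutQ.instBorelSpace : BorelSpace AutQ := ⟨rfl⟩

/-- The set of orbitals of `f`: the convex hulls, relative to `ℚ`, of the orbits
`{f ^ n r : n ∈ ℤ}` of the points `r ∈ ℚ`. -/
def orbitals (f : AutQ) : Set (Set ℚ) :=
  {O | ∃ r : ℚ, O = convexHull ℚ (range fun n : ℤ => (f ^ n) r)}

/-- The order on orbitals: distinct orbitals satisfy `O₁ < O₂` if `p₁ < p₂` for some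
`p₁ ∈ O₁`, `p₂ ∈ O₂`. -/
def OrbitalLT (O₁ O₂ : Set ℚ) : Prop :=
  O₁ ≠ O₂ ∧ ∃ p₁ ∈ O₁, ∃ p₂ ∈ O₂, p₁ < p₂

open Classical in
/-- The parity `s_f(O)` of an orbital `O` of `f`: it is `1` if `f p > p` for some `p ∈ O`, it is
`-1` if `f p < p` for some `p ∈ O`, and it is `0` if `O` consists of a fixed point of `f`. -/
noncomputable def orbitalParity (f : AutQ) (O : Set ℚ) : ℤ :=
  if ∃ p ∈ O, p < f p then 1 else if ∃ p ∈ O, f p < p then -1 else 0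

/-- Between any two orbitals of parity `1`, and between any two orbitals of parity `-1`, there is
an orbital of a different parity. -/
def HasAlternatingOrbitals (f : AutQ) : Prop :=
  ∀ O₁ ∈ orbitals f, ∀ O₂ ∈ orbitals f, OrbitalLT O₁ O₂ →
    (orbitalParity f O₁ = 1 ∧ orbitalParity f O₂ = 1) ∨
      (orbitalParity f O₁ = -1 ∧ orbitalParity f O₂ = -1) →
    ∃ O₃ ∈ orbitals f, OrbitalLT O₁ O₃ ∧ OrbitalLT O₃ O₂ ∧
      orbitalParity f O₃ ≠ orbitalParity f O₁

/-- `f` has only finitely many (rational) fixed points. -/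
def HasFinitelyManyFixedPoints (f : AutQ) : Prop :=
  (Function.fixedPoints f).Finite

/-!
Call an automorphism good if it has the two properties of the theorem. The proof has two halves:
the bad automorphisms form a Haar null set, and the conjugacy class of a good automorphism is large.
Since being good is invariant under conjugation, a conjugacy class consists of good automorphisms
or of bad ones, and the theorem follows.

**Bad automorphisms are rare** (`isHaarNull_compl_goodAut`). The witnessing measure is the law of
a random automorphism `randomAut ω`, the limit of a sequence of maps each of which is obtained from
the preceding one by adding a uniformly random multiple (with `2 ^ n` possible values at the `n`-th
step) of the distance to a finite set of points, at which the map remains unchanged from then on.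
For a given automorphism `h`, a point that is new at the `k`-th step gets the same value under the
random automorphism as under `h` with probability at most `2⁻ᵏ`, so by the Borel–Cantelli lemma
`h⁻¹ * randomAut ω` has finitely many fixed points almost surely
(`ae_finite_setOf_randomAut_eq`). If two choices differ for the first time at
the `n`-th step, then the two automorphisms are ordered, and their difference vanishes only on
a finite set. If both `h⁻¹ f` and `h⁻¹ f'`, where `f ≤ f'`, move all points of `[p, q]` up, and an
orbit of `h⁻¹ f'` stays in `[p, q]`, then along this orbit `f' - f` tends to `0`, so the orbit
converges to a point of the finite set, hence to a *rational* point of `[p, q]`, which `h⁻¹ f'`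
has to fix: a contradiction. Thus for given `p < q` at most one choice is bad
(`subsingleton_setOf_up`, `subsingleton_setOf_dn`), and single choices have probability zero.

**Good conjugacy classes are large** (`exists_capture_aut`). Let `f₀` be good, and let `K` be
a set of automorphisms such that each point has finitely many images and preimages under `K`, and
only one image if it is a fixed point of `f₀`. Then a single automorphism `h` exists such that all
`h⁻¹ f`, `f ∈ K`, are conjugate to `f₀`. Together with `h`, one constructs for every `f ∈ K` a
labelling of the line by the orbitals of `f₀` whose fibres are the orbitals of `h⁻¹ f`, by a
back-and-forth argument on finite approximations (`Approx`). Two automorphisms with labellings by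
the same alternating set of labels are conjugate (`IsOrbitalLabelling.exists_conj`). Compact sets
satisfy the finiteness conditions after the values at the finitely many fixed points of `f₀` have
been prescribed, which gives that the class is compact biter, and a compact catcher
if there are no fixed points; and every probability measure is positive on a set that
satisfies them, so the class is not Haar null.
-/

/-! ### Approximations to a capturing isomorphism -/

section Finite

variable {Z α : Type*} [LinearOrder Z] [DenselyOrdered Z]

theorem exists_between_lt_finite {a b : Z} (hab : a < b) {F : Set α} {φ : α → Z}
    (hfin : (φ '' F).Finite) (h : ∀ f ∈ F, a < φ f) :
    ∃ c, a < c ∧ c < b ∧ ∀ f ∈ F, c < φ f := by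
  obtain ⟨m, hm, hmin⟩ := Set.exists_min_image (insert b (φ '' F)) id (hfin.insert b) ⟨b, by simp⟩
  have ham : a < m := by
    rcases hm with rfl | ⟨f, hf, rfl⟩
    · exact hab
    · exact h f hf
  obtain ⟨c, hac, hcm⟩ := exists_between ham
  exact ⟨c, hac, hcm.trans_le (hmin b (by simp)),
    fun f hf => hcm.trans_le (hmin _ (Or.inr ⟨f, hf, rfl⟩))⟩

theorem exists_between_gt_finite {a b : Z} (hab : a < b) {F : Set α} {φ : α → Z}
    (hfin : (φ '' F).Finite) (h : ∀ f ∈ F, φ f < b) :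
    ∃ c, a < c ∧ c < b ∧ ∀ f ∈ F, φ f < c := by
  obtain ⟨c, hc, hc', hc''⟩ := exists_between_lt_finite (Z := Zᵒᵈ) (a := OrderDual.toDual b)
    (b := OrderDual.toDual a) hab (φ := fun f => OrderDual.toDual (φ f)) (F := F) hfin h
  exact ⟨OrderDual.ofDual c, hc', hc, hc''⟩

end Finite

section Approximation

variable {X Y L : Type*} [LinearOrder X] [LinearOrder Y] [LinearOrder L]

/-- `P` and `Q` are consecutive points of the finite chain `S ⊆ X × Y`. -/
structure Consec (S : Finset (X × Y)) (P Q : X × Y) : Prop where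
  left : P ∈ S
  right : Q ∈ S
  lt : P.1 < Q.1
  gap : ∀ R ∈ S, R.1 ≤ P.1 ∨ Q.1 ≤ R.1

/-- The graph of `f` avoids the rectangle with corners `P` and `Q`: it passes above it or
below it. -/
def Avoids (f : X ≃o Y) (P Q : X × Y) : Prop :=
  Q.2 < f P.1 ∨ f Q.1 < P.2

/-- The labels, with respect to `ℓ`, of two points `P` and `Q` between which nothing has been
decided yet: the maps in `F` have label `p` at `P` and label `q` at `Q`, where `p < q`. All other
maps in `K` have the same label at `P` and at `Q`, and they avoid the rectangle between them. -/
structure IsBox (K : Set (X ≃o Y)) (ℓ : (X ≃o Y) → X × Y → L) (P Q : X × Y) (p q : L)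
    (F : Set (X ≃o Y)) : Prop where
  lt : p < q
  subset : F ⊆ K
  label : ∀ f ∈ F, ℓ f P = p ∧ ℓ f Q = q
  avoids : ∀ f ∈ K, f ∉ F → ℓ f P = ℓ f Q ∧ Avoids f P Q

/-- A finite approximation to an isomorphism `h : X ≃o Y` and, for every `f ∈ K`, to a labelling of
`X` by `L`: the finite set `S` is a part of the graph of `h`, and `ℓ f P` is the label that `f`
gives to `P ∈ S`. The predicates `up` and `dn` on `L` say where `h` has to lie below and above
`f`. -/
structure Approx [BoundedOrder X] [BoundedOrder Y] (up dn : L → Prop) (K : Set (X ≃o Y)) where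
  S : Finset (X × Y)
  ℓ : (X ≃o Y) → X × Y → L
  chain : ∀ P ∈ S, ∀ Q ∈ S, P.1 < Q.1 ↔ P.2 < Q.2
  bot : (⊥, ⊥) ∈ S
  top : (⊤, ⊤) ∈ S
  zero : ∀ r, ¬ up r → ¬ dn r → ∃ P ∈ S, ∀ f ∈ K, ℓ f P = r
  mono : ∀ f ∈ K, ∀ P ∈ S, ∀ Q ∈ S, P.1 < Q.1 → ℓ f P ≤ ℓ f Q
  up_iff : ∀ f ∈ K, ∀ P ∈ S, up (ℓ f P) ↔ P.2 < f P.1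
  dn_iff : ∀ f ∈ K, ∀ P ∈ S, dn (ℓ f P) ↔ f P.1 < P.2
  box : ∀ P Q, Consec S P Q → ∃ p q F, IsBox K ℓ P Q p q F

variable [BoundedOrder X] [BoundedOrder Y] {up dn : L → Prop} {K : Set (X ≃o Y)}

namespace Approx

/-- `C'` extends `C`: it has more points, and the same labels at the points of `C`. -/
def Extends (C C' : Approx up dn K) : Prop :=
  C.S ⊆ C'.S ∧ ∀ f ∈ K, ∀ P ∈ C.S, C'.ℓ f P = C.ℓ f P

theorem Extends.refl (C : Approx up dn K) : C.Extends C :=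
  ⟨Finset.Subset.refl _, fun _ _ _ _ => rfl⟩

theorem Extends.trans {C C' C'' : Approx up dn K} (h : C.Extends C') (h' : C'.Extends C'') :
    C.Extends C'' :=
  ⟨h.1.trans h'.1, fun f hf P hP => (h'.2 f hf P (h.1 hP)).trans (h.2 f hf P hP)⟩

theorem eq_of_fst_eq (C : Approx up dn K) {P Q : X × Y} (hP : P ∈ C.S) (hQ : Q ∈ C.S)
    (h : P.1 = Q.1) : P = Q := by
  refine Prod.ext h (le_antisymm (not_lt.1 fun h' => ?_) (not_lt.1 fun h' => ?_))
  · exact ((C.chain Q hQ P hP).2 h').ne' h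
  · exact ((C.chain P hP Q hQ).2 h').ne h

theorem mono' (C : Approx up dn K) {f : X ≃o Y} (hf : f ∈ K) {P Q : X × Y} (hP : P ∈ C.S)
    (hQ : Q ∈ C.S) (h : P.1 ≤ Q.1) : C.ℓ f P ≤ C.ℓ f Q := by
  rcases h.lt_or_eq with h | h
  · exact C.mono f hf P hP Q hQ h
  · rw [C.eq_of_fst_eq hP hQ h]

/-- Adding a single point `R` between two consecutive points. -/
theorem exists_insert (C : Approx up dn K) {P Q R : X × Y} {p q : L} {F : Set (X ≃o Y)}
    (hPQ : Consec C.S P Q) (hB : IsBox K C.ℓ P Q p q F)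
    (h1 : P.1 < R.1) (h2 : R.1 < Q.1) (h3 : P.2 < R.2) (h4 : R.2 < Q.2)
    (ρ : (X ≃o Y) → L) (hρ : ∀ f ∈ F, p ≤ ρ f ∧ ρ f ≤ q)
    (hup : ∀ f ∈ F, up (ρ f) ↔ R.2 < f R.1) (hdn : ∀ f ∈ F, dn (ρ f) ↔ f R.1 < R.2)
    {r₁ r₂ : L} {F₁ F₂ : Set (X ≃o Y)} (hr₁ : p < r₁) (hr₂ : r₂ < q) (hF₁ : F₁ ⊆ F) (hF₂ : F₂ ⊆ F)
    (hρ₁ : ∀ f ∈ F₁, ρ f = r₁) (hρ₂ : ∀ f ∈ F₂, ρ f = r₂)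
    (hρ₁' : ∀ f ∈ F, f ∉ F₁ → ρ f = p ∧ Avoids f P R)
    (hρ₂' : ∀ f ∈ F, f ∉ F₂ → ρ f = q ∧ Avoids f R Q) :
    ∃ C' : Approx up dn K, C.Extends C' ∧ (∀ T, T ∈ C'.S ↔ T = R ∨ T ∈ C.S) ∧
      (∀ f ∈ F, C'.ℓ f R = ρ f) ∧
      Consec C'.S P R ∧ Consec C'.S R Q ∧
      IsBox K C'.ℓ P R p r₁ F₁ ∧ IsBox K C'.ℓ R Q r₂ q F₂ ∧
      ∀ P' Q', Consec C'.S P' Q' → (P' = P ∧ Q' = R) ∨ (P' = R ∧ Q' = Q) ∨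
        (Consec C.S P' Q' ∧ ¬ (P' = P ∧ Q' = Q)) := by
  classical
  have hRS : R ∉ C.S := fun h => by
    rcases hPQ.gap R h with h | h
    · exact absurd h1 (not_lt.2 h)
    · exact absurd h2 (not_lt.2 h)
  have hPR : P ≠ R := fun h => h1.ne (congrArg Prod.fst h)
  have hQR : Q ≠ R := fun h => h2.ne' (congrArg Prod.fst h)
  -- position of old points relative to `R`
  have hpos : ∀ T ∈ C.S, (T.1 < R.1 ∧ T.2 < R.2 ∧ T.1 ≤ P.1) ∨
      (R.1 < T.1 ∧ R.2 < T.2 ∧ Q.1 ≤ T.1) := by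
    intro T hT
    rcases hPQ.gap T hT with h | h
    · refine Or.inl ⟨h.trans_lt h1, lt_of_le_of_lt (not_lt.1 fun h' => ?_) h3, h⟩
      exact absurd ((C.chain P hPQ.left T hT).2 h') (not_lt.2 h)
    · refine Or.inr ⟨h2.trans_le h, lt_of_lt_of_le h4 (not_lt.1 fun h' => ?_), h⟩
      exact absurd ((C.chain T hT Q hPQ.right).2 h') (not_lt.2 h)
  let m : (X ≃o Y) → L := fun f => if f ∈ F then ρ f else C.ℓ f P
  let ℓ' : (X ≃o Y) → X × Y → L := fun f T => if T = R then m f else C.ℓ f T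
  have hℓR : ∀ f, ℓ' f R = m f := fun f => by simp [ℓ']
  have hℓ : ∀ f, ∀ T ∈ C.S, ℓ' f T = C.ℓ f T := fun f T hT => by
    have : T ≠ R := fun h => hRS (h ▸ hT)
    simp [ℓ', this]
  have hmF : ∀ f ∈ F, m f = ρ f := fun f hf => by simp [m, hf]
  have hmF' : ∀ f, f ∉ F → m f = C.ℓ f P := fun f hf => by simp [m, hf]
  have hPm : ∀ f ∈ K, C.ℓ f P ≤ m f ∧ m f ≤ C.ℓ f Q := by
    intro f hf
    by_cases hfF : f ∈ F
    · rw [hmF f hfF, (hB.label f hfF).1, (hB.label f hfF).2]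
      exact hρ f hfF
    · rw [hmF' f hfF]
      exact ⟨le_rfl, (hB.avoids f hf hfF).1.le⟩
  -- maps that avoid the big rectangle avoid the small ones
  have hav : ∀ f, Avoids f P Q → Avoids f P R ∧ Avoids f R Q := by
    intro f h
    rcases h with h | h
    · exact ⟨Or.inl (h4.trans h), Or.inl (h.trans (f.strictMono h1))⟩
    · exact ⟨Or.inr ((f.strictMono h2).trans h), Or.inr (h.trans h3)⟩
  have hbox1 : IsBox K ℓ' P R p r₁ F₁ := by
    refine ⟨hr₁, hF₁.trans hB.subset, fun f hf => ?_, fun f hf hf1 => ?_⟩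
    · rw [hℓ f P hPQ.left, hℓR, hmF f (hF₁ hf), hρ₁ f hf]
      exact ⟨(hB.label f (hF₁ hf)).1, rfl⟩
    · rw [hℓ f P hPQ.left, hℓR]
      by_cases hfF : f ∈ F
      · rw [hmF f hfF, (hB.label f hfF).1]
        exact ⟨(hρ₁' f hfF hf1).1.symm, (hρ₁' f hfF hf1).2⟩
      · rw [hmF' f hfF]
        exact ⟨rfl, (hav f (hB.avoids f hf hfF).2).1⟩
  have hbox2 : IsBox K ℓ' R Q r₂ q F₂ := by
    refine ⟨hr₂, hF₂.trans hB.subset, fun f hf => ?_, fun f hf hf1 => ?_⟩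
    · rw [hℓ f Q hPQ.right, hℓR, hmF f (hF₂ hf), hρ₂ f hf]
      exact ⟨rfl, (hB.label f (hF₂ hf)).2⟩
    · rw [hℓ f Q hPQ.right, hℓR]
      by_cases hfF : f ∈ F
      · rw [hmF f hfF, (hB.label f hfF).2]
        exact ⟨(hρ₂' f hfF hf1).1, (hρ₂' f hfF hf1).2⟩
      · rw [hmF' f hfF]
        exact ⟨(hB.avoids f hf hfF).1, (hav f (hB.avoids f hf hfF).2).2⟩
  have hcons : ∀ P' Q', Consec (insert R C.S) P' Q' → (P' = P ∧ Q' = R) ∨ (P' = R ∧ Q' = Q) ∨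
        (Consec C.S P' Q' ∧ ¬ (P' = P ∧ Q' = Q)) := by
    intro P' Q' h
    have hgap := h.gap
    have hlt := h.lt
    rcases Finset.mem_insert.1 h.left with rfl | hP'
    · right; left
      refine ⟨rfl, ?_⟩
      rcases Finset.mem_insert.1 h.right with rfl | hQ'
      · exact absurd hlt (lt_irrefl _)
      · rcases hpos Q' hQ' with h' | h'
        · exact absurd hlt (not_lt.2 h'.1.le)
        · refine C.eq_of_fst_eq hQ' hPQ.right (le_antisymm ?_ h'.2.2)
          rcases hgap Q (Finset.mem_insert_of_mem hPQ.right) with h'' | h''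
          · exact absurd h2 (not_lt.2 h'')
          · exact h''
    · rcases Finset.mem_insert.1 h.right with rfl | hQ'
      · left
        refine ⟨?_, rfl⟩
        rcases hpos P' hP' with h' | h'
        · refine C.eq_of_fst_eq hP' hPQ.left (le_antisymm h'.2.2 ?_)
          rcases hgap P (Finset.mem_insert_of_mem hPQ.left) with h'' | h''
          · exact h''
          · exact absurd h1 (not_lt.2 h'')
        · exact absurd hlt (not_lt.2 h'.1.le)
      · right; right
        refine ⟨⟨hP', hQ', hlt, fun T hT => hgap T (Finset.mem_insert_of_mem hT)⟩, ?_⟩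
        rintro ⟨rfl, rfl⟩
        rcases hgap R (Finset.mem_insert_self _ _) with h' | h'
        · exact absurd h1 (not_lt.2 h')
        · exact absurd h2 (not_lt.2 h')
  refine ⟨⟨insert R C.S, ℓ', ?_, Finset.mem_insert_of_mem C.bot, Finset.mem_insert_of_mem C.top,
    ?_, ?_, ?_, ?_, ?_⟩, ⟨Finset.subset_insert _ _, fun f _ T hT => hℓ f T hT⟩,
    fun T => Finset.mem_insert, fun f hf => (hℓR f).trans (hmF f hf), ?_, ?_, hbox1, hbox2, hcons⟩
  · intro T hT U hU
    rcases Finset.mem_insert.1 hT with rfl | hT' <;> rcases Finset.mem_insert.1 hU with rfl | hU'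
    · simp
    · rcases hpos U hU' with h | h
      · simp [h.1.not_gt, h.2.1.not_gt]
      · simp [h.1, h.2.1]
    · rcases hpos T hT' with h | h
      · simp [h.1, h.2.1]
      · simp [h.1.not_gt, h.2.1.not_gt]
    · exact C.chain T hT' U hU'
  · intro r hr hr'
    obtain ⟨T, hT, hT'⟩ := C.zero r hr hr'
    exact ⟨T, Finset.mem_insert_of_mem hT, fun f hf => (hℓ f T hT).trans (hT' f hf)⟩
  · intro f hf T hT U hU hTU
    rcases Finset.mem_insert.1 hT with rfl | hT' <;> rcases Finset.mem_insert.1 hU with rfl | hU'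
    · exact le_rfl
    · rw [hℓR, hℓ f U hU']
      rcases hpos U hU' with h | h
      · exact absurd hTU (not_lt.2 h.1.le)
      · exact (hPm f hf).2.trans (C.mono' hf hPQ.right hU' h.2.2)
    · rw [hℓR, hℓ f T hT']
      rcases hpos T hT' with h | h
      · exact (C.mono' hf hT' hPQ.left h.2.2).trans (hPm f hf).1
      · exact absurd hTU (not_lt.2 h.1.le)
    · rw [hℓ f T hT', hℓ f U hU']
      exact C.mono f hf T hT' U hU' hTU
  · intro f hf T hT
    rcases Finset.mem_insert.1 hT with rfl | hT
    · rw [hℓR]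
      by_cases hfF : f ∈ F
      · rw [hmF f hfF]; exact hup f hfF
      · rw [hmF' f hfF, C.up_iff f hf P hPQ.left]
        rcases (hB.avoids f hf hfF).2 with h | h
        · simp [(h3.trans h4).trans h, (h4.trans h).trans (f.strictMono h1)]
        · simp [((f.strictMono (h1.trans h2)).trans h).not_gt,
            (((f.strictMono h2).trans h).trans h3).not_gt]
    · rw [hℓ f T hT]; exact C.up_iff f hf T hT
  · intro f hf T hT
    rcases Finset.mem_insert.1 hT with rfl | hT
    · rw [hℓR]
      by_cases hfF : f ∈ F
      · rw [hmF f hfF]; exact hdn f hfF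
      · rw [hmF' f hfF, C.dn_iff f hf P hPQ.left]
        rcases (hB.avoids f hf hfF).2 with h | h
        · simp [((h3.trans h4).trans h).not_gt, ((h4.trans h).trans (f.strictMono h1)).not_gt]
        · simp [((f.strictMono (h1.trans h2)).trans h),
            (((f.strictMono h2).trans h).trans h3)]
    · rw [hℓ f T hT]; exact C.dn_iff f hf T hT
  · intro P' Q' h
    rcases hcons P' Q' h with ⟨rfl, rfl⟩ | ⟨rfl, rfl⟩ | ⟨h', -⟩
    · exact ⟨_, _, _, hbox1⟩
    · exact ⟨_, _, _, hbox2⟩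
    · obtain ⟨a, b, E, hE⟩ := C.box P' Q' h'
      refine ⟨a, b, E, hE.lt, hE.subset, fun f hf => ?_, fun f hf hf' => ?_⟩
      · rw [hℓ f P' h'.left, hℓ f Q' h'.right]; exact hE.label f hf
      · rw [hℓ f P' h'.left, hℓ f Q' h'.right]; exact hE.avoids f hf hf'
  · refine ⟨Finset.mem_insert_of_mem hPQ.left, Finset.mem_insert_self _ _, h1, fun T hT => ?_⟩
    rcases Finset.mem_insert.1 hT with rfl | hT
    · exact Or.inr le_rfl
    · exact (hPQ.gap T hT).imp_right h2.le.trans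
  · refine ⟨Finset.mem_insert_self _ _, Finset.mem_insert_of_mem hPQ.right, h2, fun T hT => ?_⟩
    rcases Finset.mem_insert.1 hT with rfl | hT
    · exact Or.inl le_rfl
    · exact (hPQ.gap T hT).imp_left fun h => h.trans h1.le

end Approx
end Approximation

/-! ### Symmetry of approximations under exchange of the axes -/

section Approximation

variable {X Y L : Type*} [LinearOrder X] [LinearOrder Y] [LinearOrder L]

/-- Two labels at the ends of an undecided rectangle are compatible if they are not both `up` and
not both `dn`. -/
def Compatible (up dn : L → Prop) (p q : L) : Prop :=
  ¬ (up p ∧ up q) ∧ ¬ (dn p ∧ dn q)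

/-- The labels of two kinds `up` and `dn`, and of a third kind, alternate: between two labels of the
same kind there is a label of a different kind. -/
structure Alternating (up dn : L → Prop) : Prop where
  disjoint : ∀ r, up r → ¬ dn r
  up_up : ∀ p q, p < q → up p → up q → ∃ s, p < s ∧ s < q ∧ ¬ up s
  dn_dn : ∀ p q, p < q → dn p → dn q → ∃ s, p < s ∧ s < q ∧ ¬ dn s
  zero_zero : ∀ p q, p < q → ¬ up p → ¬ dn p → ¬ up q → ¬ dn q → ∃ s, p < s ∧ s < q ∧ (up s ∨ dn s)

theorem Alternating.swap {up dn : L → Prop} (h : Alternating up dn) : Alternating dn up where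
  disjoint r hd hu := h.disjoint r hu hd
  up_up := h.dn_dn
  dn_dn := h.up_up
  zero_zero p q hpq a b c d := by
    obtain ⟨s, h1, h2, h3⟩ := h.zero_zero p q hpq b a d c
    exact ⟨s, h1, h2, h3.symm⟩

/-- Every point of `X` has finitely many images under `K`, and every point of `Y` has finitely many
preimages. For automorphisms of `ℚ` this holds when `K` is compact. -/
structure FiniteValued (K : Set (X ≃o Y)) : Prop where
  apply : ∀ x, ((fun f : X ≃o Y => f x) '' K).Finite
  symm_apply : ∀ y, ((fun f : X ≃o Y => f.symm y) '' K).Finite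

theorem FiniteValued.mono {K F : Set (X ≃o Y)} (h : FiniteValued K) (hF : F ⊆ K) :
    FiniteValued F :=
  ⟨fun x => (h.apply x).subset (image_mono hF), fun x => (h.symm_apply x).subset (image_mono hF)⟩

theorem FiniteValued.swap {K : Set (X ≃o Y)} (h : FiniteValued K) :
    FiniteValued {g : Y ≃o X | g.symm ∈ K} := by
  refine ⟨fun y => (h.symm_apply y).subset ?_, fun x => (h.apply x).subset ?_⟩
  · rintro _ ⟨g, hg, rfl⟩; exact ⟨g.symm, hg, rfl⟩
  · rintro _ ⟨g, hg, rfl⟩; exact ⟨g.symm, hg, rfl⟩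

theorem Consec.swap {S : Finset (X × Y)} (hS : ∀ P ∈ S, ∀ Q ∈ S, P.1 < Q.1 ↔ P.2 < Q.2)
    {P Q : X × Y} (h : Consec S P Q) :
    Consec (S.map (Equiv.prodComm X Y).toEmbedding) P.swap Q.swap := by
  refine ⟨by simpa using h.left, by simpa using h.right, (hS P h.left Q h.right).1 h.lt, ?_⟩
  intro R hR
  have hR' : R.swap ∈ S := by simpa using hR
  have h1 := hS P h.left _ hR'
  have h2 := hS _ hR' Q h.right
  simp only [Prod.fst_swap, Prod.snd_swap] at h1 h2 ⊢
  rw [← not_lt, ← not_lt, ← h1, ← h2, not_lt, not_lt]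
  exact h.gap _ hR'

theorem Avoids.swap {f : X ≃o Y} {P Q : X × Y} (h : Avoids f P Q) :
    Avoids f.symm P.swap Q.swap := by
  rcases h with h | h
  · right; exact (f.symm_apply_lt).2 h
  · left; exact (f.lt_symm_apply).2 h

variable [BoundedOrder X] [BoundedOrder Y] {up dn : L → Prop} {K : Set (X ≃o Y)}

namespace Approx

/-- Exchanging the two axes exchanges `f` and `f.symm` and turns `up` into `dn`. -/
def swap (C : Approx up dn K) : Approx (X := Y) (Y := X) dn up {g | g.symm ∈ K} where
  S := C.S.map (Equiv.prodComm X Y).toEmbedding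
  ℓ g R := C.ℓ g.symm R.swap
  chain P hP Q hQ := (C.chain _ (by simpa using hP) _ (by simpa using hQ)).symm
  bot := by simpa using C.bot
  top := by simpa using C.top
  zero r hd hu := by
    obtain ⟨P, hP, hP'⟩ := C.zero r hu hd
    exact ⟨P.swap, by simpa using hP, fun g hg => by simpa using hP' _ hg⟩
  mono g hg P hP Q hQ h := C.mono _ hg _ (by simpa using hP) _ (by simpa using hQ)
    ((C.chain _ (by simpa using hP) _ (by simpa using hQ)).2 h)
  up_iff g hg P hP := by
    rw [C.dn_iff _ hg _ (by simpa using hP)]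
    exact g.symm_apply_lt
  dn_iff g hg P hP := by
    rw [C.up_iff _ hg _ (by simpa using hP)]
    exact g.lt_symm_apply
  box P Q h := by
    have hS : ∀ P ∈ C.S, ∀ Q ∈ C.S, P.1 < Q.1 ↔ P.2 < Q.2 := C.chain
    have h' : Consec C.S P.swap Q.swap := by
      have := Consec.swap (S := C.S.map (Equiv.prodComm X Y).toEmbedding)
        (fun P hP Q hQ => (hS _ (by simpa using hP) _ (by simpa using hQ)).symm) h
      rwa [Finset.map_map, show (Equiv.prodComm X Y).toEmbedding.trans
        (Equiv.prodComm Y X).toEmbedding = Function.Embedding.refl _ from rfl,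
        Finset.map_refl] at this
    obtain ⟨p, q, F, hF⟩ := C.box _ _ h'
    exact ⟨p, q, {g | g.symm ∈ F}, hF.lt, fun g hg => hF.subset hg, fun g hg => hF.label _ hg,
      fun g hg hg' => ⟨(hF.avoids _ hg hg').1, (hF.avoids _ hg hg').2.swap⟩⟩

/-- The labels at the ends of every undecided rectangle of `C` are compatible. -/
def Fine (C : Approx up dn K) : Prop :=
  ∀ P Q, Consec C.S P Q → ∃ p q F, IsBox K C.ℓ P Q p q F ∧ Compatible up dn p q

theorem mem_swap (C : Approx up dn K) {P : Y × X} : P ∈ C.swap.S ↔ P.swap ∈ C.S := by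
  simp [swap]

theorem swap_swap (C : Approx up dn K) : C.swap.swap = C := by
  have hS : C.swap.swap.S = C.S := by ext P; simp [mem_swap]
  cases C
  simp only [swap] at hS ⊢
  congr

theorem consec_swap (C : Approx up dn K) {P Q : Y × X} (h : Consec C.swap.S P Q) :
    Consec C.S P.swap Q.swap := by
  have := Consec.swap C.swap.chain h
  change Consec C.swap.swap.S _ _ at this
  rwa [swap_swap] at this

theorem isBox_swap {C : Approx up dn K} {P Q : X × Y} {p q : L} {F : Set (X ≃o Y)}
    (h : IsBox K C.ℓ P Q p q F) :
    IsBox {g : Y ≃o X | g.symm ∈ K} C.swap.ℓ P.swap Q.swap p q {g | g.symm ∈ F} :=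
  ⟨h.lt, fun _ hg => h.subset hg, fun _ hg => h.label _ hg,
    fun _ hg hg' => ⟨(h.avoids _ hg hg').1, (h.avoids _ hg hg').2.swap⟩⟩

theorem Fine.swap {C : Approx up dn K} (h : C.Fine) : C.swap.Fine := by
  intro P Q hPQ
  obtain ⟨p, q, F, hF, hc⟩ := h _ _ (C.consec_swap hPQ)
  exact ⟨p, q, _, isBox_swap hF, hc.2, hc.1⟩

theorem Extends.swap {C C' : Approx up dn K} (h : C.Extends C') : C.swap.Extends C'.swap :=
  ⟨fun P hP => by rw [mem_swap] at hP ⊢; exact h.1 hP,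
    fun g hg P hP => h.2 _ hg _ (C.mem_swap.1 hP)⟩

/-- To extend an approximation it suffices to extend the swapped one. -/
theorem exists_of_swap {C : Approx up dn K}
    {p : Approx (X := Y) (Y := X) dn up {g | g.symm ∈ K} → Prop}
    (h : ∃ C', C.swap.Extends C' ∧ C'.Fine ∧ p C') :
    ∃ C' : Approx up dn K, C.Extends C' ∧ C'.Fine ∧ p C'.swap := by
  obtain ⟨C', h1, h2, h3⟩ := h
  refine ⟨C'.swap, ?_, h2.swap, ?_⟩
  · have := h1.swap
    rwa [swap_swap] at this
  · exact (iff_of_eq (congrArg p (swap_swap C'))).2 h3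

end Approx
end Approximation

/-! ### Extending an approximation inside a rectangle -/

section Approximation

variable {X Y L : Type*} [LinearOrder X] [LinearOrder Y] [LinearOrder L]
variable [BoundedOrder X] [BoundedOrder Y] {up dn : L → Prop} {K : Set (X ≃o Y)}

namespace Approx

theorem isBox_of_extends {C C' : Approx up dn K} (h : C.Extends C') {P Q : X × Y}
    (hP : P ∈ C.S) (hQ : Q ∈ C.S) {p q : L} {F : Set (X ≃o Y)} (hB : IsBox K C.ℓ P Q p q F) :
    IsBox K C'.ℓ P Q p q F := by
  refine ⟨hB.lt, hB.subset, fun f hf => ?_, fun f hf hf' => ?_⟩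
  · rw [h.2 f (hB.subset hf) P hP, h.2 f (hB.subset hf) Q hQ]; exact hB.label f hf
  · rw [h.2 f hf P hP, h.2 f hf Q hQ]; exact hB.avoids f hf hf'

/-- `C'` extends `C`, and all its new points lie between `P` and `Q`. -/
def ExtendsIn (C : Approx up dn K) (P Q : X × Y) (C' : Approx up dn K) : Prop :=
  C.Extends C' ∧ ∀ T ∈ C'.S, T ∈ C.S ∨ (P.1 < T.1 ∧ T.1 < Q.1)

theorem ExtendsIn.refl (C : Approx up dn K) (P Q : X × Y) : C.ExtendsIn P Q C :=
  ⟨Extends.refl C, fun _ h => Or.inl h⟩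

theorem ExtendsIn.trans {C C' C'' : Approx up dn K} {P Q P' Q' : X × Y} (h : C.ExtendsIn P Q C')
    (h' : C'.ExtendsIn P' Q' C'') (hP : P.1 ≤ P'.1) (hQ : Q'.1 ≤ Q.1) : C.ExtendsIn P Q C'' :=
  ⟨h.1.trans h'.1, fun T hT => (h'.2 T hT).elim (h.2 T)
    fun hT => Or.inr ⟨hP.trans_lt hT.1, hT.2.trans_le hQ⟩⟩

theorem snd_lt (C : Approx up dn K) {P Q : X × Y} (h : Consec C.S P Q) : P.2 < Q.2 :=
  (C.chain P h.left Q h.right).1 h.lt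

/-- Adding a point `R` to an undecided rectangle, where the maps in `F₁` keep the label of the lower
corner and the other maps get the label of the upper corner. -/
theorem exists_split {C : Approx up dn K} (hC : C.Fine) {P Q R : X × Y} {p q : L}
    {F F₁ : Set (X ≃o Y)} (hPQ : Consec C.S P Q) (hB : IsBox K C.ℓ P Q p q F)
    (hpq : Compatible up dn p q)
    (h1 : P.1 < R.1) (h2 : R.1 < Q.1) (h3 : P.2 < R.2) (h4 : R.2 < Q.2) (hF₁ : F₁ ⊆ F)
    (hav₁ : ∀ f ∈ F₁, Avoids f P R) (hav₂ : ∀ f ∈ F, f ∉ F₁ → Avoids f R Q) :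
    ∃ C' : Approx up dn K, C.ExtendsIn P Q C' ∧ C'.Fine ∧ R ∈ C'.S ∧
      Consec C'.S P R ∧ Consec C'.S R Q ∧
      IsBox K C'.ℓ P R p q (F \ F₁) ∧ IsBox K C'.ℓ R Q p q F₁ := by
  classical
  have key1 : ∀ f, Avoids f P R → (P.2 < f P.1 ↔ R.2 < f R.1) ∧ (f P.1 < P.2 ↔ f R.1 < R.2) := by
    intro f h
    have := f.strictMono h1
    rcases h with h | h
    · have a := h3.trans h
      have b := h.trans this
      simp [a, b, a.not_gt, b.not_gt]
    · have a := this.trans h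
      have b := h.trans h3
      simp [a, b, a.not_gt, b.not_gt]
  have key2 : ∀ f, Avoids f R Q → (Q.2 < f Q.1 ↔ R.2 < f R.1) ∧ (f Q.1 < Q.2 ↔ f R.1 < R.2) := by
    intro f h
    have := f.strictMono h2
    rcases h with h | h
    · have a := h4.trans h
      have b := h.trans this
      simp [a, b, a.not_gt, b.not_gt]
    · have a := this.trans h
      have b := h.trans h4
      simp [a, b, a.not_gt, b.not_gt]
  obtain ⟨C', e1, e2, -, e3, e4, e5, e6, e7⟩ := C.exists_insert hPQ hB h1 h2 h3 h4
    (fun f => if f ∈ F₁ then p else q)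
    (fun f _ => by split_ifs <;> simp [hB.lt.le])
    (fun f hf => by
      split_ifs with h
      · rw [← (key1 f (hav₁ f h)).1, ← C.up_iff f (hB.subset hf) P hPQ.left, (hB.label f hf).1]
      · rw [← (key2 f (hav₂ f hf h)).1, ← C.up_iff f (hB.subset hf) Q hPQ.right,
          (hB.label f hf).2])
    (fun f hf => by
      split_ifs with h
      · rw [← (key1 f (hav₁ f h)).2, ← C.dn_iff f (hB.subset hf) P hPQ.left, (hB.label f hf).1]
      · rw [← (key2 f (hav₂ f hf h)).2, ← C.dn_iff f (hB.subset hf) Q hPQ.right,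
          (hB.label f hf).2])
    hB.lt hB.lt (F₁ := F \ F₁) sdiff_subset hF₁
    (fun f hf => by simp [hf.2]) (fun f hf => by simp [hf])
    (fun f hf hf' => by
      have : f ∈ F₁ := by by_contra h; exact hf' ⟨hf, h⟩
      simp [this, hav₁ f this])
    (fun f hf hf' => by simp [hf', hav₂ f hf hf'])
  refine ⟨C', ⟨e1, fun T hT => ?_⟩, ?_, (e2 R).2 (Or.inl rfl), e3, e4, e5, e6⟩
  · rcases (e2 T).1 hT with rfl | h
    exacts [Or.inr ⟨h1, h2⟩, Or.inl h]
  intro P' Q' h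
  rcases e7 P' Q' h with ⟨rfl, rfl⟩ | ⟨rfl, rfl⟩ | ⟨h', -⟩
  · exact ⟨_, _, _, e5, hpq⟩
  · exact ⟨_, _, _, e6, hpq⟩
  · obtain ⟨a, b, E, hE, hab⟩ := hC _ _ h'
    exact ⟨a, b, E, isBox_of_extends e1 h'.left h'.right hE, hab⟩

/-- Adding a point `R` to an undecided rectangle, where all maps get the same new label. -/
theorem exists_label {C : Approx up dn K} (hC : C.Fine) {P Q R : X × Y} {p q r : L}
    {F : Set (X ≃o Y)} (hPQ : Consec C.S P Q) (hB : IsBox K C.ℓ P Q p q F)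
    (h1 : P.1 < R.1) (h2 : R.1 < Q.1) (h3 : P.2 < R.2) (h4 : R.2 < Q.2)
    (hpr : p < r) (hrq : r < q) (hcpr : Compatible up dn p r) (hcrq : Compatible up dn r q)
    (hup : ∀ f ∈ F, up r ↔ R.2 < f R.1) (hdn : ∀ f ∈ F, dn r ↔ f R.1 < R.2) :
    ∃ C' : Approx up dn K, C.ExtendsIn P Q C' ∧ C'.Fine ∧ R ∈ C'.S ∧ (∀ f ∈ F, C'.ℓ f R = r) ∧
      Consec C'.S P R ∧ Consec C'.S R Q ∧ IsBox K C'.ℓ P R p r F ∧ IsBox K C'.ℓ R Q r q F := by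
  obtain ⟨C', e1, e2, e2', e3, e4, e5, e6, e7⟩ := C.exists_insert hPQ hB h1 h2 h3 h4
    (fun _ => r) (fun _ _ => ⟨hpr.le, hrq.le⟩) hup hdn hpr hrq subset_rfl subset_rfl
    (fun _ _ => rfl) (fun _ _ => rfl) (fun f hf hf' => absurd hf hf')
    (fun f hf hf' => absurd hf hf')
  refine ⟨C', ⟨e1, fun T hT => ?_⟩, ?_, (e2 R).2 (Or.inl rfl), e2', e3, e4, e5, e6⟩
  · rcases (e2 T).1 hT with rfl | h
    exacts [Or.inr ⟨h1, h2⟩, Or.inl h]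
  intro P' Q' h
  rcases e7 P' Q' h with ⟨rfl, rfl⟩ | ⟨rfl, rfl⟩ | ⟨h', -⟩
  · exact ⟨_, _, _, e5, hcpr⟩
  · exact ⟨_, _, _, e6, hcrq⟩
  · obtain ⟨a, b, E, hE, hab⟩ := hC _ _ h'
    exact ⟨a, b, E, isBox_of_extends e1 h'.left h'.right hE, hab⟩

/-- Adding two points `A` and `B` to an undecided rectangle, with one new label for each of them.
The two points come together, since the label `s` need not be compatible with `q`. -/
theorem exists_two_labels {C : Approx up dn K} (hC : C.Fine) {P Q A B : X × Y} {p q s t : L}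
    {F : Set (X ≃o Y)} (hPQ : Consec C.S P Q) (hB : IsBox K C.ℓ P Q p q F)
    (hPA : P.1 < A.1) (hAB : A.1 < B.1) (hBQ : B.1 < Q.1)
    (hPA' : P.2 < A.2) (hAB' : A.2 < B.2) (hBQ' : B.2 < Q.2)
    (hps : p < s) (hst : s < t) (htq : t < q)
    (hcps : Compatible up dn p s) (hcst : Compatible up dn s t) (hctq : Compatible up dn t q)
    (hup : ∀ f ∈ F, up s ↔ A.2 < f A.1) (hdn : ∀ f ∈ F, dn s ↔ f A.1 < A.2)
    (hup' : ∀ f ∈ F, up t ↔ B.2 < f B.1) (hdn' : ∀ f ∈ F, dn t ↔ f B.1 < B.2) :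
    ∃ C' : Approx up dn K, C.ExtendsIn P Q C' ∧ C'.Fine ∧
      (∀ f ∈ F, (∃ R ∈ C'.S, C'.ℓ f R = s) ∧ ∃ R ∈ C'.S, C'.ℓ f R = t) ∧
      ∀ P' Q', Consec C.S P' Q' → Q.1 ≤ P'.1 → Consec C'.S P' Q' := by
  obtain ⟨C₁, e1, e2, e2', e3, e4, e5, e6, e7⟩ := C.exists_insert hPQ hB hPA (hAB.trans hBQ) hPA'
    (hAB'.trans hBQ') (fun _ => s) (fun _ _ => ⟨hps.le, (hst.trans htq).le⟩) hup hdn hps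
    (hst.trans htq) subset_rfl subset_rfl
    (fun _ _ => rfl) (fun _ _ => rfl) (fun f hf hf' => absurd hf hf')
    (fun f hf hf' => absurd hf hf')
  obtain ⟨C₂, g1, g2, g2', g3, g4, g5, g6, g7⟩ := C₁.exists_insert e4 e6 hAB hBQ hAB' hBQ'
    (fun _ => t) (fun _ _ => ⟨hst.le, htq.le⟩) hup' hdn' hst htq subset_rfl subset_rfl
    (fun _ _ => rfl) (fun _ _ => rfl) (fun f hf hf' => absurd hf hf')
    (fun f hf hf' => absurd hf hf')
  have hA : A ∈ C₁.S := (e2 A).2 (Or.inl rfl)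
  refine ⟨C₂, ⟨e1.trans g1, fun T hT => ?_⟩, ?_, fun f hf => ⟨⟨A, g1.1 hA, ?_⟩,
    B, (g2 B).2 (Or.inl rfl), g2' f hf⟩,
    fun P' Q' h hP' => ⟨(e1.trans g1).1 h.left, (e1.trans g1).1 h.right, h.lt, fun T hT => ?_⟩⟩
  · rcases (g2 T).1 hT with rfl | hT
    · exact Or.inr ⟨hPA.trans hAB, hBQ⟩
    rcases (e2 T).1 hT with rfl | hT
    · exact Or.inr ⟨hPA, hAB.trans hBQ⟩
    · exact Or.inl hT
  · intro P' Q' h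
    rcases g7 P' Q' h with ⟨rfl, rfl⟩ | ⟨rfl, rfl⟩ | ⟨h', hne⟩
    · exact ⟨_, _, _, g5, hcst⟩
    · exact ⟨_, _, _, g6, hctq⟩
    · rcases e7 P' Q' h' with ⟨rfl, rfl⟩ | h'' | ⟨h'', -⟩
      · exact ⟨_, _, _, isBox_of_extends g1 h'.left h'.right e5, hcps⟩
      · exact absurd h'' hne
      · obtain ⟨a, b, E, hE, hab⟩ := hC _ _ h''
        exact ⟨a, b, E, isBox_of_extends (e1.trans g1) h''.left h''.right hE, hab⟩
  · rw [g1.2 f (hB.subset hf) A hA, e2' f hf]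
  · rcases (g2 T).1 hT with rfl | hT
    · exact Or.inl (hBQ.le.trans hP')
    rcases (e2 T).1 hT with rfl | hT
    · exact Or.inl ((hAB.trans hBQ).le.trans hP')
    · exact h.gap T hT

variable [DenselyOrdered X] [DenselyOrdered Y]

/-- A rectangle which `h` enters below and leaves above the maps in `F` can be narrowed
at any point `(x, y)` in it: on both sides of `x` the graphs of the maps in `F` stay on the same
side of height `y` as at `x`. -/
theorem exists_corners (hK : FiniteValued K) (hud : ∀ r, up r → ¬ dn r)
    {C : Approx up dn K} (hC : C.Fine) {P Q : X × Y}
    {p q : L} {F : Set (X ≃o Y)} (hPQ : Consec C.S P Q) (hB : IsBox K C.ℓ P Q p q F)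
    (hp : up p) (hq : dn q) {x : X} {y : Y}
    (h1 : P.1 < x) (h2 : x < Q.1) (h3 : P.2 < y) (h4 : y < Q.2) :
    ∃ (C' : Approx up dn K) (R R' : X × Y), C.ExtendsIn P Q C' ∧ C'.Fine ∧ Consec C'.S R R' ∧
      IsBox K C'.ℓ R R' p q F ∧ P.1 ≤ R.1 ∧ R'.1 ≤ Q.1 ∧ R.1 < x ∧ x < R'.1 ∧ R.2 < y ∧ y < R'.2 ∧
      (∀ f ∈ F, y < f x → y < f R.1) ∧ (∀ f ∈ F, f x < y → f R'.1 < y) := by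
  have hc : Compatible up dn p q := ⟨fun h => hud q h.2 hq, fun h => hud p hp h.1⟩
  have hKF := hK.mono hB.subset
  have hPF : ∀ f ∈ F, P.2 < f P.1 := fun f hf =>
    (C.up_iff f (hB.subset hf) P hPQ.left).1 (by rwa [(hB.label f hf).1])
  have hQF : ∀ f ∈ F, f Q.1 < Q.2 := fun f hf =>
    (C.dn_iff f (hB.subset hf) Q hPQ.right).1 (by rwa [(hB.label f hf).2])
  obtain ⟨y', a1, a2, a3⟩ := exists_between_lt_finite h3 (hKF.apply P.1) hPF
  obtain ⟨x', b1, b2, b3⟩ := exists_between_gt_finite (F := {f ∈ F | y < f x}) h1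
    ((hK.mono ((sep_subset _ _).trans hB.subset)).symm_apply y)
    (fun f hf => (f.symm_apply_lt).2 hf.2)
  obtain ⟨C₁, e1, e2, e3, e4, e5, e6, e7⟩ := exists_split hC (R := (x', y')) hPQ hB hc b1
    (b2.trans h2) a1 (a2.trans h4) subset_rfl (fun f hf => Or.inl (a3 f hf))
    (fun f hf hf' => absurd hf hf')
  obtain ⟨y'', c1, c2, c3⟩ := exists_between_gt_finite h4 (hKF.apply Q.1) hQF
  obtain ⟨x'', d1, d2, d3⟩ := exists_between_lt_finite (F := {f ∈ F | f x < y}) h2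
    ((hK.mono ((sep_subset _ _).trans hB.subset)).symm_apply y)
    (fun f hf => (f.lt_symm_apply).2 hf.2)
  obtain ⟨C₂, g1, g2, g3, g4, g5, g6, g7⟩ := exists_split e2 (R := (x'', y'')) (F₁ := ∅) e5 e7 hc
    (b2.trans d1) d2 (a2.trans c1) c2 (empty_subset _) (fun f hf => absurd hf (notMem_empty _))
    (fun f hf _ => Or.inr (c3 f hf))
  rw [sdiff_empty] at g6
  exact ⟨C₂, _, _, e1.trans g1 b1.le le_rfl, g2, g4, g6, b1.le, d2.le, b2, d1, a2, c1,
    fun f hf h => (f.symm_apply_lt).1 (b3 f ⟨hf, h⟩),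
    fun f hf h => (f.lt_symm_apply).1 (d3 f ⟨hf, h⟩)⟩

/-- A point `R` inside a rectangle which `h` enters below and leaves above the maps in `F` can be
added if none of these maps passes through it. -/
theorem exists_mem_up_dn (hK : FiniteValued K) (hud : ∀ r, up r → ¬ dn r)
    {C : Approx up dn K} (hC : C.Fine) {P Q R : X × Y}
    {p q : L} {F : Set (X ≃o Y)} (hPQ : Consec C.S P Q) (hB : IsBox K C.ℓ P Q p q F)
    (hp : up p) (hq : dn q)
    (h1 : P.1 < R.1) (h2 : R.1 < Q.1) (h3 : P.2 < R.2) (h4 : R.2 < Q.2)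
    (hR : ∀ f ∈ F, f R.1 ≠ R.2) :
    ∃ C' : Approx up dn K, C.Extends C' ∧ C'.Fine ∧ R ∈ C'.S := by
  obtain ⟨C₁, T, T', e1, e2, e3, e4, -, -, e5, e6, e7, e8, e9, e10⟩ :=
    exists_corners hK hud hC hPQ hB hp hq h1 h2 h3 h4
  obtain ⟨C₂, g1, g2, g3, -⟩ := exists_split e2 (R := R) (F₁ := {f ∈ F | R.2 < f R.1}) e3 e4
    ⟨fun h => hud q h.2 hq, fun h => hud p hp h.1⟩ e5 e6 e7 e8 (sep_subset _ _)
    (fun f hf => Or.inl (e9 f hf.1 hf.2))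
    (fun f hf hf' => Or.inr (e10 f hf (lt_of_le_of_ne (not_lt.1 fun h => hf' ⟨hf, h⟩) (hR f hf))))
  exact ⟨C₂, e1.1.trans g1.1, g2, g3⟩

/-- In a rectangle which `h` enters below and leaves above the maps in `F`, all these maps can be
given two further labels `s` and `t`. The maps are treated one group at a time, grouped by their
value at a fixed point `x`: the graphs in the group of the smallest value get close to
each other on the left of `x`, so there `h` can pass above and then below all of them. -/
theorem exists_two_labels_up_dn (hK : FiniteValued K) (hud : ∀ r, up r → ¬ dn r)
    {p q s t : L} (hp : up p) (hq : dn q) (hs : dn s) (ht : up t)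
    (hps : p < s) (hst : s < t) (htq : t < q) (x : X) (n : ℕ) :
    ∀ (C : Approx up dn K), C.Fine → ∀ (P Q : X × Y) (F : Set (X ≃o Y)), Consec C.S P Q →
      IsBox K C.ℓ P Q p q F → P.1 < x → x < Q.1 → ((fun f : X ≃o Y => f x) '' F).ncard = n →
      ∃ C' : Approx up dn K, C.ExtendsIn P Q C' ∧ C'.Fine ∧
        ∀ f ∈ F, (∃ R ∈ C'.S, C'.ℓ f R = s) ∧ ∃ R ∈ C'.S, C'.ℓ f R = t := by
  induction n using Nat.strong_induction_on with
  | _ n ih =>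
  intro C hC P Q F hPQ hB h1 h2 hn
  rcases F.eq_empty_or_nonempty with rfl | hne
  · exact ⟨C, ExtendsIn.refl C P Q, hC, fun f hf => absurd hf (notMem_empty _)⟩
  have hKF := hK.mono hB.subset
  have hc : Compatible up dn p q := ⟨fun h => hud q h.2 hq, fun h => hud p hp h.1⟩
  have hPF : ∀ f ∈ F, P.2 < f P.1 := fun f hf =>
    (C.up_iff f (hB.subset hf) P hPQ.left).1 (by rwa [(hB.label f hf).1])
  have hQF : ∀ f ∈ F, f Q.1 < Q.2 := fun f hf =>
    (C.dn_iff f (hB.subset hf) Q hPQ.right).1 (by rwa [(hB.label f hf).2])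
  obtain ⟨_, ⟨f₀, hf₀, rfl⟩, hmin'⟩ := Set.exists_min_image _ id (hKF.apply x) (hne.image _)
  have hmin : ∀ f ∈ F, f₀ x ≤ f x := fun f hf => hmin' _ ⟨f, hf, rfl⟩
  set v := f₀ x with hv
  have hvQ : v < Q.2 := (f₀.strictMono h2).trans (hQF f₀ hf₀)
  have hvP : P.2 < v := (hPF f₀ hf₀).trans (f₀.strictMono h1)
  have hK1 : FiniteValued {f ∈ F | v < f x} := hKF.mono (sep_subset _ _)
  obtain ⟨y, y1, y2, y3⟩ := exists_between_lt_finite (F := {f ∈ F | v < f x}) hvQ (hK1.apply x)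
    (fun f hf => hf.2)
  obtain ⟨C₁, R, R', e1, e2, e3, e4, l1, l2, e5, e6, e7, e8, e9, e10⟩ :=
    exists_corners hK hud hC hPQ hB hp hq h1 h2 (hvP.trans y1) y2
  have hRF : ∀ f ∈ F, R.2 < f R.1 := fun f hf =>
    (C₁.up_iff f (hB.subset hf) R e3.left).1 (by rwa [(e4.label f hf).1])
  have hG : ∀ f ∈ F, f ∉ {f ∈ F | v < f x} → f x = v := fun f hf hf' =>
    le_antisymm (not_lt.1 fun h => hf' ⟨hf, h⟩) (hmin f hf)
  have hK2 : FiniteValued (F \ {f ∈ F | v < f x}) := hKF.mono sdiff_subset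
  have hf₀' : f₀ ∈ F \ {f ∈ F | v < f x} := ⟨hf₀, fun h => lt_irrefl _ h.2⟩
  have hRv : R.2 < v := (hRF f₀ hf₀).trans (f₀.strictMono e5)
  obtain ⟨b, b1, b2, b3⟩ := exists_between_gt_finite (F := F \ {f ∈ F | v < f x}) hRv
    (hK2.apply R.1) (fun f hf => (f.strictMono e5).trans_eq (hG f hf.1 hf.2))
  obtain ⟨a, a1, a2, a3⟩ := exists_between_lt_finite (F := F \ {f ∈ F | v < f x}) e5
    (hK2.symm_apply b) (fun f hf => (f.lt_symm_apply).2 (b3 f hf))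
  obtain ⟨d, d1, d2⟩ := exists_between b2
  obtain ⟨c, c1, c2, c3⟩ := exists_between_gt_finite (F := F \ {f ∈ F | v < f x}) a2
    (hK2.symm_apply d) (fun f hf => (f.symm_apply_lt).2 (d2.trans_eq (hG f hf.1 hf.2).symm))
  obtain ⟨x₁, x1, x2⟩ := exists_between c2
  obtain ⟨C₂, g1, g2, g3, g4, g5, g6, g7⟩ := exists_split e2 (R := (x₁, y))
    (F₁ := {f ∈ F | v < f x}) e3 e4 hc (a1.trans (c1.trans x1)) (x2.trans e6) e7 e8 (sep_subset _ _)
    (fun f hf => Or.inl (e9 f hf.1 (y3 f hf)))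
    (fun f hf hf' => Or.inr (e10 f hf ((hG f hf hf').trans_lt y1)))
  have hfa : ∀ f ∈ F \ {f ∈ F | v < f x}, f a < b := fun f hf => (f.lt_symm_apply).1 (a3 f hf)
  have hfc : ∀ f ∈ F \ {f ∈ F | v < f x}, d < f c := fun f hf => (f.symm_apply_lt).1 (c3 f hf)
  obtain ⟨C₃, k1, k2, k3, k4⟩ := exists_two_labels g2 (A := (a, b)) (B := (c, d)) g4 g6 a1 c1 x1 b1
    d1 (d2.trans y1) hps hst htq
    ⟨fun h => hud s h.2 hs, fun h => hud p hp h.1⟩ ⟨fun h => hud s h.1 hs, fun h => hud t ht h.2⟩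
    ⟨fun h => hud q h.2 hq, fun h => hud t ht h.1⟩
    (fun f hf => iff_of_false (fun h => hud s h hs) (hfa f hf).not_gt)
    (fun f hf => by simp [hfa f hf, hs])
    (fun f hf => by simp [hfc f hf, ht])
    (fun f hf => by simp [(hfc f hf).not_gt, hud t ht])
  have hlt : ((fun f : X ≃o Y => f x) '' {f ∈ F | v < f x}).ncard < n := by
    rw [← hn]
    refine Set.ncard_lt_ncard ⟨image_mono (sep_subset _ _), fun h => ?_⟩ (hKF.apply x)
    obtain ⟨f, hf, hf'⟩ := h ⟨f₀, hf₀, rfl⟩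
    exact hf.2.ne' hf'
  obtain ⟨C₄, m1, m2, m3⟩ := ih _ hlt C₃ k2 (x₁, y) R' {f ∈ F | v < f x}
    (k4 _ _ g5 le_rfl) (isBox_of_extends k1.1 g5.left g5.right g7) x2 e6 rfl
  refine ⟨C₄, ((e1.trans g1 l1 l2).trans k1 l1 (x2.trans h2).le).trans m1
    (l1.trans (a1.trans (c1.trans x1)).le) l2, m2, fun f hf => ?_⟩
  by_cases h : f ∈ {f ∈ F | v < f x}
  · exact m3 f h
  · obtain ⟨⟨A, hA, hA'⟩, B, hB', hB''⟩ := k3 f ⟨hf, h⟩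
    exact ⟨⟨A, m1.1.1 hA, by rw [m1.1.2 f (hB.subset hf) A hA, hA']⟩,
      B, m1.1.1 hB', by rw [m1.1.2 f (hB.subset hf) B hB', hB'']⟩

end Approx
end Approximation

/-! ### Adding prescribed points and labels -/

section Approximation

variable {X Y L : Type*} [LinearOrder X] [LinearOrder Y] [LinearOrder L]
variable [BoundedOrder X] [BoundedOrder Y] {up dn : L → Prop} {K : Set (X ≃o Y)}

namespace Approx

theorem eq_of_zero {C : Approx up dn K} {f : X ≃o Y} (hf : f ∈ K) {P : X × Y} (hP : P ∈ C.S)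
    (hu : ¬ up (C.ℓ f P)) (hd : ¬ dn (C.ℓ f P)) : f P.1 = P.2 := by
  rw [C.up_iff f hf P hP] at hu
  rw [C.dn_iff f hf P hP] at hd
  exact le_antisymm (not_lt.1 hu) (not_lt.1 hd)

/-- All the labels that are neither `up` nor `dn` are present in every approximation, so they do not
lie between the two labels of an undecided rectangle. -/
theorem up_or_dn_of_between {C : Approx up dn K} {P Q : X × Y} {p q r : L} {F : Set (X ≃o Y)}
    (hPQ : Consec C.S P Q) (hB : IsBox K C.ℓ P Q p q F) (hF : F.Nonempty) (hpr : p < r)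
    (hrq : r < q) : up r ∨ dn r := by
  by_contra h
  rw [not_or] at h
  obtain ⟨T, hT, hTr⟩ := C.zero r h.1 h.2
  obtain ⟨f, hf⟩ := hF
  have hfK := hB.subset hf
  rw [← (hB.label f hf).1, ← hTr f hfK] at hpr
  rw [← (hB.label f hf).2, ← hTr f hfK] at hrq
  rcases hPQ.gap T hT with h' | h'
  · exact absurd hpr (not_lt.2 (C.mono' hfK hT hPQ.left h'))
  · exact absurd hrq (not_lt.2 (C.mono' hfK hPQ.right hT h'))

theorem exists_consec (C : Approx up dn K) {P Q : X × Y} (hP : P ∈ C.S) (hQ : Q ∈ C.S)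
    {x : X} (hPx : P.1 < x) (hxQ : x < Q.1) (hx : ∀ R ∈ C.S, R.1 ≠ x) :
    ∃ P' Q', Consec C.S P' Q' ∧ P.1 ≤ P'.1 ∧ P'.1 < x ∧ x < Q'.1 ∧ Q'.1 ≤ Q.1 := by
  obtain ⟨P', hP', hmax⟩ := Finset.exists_max_image (C.S.filter fun R => R.1 < x) Prod.fst
    ⟨P, by simp [hP, hPx]⟩
  obtain ⟨Q', hQ', hmin⟩ := Finset.exists_min_image (C.S.filter fun R => x < R.1) Prod.fst
    ⟨Q, by simp [hQ, hxQ]⟩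
  simp only [Finset.mem_filter] at hP' hQ' hmax hmin
  refine ⟨P', Q', ⟨hP'.1, hQ'.1, hP'.2.trans hQ'.2, fun R hR => ?_⟩, hmax P ⟨hP, hPx⟩, hP'.2, hQ'.2,
    hmin Q ⟨hQ, hxQ⟩⟩
  rcases lt_or_gt_of_ne (hx R hR) with h | h
  · exact Or.inl (hmax R ⟨hR, h⟩)
  · exact Or.inr (hmin R ⟨hR, h⟩)

variable [DenselyOrdered X] [DenselyOrdered Y]

/-- A label of kind `up` can be added in a single point, if neither corner has a label of this
kind. -/
theorem exists_label_up (hK : FiniteValued K) (hud : ∀ r, up r → ¬ dn r) {C : Approx up dn K}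
    (hC : C.Fine) {P Q : X × Y} {p q r : L} {F : Set (X ≃o Y)} (hPQ : Consec C.S P Q)
    (hB : IsBox K C.ℓ P Q p q F) (hp : ¬ up p) (hq : ¬ up q) (hpq : ¬ (dn p ∧ dn q))
    (hpr : p < r) (hrq : r < q) (hr : up r) :
    ∃ (C' : Approx up dn K) (R : X × Y), C.ExtendsIn P Q C' ∧ C'.Fine ∧ R ∈ C'.S ∧
      P.1 ≤ R.1 ∧ R.1 ≤ Q.1 ∧
      (∀ f ∈ F, C'.ℓ f R = r) ∧ Consec C'.S P R ∧ Consec C'.S R Q ∧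
      IsBox K C'.ℓ P R p r F ∧ IsBox K C'.ℓ R Q r q F := by
  have hKF := hK.mono hB.subset
  obtain ⟨x, x1, x2, x3⟩ : ∃ x, P.1 < x ∧ x < Q.1 ∧ ∀ f ∈ F, P.2 < f x := by
    by_cases hdp : dn p
    · have hdq : ¬ dn q := fun h => hpq ⟨hdp, h⟩
      have hlt : ∀ f ∈ F, P.2 < f Q.1 := fun f hf => by
        rw [C.eq_of_zero (hB.subset hf) hPQ.right (by rwa [(hB.label f hf).2])
          (by rwa [(hB.label f hf).2])]
        exact C.snd_lt hPQ
      obtain ⟨x, x1, x2, x3⟩ := exists_between_gt_finite hPQ.lt (hKF.symm_apply P.2)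
        (fun f hf => (f.symm_apply_lt).2 (hlt f hf))
      exact ⟨x, x1, x2, fun f hf => (f.symm_apply_lt).1 (x3 f hf)⟩
    · obtain ⟨x, x1, x2⟩ := exists_between hPQ.lt
      refine ⟨x, x1, x2, fun f hf => ?_⟩
      rw [← C.eq_of_zero (hB.subset hf) hPQ.left (by rwa [(hB.label f hf).1])
          (by rwa [(hB.label f hf).1])]
      exact f.strictMono x1
  obtain ⟨y, y1, y2, y3⟩ := exists_between_lt_finite (C.snd_lt hPQ) (hKF.apply x) x3
  obtain ⟨C', e1, e2, e3, e4, e5, e6, e7, e8⟩ := exists_label hC (R := (x, y)) hPQ hB x1 x2 y1 y2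
    hpr hrq ⟨fun h => hp h.1, fun h => hud r hr h.2⟩ ⟨fun h => hq h.2, fun h => hud r hr h.1⟩
    (fun f hf => iff_of_true hr (y3 f hf)) (fun f hf => iff_of_false (hud r hr) (y3 f hf).not_gt)
  exact ⟨C', _, e1, e2, e3, x1.le, x2.le, e4, e5, e6, e7, e8⟩

/-- The counterpart of `exists_label_up` for labels of kind `dn`. -/
theorem exists_label_dn (hK : FiniteValued K) (hud : ∀ r, up r → ¬ dn r) {C : Approx up dn K}
    (hC : C.Fine) {P Q : X × Y} {p q r : L} {F : Set (X ≃o Y)} (hPQ : Consec C.S P Q)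
    (hB : IsBox K C.ℓ P Q p q F) (hp : ¬ dn p) (hq : ¬ dn q) (hpq : ¬ (up p ∧ up q))
    (hpr : p < r) (hrq : r < q) (hr : dn r) :
    ∃ (C' : Approx up dn K) (R : X × Y), C.ExtendsIn P Q C' ∧ C'.Fine ∧ R ∈ C'.S ∧
      P.1 ≤ R.1 ∧ R.1 ≤ Q.1 ∧
      (∀ f ∈ F, C'.ℓ f R = r) ∧ Consec C'.S P R ∧ Consec C'.S R Q ∧
      IsBox K C'.ℓ P R p r F ∧ IsBox K C'.ℓ R Q r q F := by
  have hKF := hK.mono hB.subset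
  obtain ⟨x, x1, x2, x3⟩ : ∃ x, P.1 < x ∧ x < Q.1 ∧ ∀ f ∈ F, f x < Q.2 := by
    by_cases huq : up q
    · have hup : ¬ up p := fun h => hpq ⟨h, huq⟩
      have hlt : ∀ f ∈ F, f P.1 < Q.2 := fun f hf => by
        rw [C.eq_of_zero (hB.subset hf) hPQ.left (by rwa [(hB.label f hf).1])
          (by rwa [(hB.label f hf).1])]
        exact C.snd_lt hPQ
      obtain ⟨x, x1, x2, x3⟩ := exists_between_lt_finite hPQ.lt (hKF.symm_apply Q.2)
        (fun f hf => (f.lt_symm_apply).2 (hlt f hf))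
      exact ⟨x, x1, x2, fun f hf => (f.lt_symm_apply).1 (x3 f hf)⟩
    · obtain ⟨x, x1, x2⟩ := exists_between hPQ.lt
      refine ⟨x, x1, x2, fun f hf => ?_⟩
      rw [← C.eq_of_zero (hB.subset hf) hPQ.right (by rwa [(hB.label f hf).2])
          (by rwa [(hB.label f hf).2])]
      exact f.strictMono x2
  obtain ⟨y, y1, y2, y3⟩ := exists_between_gt_finite (C.snd_lt hPQ) (hKF.apply x) x3
  obtain ⟨C', e1, e2, e3, e4, e5, e6, e7, e8⟩ := exists_label hC (R := (x, y)) hPQ hB x1 x2 y1 y2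
    hpr hrq ⟨fun h => hud r h.2 hr, fun h => hp h.1⟩ ⟨fun h => hud r h.1 hr, fun h => hq h.2⟩
    (fun f hf => iff_of_false (fun h => hud r h hr) (y3 f hf).not_gt)
    (fun f hf => iff_of_true hr (y3 f hf))
  exact ⟨C', _, e1, e2, e3, x1.le, x2.le, e4, e5, e6, e7, e8⟩

/-- Every label of kind `up` between the two labels of an undecided rectangle can be added. If one
of the corners has a label of kind `up` too, a label of kind `dn` has to be added in between; such
a label exists since the labels alternate. -/
theorem exists_label_of_up (hK : FiniteValued K) (hA : Alternating up dn) {C : Approx up dn K}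
    (hC : C.Fine) {P Q : X × Y} {p q r : L} {F : Set (X ≃o Y)} (hPQ : Consec C.S P Q)
    (hB : IsBox K C.ℓ P Q p q F) (hpq : Compatible up dn p q)
    (hpr : p < r) (hrq : r < q) (hr : up r) :
    ∃ C' : Approx up dn K, C.ExtendsIn P Q C' ∧ C'.Fine ∧ ∀ f ∈ F, ∃ R ∈ C'.S, C'.ℓ f R = r := by
  rcases F.eq_empty_or_nonempty with rfl | hne
  · exact ⟨C, ExtendsIn.refl C P Q, hC, fun f hf => absurd hf (notMem_empty _)⟩
  have hud := hA.disjoint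
  by_cases hp : up p
  · have hq : ¬ up q := fun h => hpq.1 ⟨hp, h⟩
    obtain ⟨s, hps, hsr, hs⟩ := hA.up_up p r hpr hp hr
    have hs' : dn s := (up_or_dn_of_between hPQ hB hne hps (hsr.trans hrq)).resolve_left hs
    by_cases hq' : dn q
    · obtain ⟨x, x1, x2⟩ := exists_between hPQ.lt
      obtain ⟨C', e1, e2, e3⟩ := exists_two_labels_up_dn hK hud hp hq' hs' hr hps hsr hrq x _ C hC P
        Q F hPQ hB x1 x2 rfl
      exact ⟨C', e1, e2, fun f hf => (e3 f hf).2⟩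
    · obtain ⟨C₁, R, e1, e2, e3, b1, b2, e4, e5, e6, e7, e8⟩ := exists_label_dn hK hud hC hPQ hB
        (hud p hp) hq' hpq.1 hps (hsr.trans hrq) hs'
      obtain ⟨C₂, T, g1, g2, g3, -, -, g4, -⟩ := exists_label_up hK hud e2 e6 e8 hs hq
        (fun h => hq' h.2) hsr hrq hr
      exact ⟨C₂, e1.trans g1 b1 le_rfl, g2, fun f hf => ⟨T, g3, g4 f hf⟩⟩
  · by_cases hq : up q
    · obtain ⟨s, hrs, hsq, hs⟩ := hA.up_up r q hrq hr hq
      have hs' : dn s := (up_or_dn_of_between hPQ hB hne (hpr.trans hrs) hsq).resolve_left hs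
      by_cases hp' : dn p
      · have hPQ' : Consec C.swap.S P.swap Q.swap := Consec.swap C.chain hPQ
        obtain ⟨y, y1, y2⟩ := exists_between (C.snd_lt hPQ)
        obtain ⟨C', e1, e2, e3⟩ := exists_of_swap (C := C) (p := fun C' =>
            (∀ T ∈ C'.S, T ∈ C.swap.S ∨ (P.swap.1 < T.1 ∧ T.1 < Q.swap.1)) ∧
            ∀ f ∈ {g : Y ≃o X | g.symm ∈ F}, ∃ R ∈ C'.S, C'.ℓ f R = r) (by
          obtain ⟨C', e1, e2, e3⟩ := exists_two_labels_up_dn (up := dn) (dn := up) hK.swap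
            hA.swap.disjoint hp' hq hr hs' hpr hrs hsq y _ C.swap hC.swap P.swap Q.swap _ hPQ'
            (isBox_swap hB) y1 y2 rfl
          exact ⟨C', e1.1, e2, e1.2, fun f hf => (e3 f hf).1⟩)
        refine ⟨C', ⟨e1, fun T hT => ?_⟩, e2, fun f hf => ?_⟩
        · rcases e3.1 T.swap (C'.mem_swap.2 hT) with h | h
          · exact Or.inl (C.mem_swap.1 h)
          · exact Or.inr ⟨(C'.chain P (e1.1 hPQ.left) T hT).2 h.1,
              (C'.chain T hT Q (e1.1 hPQ.right)).2 h.2⟩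
        · obtain ⟨R, hR, hR'⟩ := e3.2 f.symm hf
          exact ⟨R.swap, C'.mem_swap.1 hR, hR'⟩
      · obtain ⟨C₁, R, e1, e2, e3, b1, b2, e4, e5, e6, e7, e8⟩ := exists_label_dn hK hud hC hPQ hB
          hp' (hud q hq) hpq.1 (hpr.trans hrs) hsq hs'
        obtain ⟨C₂, T, g1, g2, g3, -, -, g4, -⟩ := exists_label_up hK hud e2 e5 e7 hp hs
          (fun h => hp' h.1) hpr hrs hr
        exact ⟨C₂, e1.trans g1 le_rfl b2, g2, fun f hf => ⟨T, g3, g4 f hf⟩⟩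
    · obtain ⟨C₁, R, e1, e2, e3, b1, b2, e4, -⟩ := exists_label_up hK hud hC hPQ hB
        hp hq hpq.2 hpr hrq hr
      exact ⟨C₁, e1, e2, fun f hf => ⟨R, e3, e4 f hf⟩⟩

/-- Every label between the two labels of an undecided rectangle can be added. -/
theorem exists_label_of_between (hK : FiniteValued K) (hA : Alternating up dn) {C : Approx up dn K}
    (hC : C.Fine) {P Q : X × Y} {p q r : L} {F : Set (X ≃o Y)} (hPQ : Consec C.S P Q)
    (hB : IsBox K C.ℓ P Q p q F) (hpq : Compatible up dn p q)
    (hpr : p < r) (hrq : r < q) :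
    ∃ C' : Approx up dn K, C.ExtendsIn P Q C' ∧ C'.Fine ∧ ∀ f ∈ F, ∃ R ∈ C'.S, C'.ℓ f R = r := by
  rcases F.eq_empty_or_nonempty with rfl | hne
  · exact ⟨C, ExtendsIn.refl C P Q, hC, fun f hf => absurd hf (notMem_empty _)⟩
  rcases up_or_dn_of_between hPQ hB hne hpr hrq with h | h
  · exact exists_label_of_up hK hA hC hPQ hB hpq hpr hrq h
  · have hPQ' : Consec C.swap.S P.swap Q.swap := Consec.swap C.chain hPQ
    obtain ⟨C', e1, e2, e3⟩ := exists_of_swap (C := C) (p := fun C' =>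
        (∀ T ∈ C'.S, T ∈ C.swap.S ∨ (P.swap.1 < T.1 ∧ T.1 < Q.swap.1)) ∧
        ∀ f ∈ {g : Y ≃o X | g.symm ∈ F}, ∃ R ∈ C'.S, C'.ℓ f R = r) (by
      obtain ⟨C', e1, e2, e3⟩ := exists_label_of_up (up := dn) (dn := up) hK.swap
        hA.swap hC.swap hPQ' (isBox_swap hB) ⟨hpq.2, hpq.1⟩ hpr hrq h
      exact ⟨C', e1.1, e2, e1.2, e3⟩)
    refine ⟨C', ⟨e1, fun T hT => ?_⟩, e2, fun f hf => ?_⟩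
    · rcases e3.1 T.swap (C'.mem_swap.2 hT) with h | h
      · exact Or.inl (C.mem_swap.1 h)
      · exact Or.inr ⟨(C'.chain P (e1.1 hPQ.left) T hT).2 h.1,
          (C'.chain T hT Q (e1.1 hPQ.right)).2 h.2⟩
    · obtain ⟨R, hR, hR'⟩ := e3.2 f.symm hf
      exact ⟨R.swap, C'.mem_swap.1 hR, hR'⟩

/-- The lower corners of the rectangles of `C` in which the label `r` is missing for some map. -/
def missing (C : Approx up dn K) (r : L) : Set (X × Y) :=
  {P | ∃ Q, Consec C.S P Q ∧ ∃ f ∈ K, C.ℓ f P < r ∧ r < C.ℓ f Q}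

/-- Every label can be added for all maps in `K`: treat the rectangles one after the other. -/
theorem exists_label_forall (hK : FiniteValued K) (hA : Alternating up dn) (r : L) (n : ℕ) :
    ∀ C : Approx up dn K, C.Fine → (∀ f ∈ K, C.ℓ f (⊥, ⊥) ≤ r) → (∀ f ∈ K, r ≤ C.ℓ f (⊤, ⊤)) →
    (C.missing r).ncard = n →
    ∃ C' : Approx up dn K, C.Extends C' ∧ C'.Fine ∧ ∀ f ∈ K, ∃ R ∈ C'.S, C'.ℓ f R = r := by
  induction n using Nat.strong_induction_on with
  | _ n ih =>
  intro C hC hbot htop hn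
  rcases (C.missing r).eq_empty_or_nonempty with hem | ⟨P, Q, hPQ, f₀, hf₀, h1, h2⟩
  · refine ⟨C, Extends.refl C, hC, fun f hf => ?_⟩
    by_contra hcon
    push Not at hcon
    -- the last point with a label below `r` and the first point with a label above `r`
    obtain ⟨P, hP, hmax⟩ := Finset.exists_max_image (C.S.filter fun R => C.ℓ f R < r) Prod.fst
      ⟨(⊥, ⊥), by simpa [C.bot] using lt_of_le_of_ne (hbot f hf) (hcon _ C.bot)⟩
    obtain ⟨Q, hQ, hmin⟩ := Finset.exists_min_image (C.S.filter fun R => r < C.ℓ f R) Prod.fst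
      ⟨(⊤, ⊤), by simpa [C.top] using lt_of_le_of_ne (htop f hf) (hcon _ C.top).symm⟩
    simp only [Finset.mem_filter] at hP hQ hmax hmin
    have : P ∈ C.missing r := by
      refine ⟨Q, ⟨hP.1, hQ.1, not_le.1 fun h => ?_, fun R hR => ?_⟩, f, hf, hP.2, hQ.2⟩
      · exact absurd (C.mono' hf hQ.1 hP.1 h) (not_le.2 (hP.2.trans hQ.2))
      · rcases lt_or_gt_of_ne (hcon R hR) with h | h
        · exact Or.inl (hmax R ⟨hR, h⟩)
        · exact Or.inr (hmin R ⟨hR, h⟩)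
    rw [hem] at this
    exact this
  · obtain ⟨p, q, F, hB, hpq⟩ := hC P Q hPQ
    have hf₀F : ∀ f ∈ K, C.ℓ f P < r → r < C.ℓ f Q → f ∈ F := fun f hf h h' => by
      by_contra hF
      exact (h.trans h').ne (hB.avoids f hf hF).1
    have hl := hB.label f₀ (hf₀F f₀ hf₀ h1 h2)
    obtain ⟨C₁, e1, e2, e3⟩ := exists_label_of_between hK hA hC hPQ hB hpq
      (hl.1 ▸ h1) (hl.2 ▸ h2)
    have hfin : (C.missing r).Finite := C.S.finite_toSet.subset fun P ⟨Q, h, _⟩ => h.left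
    -- no rectangle between `P` and `Q` misses `r` any longer
    have hdone : ∀ P' Q', Consec C₁.S P' Q' → P.1 ≤ P'.1 → Q'.1 ≤ Q.1 → ∀ f ∈ K,
        C₁.ℓ f P' < r → r < C₁.ℓ f Q' → False := by
      intro P' Q' h hP hQ f hf h3 h4
      have hfF : f ∈ F := by
        refine hf₀F f hf ?_ ?_
        · rw [← e1.1.2 f hf P hPQ.left]
          exact (C₁.mono' hf (e1.1.1 hPQ.left) h.left hP).trans_lt h3
        · rw [← e1.1.2 f hf Q hPQ.right]
          exact h4.trans_le (C₁.mono' hf h.right (e1.1.1 hPQ.right) hQ)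
      obtain ⟨R, hR, hRr⟩ := e3 f hfF
      rcases h.gap R hR with h' | h'
      · exact absurd (C₁.mono' hf hR h.left h') (by rw [hRr]; exact not_le.2 h3)
      · exact absurd (C₁.mono' hf h.right hR h') (by rw [hRr]; exact not_le.2 h4)
    have hsub : C₁.missing r ⊆ C.missing r \ {P} := by
      rintro P' ⟨Q', h, f, hf, h3, h4⟩
      have hout : ¬ (P.1 ≤ P'.1 ∧ Q'.1 ≤ Q.1) := fun h' => hdone P' Q' h h'.1 h'.2 f hf h3 h4
      have hP' : P' ∈ C.S := by
        refine (e1.2 P' h.left).resolve_right fun h' => hout ⟨h'.1.le, ?_⟩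
        exact (h.gap Q (e1.1.1 hPQ.right)).resolve_left (not_le.2 h'.2)
      have hQ' : Q' ∈ C.S := by
        refine (e1.2 Q' h.right).resolve_right fun h' => hout ⟨?_, h'.2.le⟩
        exact (h.gap P (e1.1.1 hPQ.left)).resolve_right (not_le.2 h'.1)
      refine ⟨⟨Q', ⟨hP', hQ', h.lt, fun T hT => h.gap T (e1.1.1 hT)⟩, f, hf, ?_, ?_⟩, ?_⟩
      · rwa [← e1.1.2 f hf P' hP']
      · rwa [← e1.1.2 f hf Q' hQ']
      · rintro rfl
        refine hout ⟨le_rfl, ?_⟩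
        exact (h.gap Q (e1.1.1 hPQ.right)).resolve_left (not_le.2 hPQ.lt)
    have hlt : (C₁.missing r).ncard < n := by
      rw [← hn]
      refine Set.ncard_lt_ncard ⟨hsub.trans sdiff_subset, fun h => ?_⟩ hfin
      exact (hsub (h ⟨Q, hPQ, f₀, hf₀, h1, h2⟩)).2 rfl
    obtain ⟨C₂, g1, g2, g3⟩ := ih _ hlt C₁ e2
      (fun f hf => by rw [e1.1.2 f hf _ C.bot]; exact hbot f hf)
      (fun f hf => by rw [e1.1.2 f hf _ C.top]; exact htop f hf) rfl
    exact ⟨C₂, e1.1.trans g1, g2, g3⟩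

/-- Every point of `X` can be added to the domain. -/
theorem exists_fst (hK : FiniteValued K) (hA : Alternating up dn) {C : Approx up dn K}
    (hC : C.Fine) (x : X) :
    ∃ C' : Approx up dn K, C.Extends C' ∧ C'.Fine ∧ ∃ R ∈ C'.S, R.1 = x := by
  by_cases hx : ∃ R ∈ C.S, R.1 = x
  · exact ⟨C, Extends.refl C, hC, hx⟩
  push Not at hx
  have hud := hA.disjoint
  obtain ⟨P, Q, hPQ, -, h1, h2, -⟩ := C.exists_consec C.bot C.top (x := x)
    (bot_le.lt_of_ne (hx _ C.bot)) (le_top.lt_of_ne (hx _ C.top).symm) hx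
  obtain ⟨p, q, F, hB, hpq⟩ := hC P Q hPQ
  have hKF := hK.mono hB.subset
  have h3 := C.snd_lt hPQ
  have hPz : ¬ up p → ¬ dn p → ∀ f ∈ F, f P.1 = P.2 := fun hu hd f hf =>
    C.eq_of_zero (hB.subset hf) hPQ.left (by rwa [(hB.label f hf).1]) (by rwa [(hB.label f hf).1])
  have hQz : ¬ up q → ¬ dn q → ∀ f ∈ F, f Q.1 = Q.2 := fun hu hd f hf =>
    C.eq_of_zero (hB.subset hf) hPQ.right (by rwa [(hB.label f hf).2]) (by rwa [(hB.label f hf).2])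
  have hPu : up p → ∀ f ∈ F, P.2 < f P.1 := fun h f hf =>
    (C.up_iff f (hB.subset hf) P hPQ.left).1 (by rwa [(hB.label f hf).1])
  have hPd : dn p → ∀ f ∈ F, f P.1 < P.2 := fun h f hf =>
    (C.dn_iff f (hB.subset hf) P hPQ.left).1 (by rwa [(hB.label f hf).1])
  have hQu : up q → ∀ f ∈ F, Q.2 < f Q.1 := fun h f hf =>
    (C.up_iff f (hB.subset hf) Q hPQ.right).1 (by rwa [(hB.label f hf).2])
  have hQd : dn q → ∀ f ∈ F, f Q.1 < Q.2 := fun h f hf =>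
    (C.dn_iff f (hB.subset hf) Q hPQ.right).1 (by rwa [(hB.label f hf).2])
  by_cases hpu : up p
  · by_cases hqd : dn q
    · obtain ⟨y, y1, y2, y3⟩ := exists_between_lt_finite (F := {f ∈ F | P.2 < f x}) h3
        ((hKF.mono (sep_subset _ _)).apply x) (fun f hf => hf.2)
      obtain ⟨C', e1, e2, e3⟩ := exists_mem_up_dn (R := (x, y)) hK hud hC hPQ hB hpu hqd h1 h2 y1 y2
        (fun f hf h => (y3 f ⟨hf, y1.trans_eq h.symm⟩).ne' h)
      exact ⟨C', e1, e2, _, e3, rfl⟩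
    · obtain ⟨y, y1, y2, y3⟩ := exists_between_lt_finite h3 (hKF.apply P.1) (hPu hpu)
      obtain ⟨C', e1, e2, e3, -⟩ := exists_split (R := (x, y)) hC hPQ hB hpq h1 h2 y1 y2 subset_rfl
        (fun f hf => Or.inl (y3 f hf)) (fun f hf hf' => absurd hf hf')
      exact ⟨C', e1.1, e2, _, e3, rfl⟩
  by_cases hqd : dn q
  · obtain ⟨y, y1, y2, y3⟩ := exists_between_gt_finite h3 (hKF.apply Q.1) (hQd hqd)
    obtain ⟨C', e1, e2, e3, -⟩ := exists_split (R := (x, y)) (F₁ := ∅) hC hPQ hB hpq h1 h2 y1 y2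
      (empty_subset _) (fun f hf => absurd hf (notMem_empty _))
      (fun f hf hf' => Or.inr (y3 f hf))
    exact ⟨C', e1.1, e2, _, e3, rfl⟩
  by_cases hpd : dn p
  · by_cases hqu : up q
    · obtain ⟨y, y1, y2, y3⟩ := exists_between_lt_finite (F := {f ∈ F | P.2 < f x}) h3
        ((hKF.mono (sep_subset _ _)).apply x) (fun f hf => hf.2)
      obtain ⟨C', e1, e2, e3⟩ := exists_of_swap (C := C) (p := fun C' => (y, x) ∈ C'.S)
        (exists_mem_up_dn (R := (y, x)) hK.swap hA.swap.disjoint hC.swap (Consec.swap C.chain hPQ)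
          (isBox_swap hB) hpd hqu y1 y2 h1 h2 (fun f hf h => by
            have : f.symm x = y := by rw [f.symm_apply_eq]; exact h.symm
            exact (y3 f.symm ⟨hf, y1.trans_eq this.symm⟩).ne' this))
      exact ⟨C', e1, e2, (x, y), C'.mem_swap.1 e3, rfl⟩
    · obtain ⟨x₁, x1, x2, x3⟩ := exists_between_lt_finite h1 (hKF.symm_apply P.2)
        (fun f hf => (f.lt_symm_apply).2 (hPd hpd f hf))
      obtain ⟨y₁, y1, y2, y3⟩ := exists_between_gt_finite h3 (hKF.apply x)
        (fun f hf => (f.strictMono h2).trans_eq (hQz hqu hqd f hf))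
      obtain ⟨y₂, y4, y5⟩ := exists_between y2
      obtain ⟨C₁, e1, e2, e3, e4, e5, e6, e7⟩ := exists_split (R := (x₁, y₁)) hC hPQ hB hpq x1
        (x2.trans h2) y1 y2 subset_rfl
        (fun f hf => Or.inr ((f.lt_symm_apply).1 (x3 f hf))) (fun f hf hf' => absurd hf hf')
      obtain ⟨C₂, g1, g2, g3, -⟩ := exists_split (R := (x, y₂)) e2 e5 e7 hpq x2 h2 y4 y5 subset_rfl
        (fun f hf => Or.inr (y3 f hf)) (fun f hf hf' => absurd hf hf')
      exact ⟨C₂, e1.1.trans g1.1, g2, _, g3, rfl⟩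
  by_cases hqu : up q
  · obtain ⟨x₁, x1, x2, x3⟩ := exists_between_gt_finite h2 (hKF.symm_apply Q.2)
      (fun f hf => (f.symm_apply_lt).2 (hQu hqu f hf))
    obtain ⟨y₁, y1, y2, y3⟩ := exists_between_lt_finite h3 (hKF.apply x)
      (fun f hf => (hPz hpu hpd f hf).symm.trans_lt (f.strictMono h1))
    obtain ⟨y₂, y4, y5⟩ := exists_between y1
    obtain ⟨C₁, e1, e2, e3, e4, e5, e6, e7⟩ := exists_split (R := (x₁, y₁)) (F₁ := ∅) hC hPQ hB hpq
      (h1.trans x1) x2 y1 y2 (empty_subset _) (fun f hf => absurd hf (notMem_empty _))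
      (fun f hf _ => Or.inl ((f.symm_apply_lt).1 (x3 f hf)))
    obtain ⟨C₂, g1, g2, g3, -⟩ := exists_split (R := (x, y₂)) (F₁ := ∅) e2 e4 e6 hpq h1 x1 y4 y5
      (empty_subset _) (fun f hf => absurd hf (notMem_empty _))
      (fun f hf _ => Or.inl (y3 f hf.1))
    exact ⟨C₂, e1.1.trans g1.1, g2, _, g3, rfl⟩
  obtain ⟨s, hps, hsq, hs | hs⟩ := hA.zero_zero p q hB.lt hpu hpd hqu hqd
  · obtain ⟨y, y1, y2, y3⟩ := exists_between_lt_finite h3 (hKF.apply x)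
      (fun f hf => (hPz hpu hpd f hf).symm.trans_lt (f.strictMono h1))
    obtain ⟨C', e1, e2, e3, -⟩ := exists_label hC (R := (x, y)) hPQ hB h1 h2 y1 y2
      hps hsq ⟨fun h => hpu h.1, fun h => hpd h.1⟩ ⟨fun h => hqu h.2, fun h => hqd h.2⟩
      (fun f hf => iff_of_true hs (y3 f hf)) (fun f hf => iff_of_false (hud s hs) (y3 f hf).not_gt)
    exact ⟨C', e1.1, e2, _, e3, rfl⟩
  · obtain ⟨y, y1, y2, y3⟩ := exists_between_gt_finite h3 (hKF.apply x)
      (fun f hf => (f.strictMono h2).trans_eq (hQz hqu hqd f hf))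
    obtain ⟨C', e1, e2, e3, -⟩ := exists_label hC (R := (x, y)) hPQ hB h1 h2 y1 y2
      hps hsq ⟨fun h => hpu h.1, fun h => hpd h.1⟩ ⟨fun h => hqu h.2, fun h => hqd h.2⟩
      (fun f hf => iff_of_false (fun h => hud s h hs) (y3 f hf).not_gt)
      (fun f hf => iff_of_true hs (y3 f hf))
    exact ⟨C', e1.1, e2, _, e3, rfl⟩

/-- Every point of `Y` can be added to the range. -/
theorem exists_snd (hK : FiniteValued K) (hA : Alternating up dn) {C : Approx up dn K}
    (hC : C.Fine) (y : Y) :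
    ∃ C' : Approx up dn K, C.Extends C' ∧ C'.Fine ∧ ∃ R ∈ C'.S, R.2 = y := by
  obtain ⟨C', e1, e2, R, e3, e4⟩ := exists_of_swap (C := C) (p := fun C' => ∃ R ∈ C'.S, R.1 = y)
    (exists_fst hK.swap hA.swap hC.swap y)
  exact ⟨C', e1, e2, R.swap, C'.mem_swap.1 e3, e4⟩

end Approx
end Approximation

/-! ### The limit of the approximations -/

section Labelling

variable {X L : Type*} [LinearOrder X] [LinearOrder L]

/-- The map `c` labels the points of `X` by the orbitals of `φ`: its fibres are the
orbitals, and the labels of kind `up` and `dn` are those of the orbitals on which `φ` moves points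
up and down. -/
structure IsOrbitalLabelling (up dn : L → Prop) (φ : X ≃o X) (c : X → L) : Prop where
  mono : Monotone c
  surj : Function.Surjective c
  up_iff : ∀ x, up (c x) ↔ x < φ x
  dn_iff : ∀ x, dn (c x) ↔ φ x < x
  up_orbit : ∀ x x', x < x' → c x = c x' → up (c x) → ∃ n : ℕ, x' < (φ ^ n) x
  dn_orbit : ∀ x x', x < x' → c x = c x' → dn (c x) → ∃ n : ℕ, (φ ^ n) x' < x
  up_or_dn : ∀ x x', x < x' → c x = c x' → up (c x) ∨ dn (c x)

end Labelling

section Approximation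

variable {X Y L : Type*} [LinearOrder X] [LinearOrder Y] [LinearOrder L]
variable [BoundedOrder X] [BoundedOrder Y] {up dn : L → Prop} {K : Set (X ≃o Y)}

namespace Approx

theorem avoids_of_label_eq {C : Approx up dn K} {P Q : X × Y} (h : Consec C.S P Q) {f : X ≃o Y}
    (hf : f ∈ K) (hl : C.ℓ f P = C.ℓ f Q) : Avoids f P Q := by
  obtain ⟨p, q, F, hB⟩ := C.box P Q h
  by_cases hfF : f ∈ F
  · have := hB.label f hfF
    rw [hl, this.2] at this
    exact absurd this.1 hB.lt.ne'
  · exact (hB.avoids f hf hfF).2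

theorem exists_succ (C : Approx up dn K) {P Q : X × Y} (hP : P ∈ C.S) (hQ : Q ∈ C.S)
    (h : P.1 < Q.1) : ∃ R, Consec C.S P R ∧ R.1 ≤ Q.1 := by
  obtain ⟨R, hR, hmin⟩ := Finset.exists_min_image (C.S.filter fun R => P.1 < R.1) Prod.fst
    ⟨Q, by simp [hQ, h]⟩
  simp only [Finset.mem_filter] at hR hmin
  exact ⟨R, ⟨hP, hR.1, hR.2, fun T hT => (le_or_gt T.1 P.1).imp_right fun h' => hmin T ⟨hT, h'⟩⟩,
    hmin Q ⟨hQ, h⟩⟩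

theorem exists_pred (C : Approx up dn K) {P Q : X × Y} (hP : P ∈ C.S) (hQ : Q ∈ C.S)
    (h : P.1 < Q.1) : ∃ R, Consec C.S R Q ∧ P.1 ≤ R.1 := by
  obtain ⟨R, hR, hmax⟩ := Finset.exists_max_image (C.S.filter fun R => R.1 < Q.1) Prod.fst
    ⟨P, by simp [hP, h]⟩
  simp only [Finset.mem_filter] at hR hmax
  exact ⟨R, ⟨hR.1, hQ, hR.2, fun T hT => (lt_or_ge T.1 Q.1).imp_left fun h' => hmax T ⟨hT, h'⟩⟩,
    hmax P ⟨hP, h⟩⟩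

/-- Along points of equal label of kind `up`, the map `φ = h⁻¹ f` moves past each point in
finitely many steps. -/
theorem exists_lt_pow {C : Approx up dn K} {f : X ≃o Y} (hf : f ∈ K) (h : X ≃o Y)
    (hh : ∀ P ∈ C.S, h P.1 = P.2) {P Q : X × Y} (hP : P ∈ C.S) (hQ : Q ∈ C.S) (hPQ : P.1 < Q.1)
    (hl : C.ℓ f P = C.ℓ f Q) (hu : up (C.ℓ f P)) :
    ∃ n : ℕ, Q.1 < ((f.trans h.symm : X ≃o X) ^ n) P.1 := by
  classical
  set φ : X ≃o X := f.trans h.symm with hφ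
  obtain ⟨T, hT, hmax⟩ := Finset.exists_max_image
    (C.S.filter fun T => P.1 ≤ T.1 ∧ T.1 ≤ Q.1 ∧ ∃ n : ℕ, T.1 ≤ (φ ^ n) P.1) Prod.fst
    ⟨P, by simp only [Finset.mem_filter]; exact ⟨hP, le_rfl, hPQ.le, 0, le_rfl⟩⟩
  simp only [Finset.mem_filter] at hT hmax
  obtain ⟨hT, hPT, hTQ, n, hn⟩ := hT
  have hlT : ∀ T ∈ C.S, P.1 ≤ T.1 → T.1 ≤ Q.1 → C.ℓ f T = C.ℓ f P := fun T hT h1 h2 =>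
    le_antisymm (hl ▸ C.mono' hf hT hQ h2) (C.mono' hf hP hT h1)
  have hsucc : ∀ z, z ≤ (φ ^ n) P.1 → φ z ≤ (φ ^ (n + 1)) P.1 := fun z hz => by
    rw [pow_succ', RelIso.mul_apply]; exact φ.monotone hz
  rcases hTQ.lt_or_eq with hlt | heq
  · obtain ⟨R, hR, hRQ⟩ := C.exists_succ hT hQ hlt
    have hRP := hPT.trans hR.lt.le
    have hav : R.2 < f T.1 := by
      refine (C.avoids_of_label_eq hR hf ((hlT T hT hPT hTQ).trans
        (hlT R hR.right hRP hRQ).symm)).resolve_right fun h' => ?_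
      have h1 := (C.up_iff f hf T hT).1 (by rwa [hlT T hT hPT hTQ])
      exact absurd (h1.trans (f.strictMono hR.lt)) h'.not_gt
    have : R.1 ≤ φ T.1 := by
      rw [← hh R hR.right] at hav
      exact ((h.lt_symm_apply).2 hav).le
    exact absurd (hmax R ⟨hR.right, hRP, hRQ, n + 1, this.trans (hsucc _ hn)⟩) (not_le.2 hR.lt)
  · refine ⟨n + 1, lt_of_lt_of_le ?_ (hsucc _ hn)⟩
    rw [← heq]
    have h1 := (C.up_iff f hf T hT).1 (by rwa [hlT T hT hPT hTQ])
    rw [← hh T hT] at h1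
    exact (h.lt_symm_apply).2 h1

/-- The counterpart of `exists_lt_pow` for labels of kind `dn`. -/
theorem exists_pow_lt {C : Approx up dn K} {f : X ≃o Y} (hf : f ∈ K) (h : X ≃o Y)
    (hh : ∀ P ∈ C.S, h P.1 = P.2) {P Q : X × Y} (hP : P ∈ C.S) (hQ : Q ∈ C.S) (hPQ : P.1 < Q.1)
    (hl : C.ℓ f P = C.ℓ f Q) (hd : dn (C.ℓ f P)) :
    ∃ n : ℕ, ((f.trans h.symm : X ≃o X) ^ n) Q.1 < P.1 := by
  classical
  set φ : X ≃o X := f.trans h.symm with hφ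
  obtain ⟨T, hT, hmin⟩ := Finset.exists_min_image
    (C.S.filter fun T => P.1 ≤ T.1 ∧ T.1 ≤ Q.1 ∧ ∃ n : ℕ, (φ ^ n) Q.1 ≤ T.1) Prod.fst
    ⟨Q, by simp only [Finset.mem_filter]; exact ⟨hQ, hPQ.le, le_rfl, 0, le_rfl⟩⟩
  simp only [Finset.mem_filter] at hT hmin
  obtain ⟨hT, hPT, hTQ, n, hn⟩ := hT
  have hlT : ∀ T ∈ C.S, P.1 ≤ T.1 → T.1 ≤ Q.1 → C.ℓ f T = C.ℓ f P := fun T hT h1 h2 =>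
    le_antisymm (hl ▸ C.mono' hf hT hQ h2) (C.mono' hf hP hT h1)
  have hsucc : ∀ z, (φ ^ n) Q.1 ≤ z → (φ ^ (n + 1)) Q.1 ≤ φ z := fun z hz => by
    rw [pow_succ', RelIso.mul_apply]; exact φ.monotone hz
  rcases hPT.lt_or_eq with hlt | heq
  · obtain ⟨R, hR, hPR⟩ := C.exists_pred hP hT hlt
    have hRQ := hR.lt.le.trans hTQ
    have hav : f T.1 < R.2 := by
      refine (C.avoids_of_label_eq hR hf ((hlT R hR.left hPR hRQ).trans
        (hlT T hT hPT hTQ).symm)).resolve_left fun h' => ?_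
      have h1 := (C.dn_iff f hf T hT).1 (by rwa [hlT T hT hPT hTQ])
      exact absurd ((f.strictMono hR.lt).trans h1) h'.not_gt
    have : φ T.1 ≤ R.1 := by
      rw [← hh R hR.left] at hav
      exact ((h.symm_apply_lt).2 hav).le
    exact absurd (hmin R ⟨hR.left, hPR, hRQ, n + 1, (hsucc _ hn).trans this⟩) (not_le.2 hR.lt)
  · refine ⟨n + 1, lt_of_le_of_lt (hsucc _ hn) ?_⟩
    rw [heq]
    have h1 := (C.dn_iff f hf T hT).1 (by rwa [hlT T hT hPT hTQ])
    rw [← hh T hT] at h1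
    exact (h.symm_apply_lt).2 h1

variable [DenselyOrdered X] [DenselyOrdered Y] [Countable X] [Countable Y] [Countable L]

/-- A fine approximation in which all maps have the least label at `⊥` and the greatest label
at `⊤` extends to an isomorphism `h` such that all the maps `h⁻¹ f`, `f ∈ K`, have their orbitals
labelled by `L`. -/
theorem exists_isOrbitalLabelling (hK : FiniteValued K) (hA : Alternating up dn)
    (C₀ : Approx up dn K) (hC₀ : C₀.Fine) (hbot : ∀ f ∈ K, ∀ r, C₀.ℓ f (⊥, ⊥) ≤ r)
    (htop : ∀ f ∈ K, ∀ r, r ≤ C₀.ℓ f (⊤, ⊤)) :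
    ∃ h : X ≃o Y, ∀ f ∈ K, ∃ c : X → L, IsOrbitalLabelling up dn (f.trans h.symm : X ≃o X) c := by
  classical
  -- the countably many requirements: every point of `X` is in the domain, every point of `Y` is in
  -- the range, and every label is used
  let D : X ⊕ Y ⊕ L → Approx up dn K → Prop := fun i C => match i with
    | Sum.inl x => ∃ R ∈ C.S, R.1 = x
    | Sum.inr (Sum.inl y) => ∃ R ∈ C.S, R.2 = y
    | Sum.inr (Sum.inr r) => ∀ f ∈ K, ∃ R ∈ C.S, C.ℓ f R = r
  have hD : ∀ (i) (C : {C : Approx up dn K // C.Fine ∧ C₀.Extends C}),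
      ∃ C' : {C : Approx up dn K // C.Fine ∧ C₀.Extends C}, C.1.Extends C'.1 ∧ D i C'.1 := by
    rintro (x | y | r) ⟨C, hC, hC'⟩
    · obtain ⟨C', e1, e2, e3⟩ := exists_fst hK hA hC x
      exact ⟨⟨C', e2, hC'.trans e1⟩, e1, e3⟩
    · obtain ⟨C', e1, e2, e3⟩ := exists_snd hK hA hC y
      exact ⟨⟨C', e2, hC'.trans e1⟩, e1, e3⟩
    · obtain ⟨C', e1, e2, e3⟩ := exists_label_forall hK hA r _ C hC
        (fun f hf => by rw [hC'.2 f hf _ C₀.bot]; exact hbot f hf r)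
        (fun f hf => by rw [hC'.2 f hf _ C₀.top]; exact htop f hf r) rfl
      exact ⟨⟨C', e2, hC'.trans e1⟩, e1, e3⟩
  choose next hnext hnext' using hD
  obtain ⟨e, he⟩ := exists_surjective_nat (X ⊕ Y ⊕ L)
  let s : ℕ → {C : Approx up dn K // C.Fine ∧ C₀.Extends C} :=
    fun n => Nat.rec ⟨C₀, hC₀, Extends.refl C₀⟩ (fun n C => next (e n) C) n
  have hs : ∀ {m n}, m ≤ n → (s m).1.Extends (s n).1 := by
    intro m n hmn
    induction n, hmn using Nat.le_induction with
    | base => exact Extends.refl _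
    | succ n _ ih => exact ih.trans (hnext (e n) (s n))
  have hsD : ∀ i, ∃ n, D i (s n).1 := fun i => by
    obtain ⟨n, rfl⟩ := he i
    exact ⟨n + 1, hnext' (e n) (s n)⟩
  have hx : ∀ x, ∃ n y, (x, y) ∈ (s n).1.S := fun x => by
    obtain ⟨n, R, hR, rfl⟩ := hsD (Sum.inl x)
    exact ⟨n, R.2, hR⟩
  choose N g hg using hx
  have hgm : ∀ {n P}, P ∈ (s n).1.S → g P.1 = P.2 := by
    intro n P hP
    have h1 := (hs (le_max_left n (N P.1))).1 hP
    have h2 := (hs (le_max_right n (N P.1))).1 (hg P.1)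
    exact congrArg Prod.snd (Approx.eq_of_fst_eq _ h2 h1 rfl)
  have hgmono : StrictMono g := by
    intro x x' hxx'
    have h1 := (hs (le_max_left (N x) (N x'))).1 (hg x)
    have h2 := (hs (le_max_right (N x) (N x'))).1 (hg x')
    exact (Approx.chain _ _ h1 _ h2).1 hxx'
  have hgsurj : Function.Surjective g := by
    intro y
    obtain ⟨n, R, hR, rfl⟩ := hsD (Sum.inr (Sum.inl y))
    exact ⟨R.1, hgm hR⟩
  let h : X ≃o Y := StrictMono.orderIsoOfSurjective g hgmono hgsurj
  have hh : ∀ n, ∀ P ∈ (s n).1.S, h P.1 = P.2 := fun n P hP => hgm hP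
  refine ⟨h, fun f hf => ?_⟩
  let c : X → L := fun x => (s (N x)).1.ℓ f (x, g x)
  have hc : ∀ {n P}, P ∈ (s n).1.S → c P.1 = (s n).1.ℓ f P := by
    intro n P hP
    have h1 := (hs (le_max_left n (N P.1))).2 f hf _ hP
    have h2 := (hs (le_max_right n (N P.1))).2 f hf _ (hg P.1)
    rw [← h1]
    change (s (N P.1)).1.ℓ f (P.1, g P.1) = _
    rw [← h2, hgm hP]
  have hcommon : ∀ x x', ∃ n, (x, g x) ∈ (s n).1.S ∧ (x', g x') ∈ (s n).1.S := fun x x' =>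
    ⟨_, (hs (le_max_left (N x) (N x'))).1 (hg x), (hs (le_max_right (N x) (N x'))).1 (hg x')⟩
  refine ⟨c, ⟨?_, ?_, ?_, ?_, ?_, ?_, ?_⟩⟩
  · intro x x' hxx'
    obtain ⟨n, h1, h2⟩ := hcommon x x'
    have := Approx.mono' (s n).1 hf h1 h2 hxx'
    rwa [← hc h1, ← hc h2] at this
  · intro r
    obtain ⟨n, hn⟩ := hsD (Sum.inr (Sum.inr r))
    obtain ⟨R, hR, hRr⟩ := hn f hf
    exact ⟨R.1, (hc hR).trans hRr⟩
  · intro x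
    exact ((s (N x)).1.up_iff f hf _ (hg x)).trans (h.lt_symm_apply).symm
  · intro x
    exact ((s (N x)).1.dn_iff f hf _ (hg x)).trans (h.symm_apply_lt).symm
  · intro x x' hlt heq hu
    obtain ⟨n, h1, h2⟩ := hcommon x x'
    exact exists_lt_pow hf h (hh n) h1 h2 hlt (by rw [← hc h1, ← hc h2]; exact heq)
      (by rw [← hc h1]; exact hu)
  · intro x x' hlt heq hd
    obtain ⟨n, h1, h2⟩ := hcommon x x'
    exact exists_pow_lt hf h (hh n) h1 h2 hlt (by rw [← hc h1, ← hc h2]; exact heq)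
      (by rw [← hc h1]; exact hd)
  · intro x x' hlt heq
    obtain ⟨n, h1, h2⟩ := hcommon x x'
    obtain ⟨R, hR, hRx⟩ := Approx.exists_succ _ h1 h2 hlt
    have hl : (s n).1.ℓ f (x, g x) = (s n).1.ℓ f R :=
      le_antisymm (Approx.mono' _ hf h1 hR.right hR.lt.le) (by
        rw [← hc h1, show c (x, g x).1 = c (x', g x').1 from heq, hc h2]
        exact Approx.mono' _ hf hR.right h2 hRx)
    rw [show c x = (s n).1.ℓ f (x, g x) from hc h1]
    have hlt2 := Approx.snd_lt _ hR
    rcases Approx.avoids_of_label_eq hR hf hl with h' | h'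
    · left
      rw [(s n).1.up_iff f hf _ h1]
      exact hlt2.trans h'
    · right
      rw [(s n).1.dn_iff f hf _ h1]
      exact (f.strictMono hR.lt).trans h'

end Approx
end Approximation

/-! ### Automorphisms with the same labels are conjugate -/

section Conjugacy

variable {X L : Type*} [LinearOrder X] [LinearOrder L]

theorem OrderIso.zpow_strictMono_of_lt {φ : X ≃o X} {a : X} (ha : a < φ a) :
    StrictMono fun n : ℤ => (φ ^ n) a := by
  refine strictMono_int_of_lt_succ fun n => ?_
  rw [zpow_add_one, RelIso.mul_apply]
  exact (φ ^ n).strictMono ha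

/-- Two fundamental intervals are isomorphic. -/
theorem exists_strictMonoOn_Ico [Countable X] [DenselyOrdered X] {a a' b b' : X} (ha : a < a')
    (hb : b < b') : ∃ w : X → X, StrictMonoOn w (Ico a a') ∧ w '' Ico a a' = Ico b b' := by
  classical
  have hna : Nonempty (Ioo a a') := (nonempty_Ioo.2 ha).to_subtype
  have hnb : Nonempty (Ioo b b') := (nonempty_Ioo.2 hb).to_subtype
  obtain ⟨i⟩ := Order.iso_of_countable_dense (Ioo a a') (Ioo b b')
  let w : X → X := fun x => if h : x ∈ Ioo a a' then i ⟨x, h⟩ else b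
  have hw : ∀ x (h : x ∈ Ioo a a'), w x = i ⟨x, h⟩ := fun x h => dif_pos h
  have hwa : w a = b := dif_neg (by simp)
  have hmem : ∀ x (h : x ∈ Ico a a'), x = a ∨ x ∈ Ioo a a' := fun x h =>
    h.1.eq_or_lt.imp Eq.symm fun h' => ⟨h', h.2⟩
  refine ⟨w, ?_, ?_⟩
  · intro x hx y hy hxy
    rcases hmem x hx with rfl | hx' <;> rcases hmem y hy with rfl | hy'
    · exact absurd hxy (lt_irrefl _)
    · rw [hwa, hw y hy']; exact (i ⟨y, hy'⟩).2.1
    · exact absurd hxy hx'.1.not_gt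
    · rw [hw x hx', hw y hy']; exact i.strictMono hxy
  · ext y
    constructor
    · rintro ⟨x, hx, rfl⟩
      rcases hmem x hx with rfl | hx'
      · rw [hwa]; exact ⟨le_rfl, hb⟩
      · rw [hw x hx']; exact ⟨(i ⟨x, hx'⟩).2.1.le, (i ⟨x, hx'⟩).2.2⟩
    · intro hy
      rcases hy.1.eq_or_lt with rfl | h
      · exact ⟨a, ⟨le_rfl, ha⟩, hwa⟩
      · refine ⟨i.symm ⟨y, h, hy.2⟩, ⟨(i.symm ⟨y, h, hy.2⟩).2.1.le, (i.symm ⟨y, h, hy.2⟩).2.2⟩, ?_⟩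
        rw [hw _ (i.symm ⟨y, h, hy.2⟩).2]
        simp

/-- The union of the translates `[φ ^ n a, φ ^ (n + 1) a)` of a fundamental interval. -/
def orbitSpan (φ : X ≃o X) (a : X) : Set X :=
  {x | ∃ n : ℤ, (φ ^ n) a ≤ x ∧ x < (φ ^ (n + 1)) a}

theorem mem_orbitSpan {φ : X ≃o X} {a x : X} (ha : a < φ a) {m n : ℤ} (hm : (φ ^ m) a ≤ x)
    (hn : x < (φ ^ n) a) : x ∈ orbitSpan φ a := by
  have hmono := OrderIso.zpow_strictMono_of_lt ha
  obtain ⟨k, hk, hk'⟩ := Int.exists_greatest_of_bdd (P := fun k => (φ ^ k) a ≤ x)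
    ⟨n, fun k hk => (hmono.lt_iff_lt.1 (hk.trans_lt hn)).le⟩ ⟨m, hm⟩
  exact ⟨k, hk, not_le.1 fun h => by have := hk' _ h; omega⟩

/-- Any two upward orbitals are conjugate: extend an isomorphism of fundamental intervals. -/
theorem exists_conj_orbitSpan [Countable X] [DenselyOrdered X] {φ ψ : X ≃o X} {a b : X}
    (ha : a < φ a) (hb : b < ψ b) :
    ∃ u : X → X, (∀ x ∈ orbitSpan φ a, u x ∈ orbitSpan ψ b ∧ u (φ x) = ψ (u x)) ∧
      StrictMonoOn u (orbitSpan φ a) ∧ SurjOn u (orbitSpan φ a) (orbitSpan ψ b) := by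
  classical
  obtain ⟨w, hw, hw'⟩ := exists_strictMonoOn_Ico ha hb
  have hmono := OrderIso.zpow_strictMono_of_lt ha
  have hmono' := OrderIso.zpow_strictMono_of_lt hb
  choose! N hN hN' using fun (x) (hx : x ∈ orbitSpan φ a) => hx
  have hNuniq : ∀ x (n : ℤ), (φ ^ n) a ≤ x → x < (φ ^ (n + 1)) a → N x = n := by
    intro x n h1 h2
    have hx : x ∈ orbitSpan φ a := ⟨n, h1, h2⟩
    have h3 := hmono.lt_iff_lt.1 ((hN x hx).trans_lt h2)
    have h4 := hmono.lt_iff_lt.1 (h1.trans_lt (hN' x hx))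
    omega
  -- the fundamental representative of `x`
  have hr : ∀ x ∈ orbitSpan φ a, (φ ^ (-N x)) x ∈ Ico a (φ a) := by
    intro x hx
    have h1 := (φ ^ (-N x)).monotone (hN x hx)
    have h2 := (φ ^ (-N x)).strictMono (hN' x hx)
    rw [← RelIso.mul_apply, ← zpow_add] at h1 h2
    simp only [neg_add_cancel, zpow_zero, RelIso.one_apply, neg_add_cancel_left, zpow_one] at h1 h2
    exact ⟨h1, h2⟩
  have hwr : ∀ x ∈ orbitSpan φ a, b ≤ w ((φ ^ (-N x)) x) ∧ w ((φ ^ (-N x)) x) < ψ b := by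
    intro x hx
    have : w ((φ ^ (-N x)) x) ∈ Ico b (ψ b) := hw' ▸ mem_image_of_mem w (hr x hx)
    exact this
  have hu : ∀ x ∈ orbitSpan φ a, (ψ ^ N x) b ≤ (ψ ^ N x) (w ((φ ^ (-N x)) x)) ∧
      (ψ ^ N x) (w ((φ ^ (-N x)) x)) < (ψ ^ (N x + 1)) b := by
    intro x hx
    refine ⟨(ψ ^ N x).monotone (hwr x hx).1, ?_⟩
    rw [zpow_add_one, RelIso.mul_apply]
    exact (ψ ^ N x).strictMono (hwr x hx).2
  refine ⟨fun x => (ψ ^ N x) (w ((φ ^ (-N x)) x)), fun x hx => ⟨⟨N x, hu x hx⟩, ?_⟩, ?_, ?_⟩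
  · have : N (φ x) = N x + 1 := by
      apply hNuniq
      · rw [add_comm, zpow_one_add, RelIso.mul_apply]; exact φ.monotone (hN x hx)
      · rw [add_comm, zpow_one_add, RelIso.mul_apply]; exact φ.strictMono (hN' x hx)
    dsimp only
    rw [this, neg_add, add_comm (N x) 1, zpow_one_add ψ, RelIso.mul_apply, zpow_add φ,
      RelIso.mul_apply (φ ^ (-N x)), zpow_neg_one, RelIso.inv_apply_self]
  · intro x hx y hy hxy
    have h1 : N x ≤ N y := by
      have := hmono.lt_iff_lt.1 ((hN x hx).trans_lt (hxy.trans (hN' y hy)))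
      omega
    rcases h1.eq_or_lt with h | h
    · dsimp only
      have h2 := hr y hy
      rw [← h] at h2 ⊢
      exact (ψ ^ N x).strictMono (hw (hr x hx) h2 ((φ ^ (-N x)).strictMono hxy))
    · exact (hu x hx).2.trans_le ((hmono'.monotone (by omega)).trans (hu y hy).1)
  · rintro y ⟨n, h1, h2⟩
    have h3 : (ψ ^ (-n)) y ∈ w '' Ico a (φ a) := by
      rw [hw']
      have h1 := (ψ ^ (-n)).monotone h1
      have h2 := (ψ ^ (-n)).strictMono h2
      rw [← RelIso.mul_apply, ← zpow_add] at h1 h2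
      simp only [neg_add_cancel, zpow_zero, RelIso.one_apply, neg_add_cancel_left, zpow_one]
        at h1 h2
      exact ⟨h1, h2⟩
    obtain ⟨x, hx, hxy⟩ := h3
    have h4 : (φ ^ n) a ≤ (φ ^ n) x := (φ ^ n).monotone hx.1
    have h5 : (φ ^ n) x < (φ ^ (n + 1)) a := by
      rw [zpow_add_one, RelIso.mul_apply]
      exact (φ ^ n).strictMono hx.2
    refine ⟨(φ ^ n) x, ⟨n, h4, h5⟩, ?_⟩
    have hNn := hNuniq _ n h4 h5
    dsimp only
    rw [hNn, ← RelIso.mul_apply (φ ^ (-n)), ← zpow_add, neg_add_cancel, zpow_zero,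
      RelIso.one_apply, hxy, ← RelIso.mul_apply, ← zpow_add, add_neg_cancel, zpow_zero,
      RelIso.one_apply]

variable {up dn : L → Prop} {φ ψ : X ≃o X} {c c' : X → L}

/-- The labelling is invariant: if the labels of `x` and `φ x` were different, then there would be
a label of a different kind between them. -/
theorem IsOrbitalLabelling.apply_eq (hA : Alternating up dn)
    (h : IsOrbitalLabelling up dn φ c) (x : X) : c (φ x) = c x := by
  rcases lt_trichotomy x (φ x) with hx | hx | hx
  · refine (le_antisymm (h.mono hx.le) (not_lt.1 fun hlt => ?_)).symm
    have hu : up (c (φ x)) := (h.up_iff _).2 (φ.strictMono hx)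
    obtain ⟨s, h1, h2, h3⟩ := hA.up_up _ _ hlt ((h.up_iff _).2 hx) hu
    obtain ⟨z, rfl⟩ := h.surj s
    have hz1 : x < z := not_le.1 fun h' => absurd (h.mono h') h1.not_ge
    have hz2 : z < φ x := not_le.1 fun h' => absurd (h.mono h') h2.not_ge
    rw [h.up_iff] at h3
    exact h3 (hz2.trans (φ.strictMono hz1))
  · rw [← hx]
  · refine le_antisymm (h.mono hx.le) (not_lt.1 fun hlt => ?_)
    have hu : dn (c (φ x)) := (h.dn_iff _).2 (φ.strictMono hx)
    obtain ⟨s, h1, h2, h3⟩ := hA.dn_dn _ _ hlt hu ((h.dn_iff _).2 hx)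
    obtain ⟨z, rfl⟩ := h.surj s
    have hz1 : φ x < z := not_le.1 fun h' => absurd (h.mono h') h1.not_ge
    have hz2 : z < x := not_le.1 fun h' => absurd (h.mono h') h2.not_ge
    rw [h.dn_iff] at h3
    exact h3 ((φ.strictMono hz2).trans hz1)

theorem IsOrbitalLabelling.zpow_apply_eq (hA : Alternating up dn)
    (h : IsOrbitalLabelling up dn φ c) (n : ℤ) (x : X) : c ((φ ^ n) x) = c x := by
  induction n using Int.induction_on with
  | zero => rfl
  | succ n ih => rw [add_comm, zpow_one_add, RelIso.mul_apply, h.apply_eq hA, ih]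
  | pred n ih =>
    rw [← ih, ← h.apply_eq hA ((φ ^ (-(n : ℤ) - 1)) x), ← RelIso.mul_apply, ← zpow_one_add,
      add_sub_cancel]

/-- The inverse has the same orbitals, with the two directions exchanged. -/
theorem IsOrbitalLabelling.inv (h : IsOrbitalLabelling up dn φ c) :
    IsOrbitalLabelling dn up φ⁻¹ c where
  mono := h.mono
  surj := h.surj
  up_iff x := (h.dn_iff x).trans (φ.lt_symm_apply).symm
  dn_iff x := (h.up_iff x).trans (φ.symm_apply_lt).symm
  up_orbit x x' hlt heq hd := by
    obtain ⟨n, hn⟩ := h.dn_orbit x x' hlt heq hd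
    refine ⟨n, ?_⟩
    have := (φ ^ n)⁻¹.strictMono hn
    rwa [RelIso.inv_apply_self, ← inv_pow] at this
  dn_orbit x x' hlt heq hd := by
    obtain ⟨n, hn⟩ := h.up_orbit x x' hlt heq hd
    refine ⟨n, ?_⟩
    have := (φ ^ n)⁻¹.strictMono hn
    rwa [RelIso.inv_apply_self, ← inv_pow] at this
  up_or_dn x x' hlt heq := (h.up_or_dn x x' hlt heq).symm

theorem IsOrbitalLabelling.mem_orbitSpan_iff (hA : Alternating up dn)
    (h : IsOrbitalLabelling up dn φ c) {a x : X} (ha : up (c a)) :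
    x ∈ orbitSpan φ a ↔ c x = c a := by
  have ha' := (h.up_iff a).1 ha
  constructor
  · rintro ⟨n, h1, h2⟩
    have h1 := h.mono h1
    have h2 := h.mono h2.le
    rw [h.zpow_apply_eq hA] at h1 h2
    exact le_antisymm h2 h1
  · intro hx
    rcases lt_trichotomy a x with hlt | rfl | hlt
    · obtain ⟨n, hn⟩ := h.up_orbit a x hlt hx.symm ha
      exact mem_orbitSpan ha' (m := 0) (n := n) hlt.le (by rwa [zpow_natCast])
    · exact ⟨0, le_rfl, by simpa using ha'⟩
    · obtain ⟨n, hn⟩ := h.up_orbit x a hlt hx (hx ▸ ha)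
      refine mem_orbitSpan ha' (m := -n) (n := 0) ?_ hlt
      have := (φ ^ n)⁻¹.monotone hn.le
      rwa [RelIso.inv_apply_self, ← zpow_natCast, ← zpow_neg] at this

variable [Countable X] [DenselyOrdered X]

theorem IsOrbitalLabelling.exists_conj_fibre_of_up (hA : Alternating up dn)
    (h : IsOrbitalLabelling up dn φ c) (h' : IsOrbitalLabelling up dn ψ c') {r : L} (hr : up r) :
    ∃ u : X → X, (∀ x, c x = r → c' (u x) = r ∧ u (φ x) = ψ (u x)) ∧
      (∀ x x', c x = r → c x' = r → x < x' → u x < u x') ∧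
      ∀ y, c' y = r → ∃ x, c x = r ∧ u x = y := by
  obtain ⟨a, ha⟩ := h.surj r
  obtain ⟨b, hb⟩ := h'.surj r
  have ha' : up (c a) := ha ▸ hr
  have hb' : up (c' b) := hb ▸ hr
  have h1 : ∀ x, x ∈ orbitSpan φ a ↔ c x = r := fun x =>
    (h.mem_orbitSpan_iff hA ha').trans (by rw [ha])
  have h2 : ∀ x, x ∈ orbitSpan ψ b ↔ c' x = r := fun x =>
    (h'.mem_orbitSpan_iff hA hb').trans (by rw [hb])
  obtain ⟨u, e1, e2, e3⟩ := exists_conj_orbitSpan ((h.up_iff a).1 ha') ((h'.up_iff b).1 hb')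
  refine ⟨u, fun x hx => ⟨(h2 _).1 (e1 x ((h1 x).2 hx)).1, (e1 x ((h1 x).2 hx)).2⟩,
    fun x x' hx hx' hlt => e2 ((h1 x).2 hx) ((h1 x').2 hx') hlt, fun y hy => ?_⟩
  obtain ⟨x, hx, hxy⟩ := e3 ((h2 y).2 hy)
  exact ⟨x, (h1 x).1 hx, hxy⟩

theorem IsOrbitalLabelling.exists_conj_fibre (hA : Alternating up dn)
    (h : IsOrbitalLabelling up dn φ c) (h' : IsOrbitalLabelling up dn ψ c') (r : L) :
    ∃ u : X → X, (∀ x, c x = r → c' (u x) = r ∧ u (φ x) = ψ (u x)) ∧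
      (∀ x x', c x = r → c x' = r → x < x' → u x < u x') ∧
      ∀ y, c' y = r → ∃ x, c x = r ∧ u x = y := by
  by_cases hu : up r
  · exact h.exists_conj_fibre_of_up hA h' hu
  by_cases hd : dn r
  · obtain ⟨u, e1, e2, e3⟩ := (h.inv).exists_conj_fibre_of_up hA.swap (h'.inv) hd
    refine ⟨u, fun x hx => ⟨(e1 x hx).1, ?_⟩, e2, e3⟩
    have := (e1 (φ x) ((h.apply_eq hA x).trans hx)).2
    rw [RelIso.inv_apply_self] at this
    rw [this, RelIso.apply_inv_self]
  · obtain ⟨b, hb⟩ := h'.surj r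
    have hsub : ∀ x x', c x = r → c x' = r → ¬ x < x' := fun x x' hx hx' hlt => by
      have := h.up_or_dn x x' hlt (hx.trans hx'.symm)
      rw [hx] at this
      exact this.elim hu hd
    have hsub' : ∀ x x', c' x = r → c' x' = r → ¬ x < x' := fun x x' hx hx' hlt => by
      have := h'.up_or_dn x x' hlt (hx.trans hx'.symm)
      rw [hx] at this
      exact this.elim hu hd
    obtain ⟨a, ha⟩ := h.surj r
    refine ⟨fun _ => b, fun x _ => ⟨hb, ?_⟩, fun x x' hx hx' hlt => absurd hlt (hsub x x' hx hx'),
      fun y hy => ⟨a, ha, ?_⟩⟩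
    · refine le_antisymm (not_lt.1 ?_) (not_lt.1 ?_)
      · rw [← h'.dn_iff, hb]; exact hd
      · rw [← h'.up_iff, hb]; exact hu
    · exact le_antisymm (not_lt.1 (hsub' y b hy hb)) (not_lt.1 (hsub' b y hb hy))

/-- Automorphisms whose orbitals are labelled by the same alternating set of labels are
conjugate. -/
theorem IsOrbitalLabelling.exists_conj (hA : Alternating up dn)
    (h : IsOrbitalLabelling up dn φ c) (h' : IsOrbitalLabelling up dn ψ c') :
    ∃ u : X ≃o X, ∀ x, u (φ x) = ψ (u x) := by
  choose u hu hmono hsurj using fun r => h.exists_conj_fibre hA h' r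
  have hc : ∀ x, c' (u (c x) x) = c x := fun x => (hu (c x) x rfl).1
  have hU : StrictMono fun x => u (c x) x := by
    intro x x' hlt
    rcases (h.mono hlt.le).eq_or_lt with heq | hlt'
    · dsimp only
      rw [← heq]
      exact hmono _ x x' rfl heq.symm hlt
    · rw [← hc x, ← hc x'] at hlt'
      exact not_le.1 fun hle => absurd (h'.mono hle) hlt'.not_ge
  have hS : Function.Surjective fun x => u (c x) x := by
    intro y
    obtain ⟨x, hx, hxy⟩ := hsurj (c' y) y rfl
    exact ⟨x, by dsimp only; rw [hx, hxy]⟩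
  refine ⟨StrictMono.orderIsoOfSurjective _ hU hS, fun x => ?_⟩
  change u (c (φ x)) (φ x) = ψ (u (c x) x)
  rw [h.apply_eq hA]
  exact (hu (c x) x rfl).2

end Conjugacy

/-! ### The orbitals of an automorphism -/

section Capture

variable {X Y : Type*} [LinearOrder X] [LinearOrder Y]

/-- Between any two points of different upward orbitals there is a point that `f` does not move up,
and similarly for downward orbitals. -/
structure PointwiseAlternating (f : X ≃o X) : Prop where
  up : ∀ p q, p < q → (∀ x, p ≤ x → x ≤ q → x < f x) → ∃ n : ℕ, q < (f ^ n) p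
  dn : ∀ p q, p < q → (∀ x, p ≤ x → x ≤ q → f x < x) → ∃ n : ℕ, (f ^ n) q < p

/-- The equivalence relation whose classes are the orbitals of `f`. -/
def orbitalSetoid (f : X ≃o X) : Setoid X where
  r x y := ∃ m n : ℤ, (f ^ m) x ≤ y ∧ y ≤ (f ^ n) x
  iseqv := by
    refine ⟨fun x => ⟨0, 0, le_rfl, le_rfl⟩, ?_, ?_⟩
    · rintro x y ⟨m, n, h1, h2⟩
      refine ⟨-n, -m, ?_, ?_⟩
      · have := (f ^ n)⁻¹.monotone h2
        rwa [RelIso.inv_apply_self, ← zpow_neg] at this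
      · have := (f ^ m)⁻¹.monotone h1
        rwa [RelIso.inv_apply_self, ← zpow_neg] at this
    · rintro x y z ⟨m, n, h1, h2⟩ ⟨m', n', h3, h4⟩
      refine ⟨m' + m, n' + n, ?_, ?_⟩
      · rw [zpow_add, RelIso.mul_apply]; exact ((f ^ m').monotone h1).trans h3
      · rw [zpow_add, RelIso.mul_apply]; exact h4.trans ((f ^ n').monotone h2)

/-- A chosen point in the orbital of `x`. -/
noncomputable def orbitalRep (f : X ≃o X) (x : X) : X :=
  (Quotient.mk (orbitalSetoid f) x).out

theorem orbitalRep_rel (f : X ≃o X) (x : X) : (orbitalSetoid f).r (orbitalRep f x) x :=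
  Quotient.mk_out (s := orbitalSetoid f) x

theorem orbitalRep_eq (f : X ≃o X) {x y : X} (h : (orbitalSetoid f).r x y) :
    orbitalRep f x = orbitalRep f y :=
  congrArg Quotient.out (Quotient.sound (s := orbitalSetoid f) h)

theorem rel_of_orbitalRep_eq (f : X ≃o X) {x y : X} (h : orbitalRep f x = orbitalRep f y) :
    (orbitalSetoid f).r x y :=
  (orbitalSetoid f).trans' ((orbitalSetoid f).symm' (orbitalRep_rel f x))
    (h ▸ orbitalRep_rel f y)

theorem orbitalRep_idem (f : X ≃o X) (x : X) : orbitalRep f (orbitalRep f x) = orbitalRep f x :=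
  orbitalRep_eq f (orbitalRep_rel f x)

theorem orbitalRep_monotone (f : X ≃o X) : Monotone (orbitalRep f) := by
  intro x y hxy
  by_contra hlt
  rw [not_le] at hlt
  obtain ⟨m, n, -, h2⟩ := (orbitalSetoid f).symm' (orbitalRep_rel f x)
  obtain ⟨m', n', h3, h4⟩ := orbitalRep_rel f y
  refine hlt.ne ?_
  rw [← orbitalRep_idem f x, ← orbitalRep_idem f y]
  refine orbitalRep_eq f ⟨0, n + n', hlt.le, ?_⟩
  rw [zpow_add, RelIso.mul_apply]
  exact h2.trans ((f ^ n).monotone (hxy.trans h4))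

theorem lt_apply_of_rel {f : X ≃o X} {x y : X} (h : (orbitalSetoid f).r x y) (hx : x < f x) :
    y < f y := by
  obtain ⟨m, n, h1, h2⟩ := h
  by_contra hy
  rw [not_lt] at hy
  have hpow : ∀ k : ℕ, (f ^ k) y ≤ y := by
    intro k
    induction k with
    | zero => exact le_rfl
    | succ k ih => rw [pow_succ', RelIso.mul_apply]; exact (f.monotone ih).trans hy
  have hmono := OrderIso.zpow_strictMono_of_lt hx
  have h3 : (f ^ ((n - m).toNat + 1)) ((f ^ m) x) ≤ (f ^ n) x :=
    ((f ^ ((n - m).toNat + 1)).monotone h1).trans ((hpow _).trans h2)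
  rw [← zpow_natCast, ← RelIso.mul_apply, ← zpow_add] at h3
  have := hmono.le_iff_le.1 h3
  omega

theorem apply_lt_of_rel {f : X ≃o X} {x y : X} (h : (orbitalSetoid f).r x y) (hx : f x < x) :
    f y < y := by
  have h' : (orbitalSetoid f⁻¹).r x y := by
    obtain ⟨m, n, h1, h2⟩ := h
    exact ⟨-m, -n, by rwa [inv_zpow', neg_neg], by rwa [inv_zpow', neg_neg]⟩
  exact (f.lt_symm_apply).1 (lt_apply_of_rel h' ((f.lt_symm_apply).2 hx))

/-- The labels attached to `f`: one point of every orbital. -/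
abbrev OrbitalLabel (f : X ≃o X) : Type _ := range (orbitalRep f)

/-- Every automorphism has its orbitals labelled by their chosen points. -/
theorem isOrbitalLabelling_orbitalRep (f : X ≃o X) :
    IsOrbitalLabelling (L := OrbitalLabel f) (fun r => (r : X) < f r) (fun r => f r < r) f
      (rangeFactorization (orbitalRep f)) where
  mono x y h := orbitalRep_monotone f h
  surj := rangeFactorization_surjective
  up_iff x := ⟨lt_apply_of_rel (orbitalRep_rel f x),
    lt_apply_of_rel ((orbitalSetoid f).symm' (orbitalRep_rel f x))⟩
  dn_iff x := ⟨apply_lt_of_rel (orbitalRep_rel f x),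
    apply_lt_of_rel ((orbitalSetoid f).symm' (orbitalRep_rel f x))⟩
  up_orbit x y _ heq hu := by
    have heq' : orbitalRep f x = orbitalRep f y := Subtype.ext_iff.1 heq
    have hx := lt_apply_of_rel (orbitalRep_rel f x) hu
    obtain ⟨m, n, h1, h2⟩ := rel_of_orbitalRep_eq f heq'
    refine ⟨n.toNat + 1, h2.trans_lt ?_⟩
    rw [← zpow_natCast]
    exact OrderIso.zpow_strictMono_of_lt hx (show n < ((n.toNat + 1 : ℕ) : ℤ) by omega)
  dn_orbit x y _ heq hu := by
    have heq' : orbitalRep f x = orbitalRep f y := Subtype.ext_iff.1 heq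
    have hx := apply_lt_of_rel (orbitalRep_rel f x) hu
    have hy : y < f⁻¹ y := (f.lt_symm_apply).2
      (apply_lt_of_rel (rel_of_orbitalRep_eq f heq') hx)
    obtain ⟨m, n, h1, h2⟩ := rel_of_orbitalRep_eq f heq'.symm
    refine ⟨m.toNat + 1, lt_of_lt_of_le ?_ h1⟩
    have := OrderIso.zpow_strictMono_of_lt hy (show -((m.toNat + 1 : ℕ) : ℤ) < -m by omega)
    simpa only [inv_zpow', neg_neg, zpow_natCast] using this
  up_or_dn x y hlt heq := by
    have heq' : orbitalRep f x = orbitalRep f y := Subtype.ext_iff.1 heq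
    by_contra hcon
    rw [not_or] at hcon
    have hfix : f x = x := by
      have hr := (orbitalSetoid f).symm' (orbitalRep_rel f x)
      refine le_antisymm (not_lt.1 fun h => hcon.1 (lt_apply_of_rel hr h))
        (not_lt.1 fun h => hcon.2 (apply_lt_of_rel hr h))
    obtain ⟨m, n, h1, h2⟩ := rel_of_orbitalRep_eq f heq'
    have hz : ∀ n : ℤ, (f ^ n) x = x := fun n => by
      have h1 : ∀ k : ℕ, (f ^ k) x = x := fun k => by
        induction k with
        | zero => rfl
        | succ k ih => rw [pow_succ', RelIso.mul_apply, ih, hfix]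
      cases n with
      | ofNat k => exact h1 k
      | negSucc k =>
        rw [zpow_negSucc]
        nth_rw 1 [← h1 (k + 1)]
        exact RelIso.inv_apply_self _ _
    exact absurd hlt (h2.trans_eq (hz n)).not_gt

/-- The labels attached to a good automorphism alternate. Two labels of fixed points are separated
by the label of a moved point, since the fixed points are finite in number. -/
theorem PointwiseAlternating.alternating [DenselyOrdered X] {f : X ≃o X}
    (hf : PointwiseAlternating f) (hfin : (Function.fixedPoints f).Finite) :
    Alternating (L := OrbitalLabel f) (fun r => (r : X) < f r) (fun r => f r < r) := by
  have hrep : ∀ r : OrbitalLabel f, orbitalRep f r = r := by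
    rintro ⟨_, x, rfl⟩; exact orbitalRep_idem f x
  have hc := isOrbitalLabelling_orbitalRep f
  -- a point between two labels is labelled by one of them or by a label between them
  have hmem : ∀ {p q : OrbitalLabel f} {x : X}, (p : X) ≤ x → x ≤ q →
      orbitalRep f x = p ∨ orbitalRep f x = q ∨ ∃ s : OrbitalLabel f, p < s ∧ s < q ∧
        orbitalRep f x = s := by
    intro p q x h1 h2
    have h1 := orbitalRep_monotone f h1
    have h2 := orbitalRep_monotone f h2
    rw [hrep] at h1 h2
    rcases h1.eq_or_lt with h | h
    · exact Or.inl h.symm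
    rcases h2.eq_or_lt with h' | h'
    · exact Or.inr (Or.inl h')
    · exact Or.inr (Or.inr ⟨⟨_, x, rfl⟩, h, h', rfl⟩)
  have hne : ∀ {p q : OrbitalLabel f}, p < q → ¬ (orbitalSetoid f).r (p : X) q := by
    intro p q hpq h
    have := orbitalRep_eq f h
    rw [hrep, hrep] at this
    exact hpq.ne (Subtype.ext this)
  refine ⟨fun r h => h.not_gt, ?_, ?_, ?_⟩
  · intro p q hpq hp hq
    by_contra hcon
    push Not at hcon
    obtain ⟨n, hn⟩ := hf.up p q hpq (fun x h1 h2 => by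
      refine lt_apply_of_rel (orbitalRep_rel f x) ?_
      rcases hmem h1 h2 with h | h | ⟨s, h3, h4, h⟩
      · rw [h]; exact hp
      · rw [h]; exact hq
      · rw [h]; exact hcon s h3 h4)
    exact hne hpq ⟨0, n, le_of_lt hpq, hn.le⟩
  · intro p q hpq hp hq
    by_contra hcon
    push Not at hcon
    obtain ⟨n, hn⟩ := hf.dn p q hpq (fun x h1 h2 => by
      refine apply_lt_of_rel (orbitalRep_rel f x) ?_
      rcases hmem h1 h2 with h | h | ⟨s, h3, h4, h⟩
      · rw [h]; exact hp
      · rw [h]; exact hq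
      · rw [h]; exact hcon s h3 h4)
    exact hne hpq ((orbitalSetoid f).symm' ⟨n, 0, hn.le, le_of_lt hpq⟩)
  · intro p q hpq h1 h2 h3 h4
    by_contra hcon
    push Not at hcon
    refine (Ico_infinite (show (p : X) < q from hpq)).mono ?_ hfin
    intro x hx
    have hr := (orbitalSetoid f).symm' (orbitalRep_rel f x)
    refine le_antisymm (not_lt.1 fun h => ?_) (not_lt.1 fun h => ?_)
    · have := lt_apply_of_rel hr h
      rcases hmem hx.1 hx.2.le with h | h | ⟨s, h5, h6, h⟩
      · rw [h] at this; exact h1 this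
      · rw [h] at this; exact h3 this
      · rw [h] at this; exact (hcon s h5 h6).1.not_gt this
    · have := apply_lt_of_rel hr h
      rcases hmem hx.1 hx.2.le with h | h | ⟨s, h5, h6, h⟩
      · rw [h] at this; exact h2 this
      · rw [h] at this; exact h4 this
      · rw [h] at this; exact (hcon s h5 h6).2.not_gt this

end Capture

/-! ### Capturing a set of automorphisms in a conjugacy class -/

section Capture

variable {X Y : Type*} [LinearOrder X] [LinearOrder Y] [BoundedOrder X] [BoundedOrder Y]

/-- The approximation that only knows the fixed points of `f₀`, at which all maps in `K` agree. -/
noncomputable def Approx.ofFixedPoints {K : Set (X ≃o Y)} {f₀ : X ≃o X}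
    (hfin : (Function.fixedPoints f₀).Finite) {k : X ≃o Y} (hk : k ∈ K)
    (hz : ∀ z, f₀ z = z → ∀ f ∈ K, ∀ g ∈ K, f z = g z) :
    Approx (L := OrbitalLabel f₀) (fun r => (r : X) < f₀ r) (fun r => f₀ r < r) K where
  S := (hfin.image fun z => (z, k z)).toFinset
  ℓ _ P := rangeFactorization (orbitalRep f₀) P.1
  chain P hP Q hQ := by
    rw [Finite.mem_toFinset] at hP hQ
    obtain ⟨z, -, rfl⟩ := hP
    obtain ⟨w, -, rfl⟩ := hQ
    exact k.lt_iff_lt.symm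
  bot := by
    rw [Finite.mem_toFinset]
    exact ⟨⊥, f₀.map_bot, Prod.ext rfl k.map_bot⟩
  top := by
    rw [Finite.mem_toFinset]
    exact ⟨⊤, f₀.map_top, Prod.ext rfl k.map_top⟩
  zero r hu hd := by
    have hr : f₀ r = r := le_antisymm (not_lt.1 hu) (not_lt.1 hd)
    refine ⟨(r, k r), by rw [Finite.mem_toFinset]; exact ⟨r, hr, rfl⟩, fun f _ => ?_⟩
    obtain ⟨_, x, rfl⟩ := r
    exact Subtype.ext (orbitalRep_idem f₀ x)
  mono f _ P _ Q _ h := (isOrbitalLabelling_orbitalRep f₀).mono h.le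
  up_iff f hf P hP := by
    rw [Finite.mem_toFinset] at hP
    obtain ⟨z, hz', rfl⟩ := hP
    rw [(isOrbitalLabelling_orbitalRep f₀).up_iff]
    simp [Function.mem_fixedPoints_iff.1 hz', hz z hz' f hf k hk]
  dn_iff f hf P hP := by
    rw [Finite.mem_toFinset] at hP
    obtain ⟨z, hz', rfl⟩ := hP
    rw [(isOrbitalLabelling_orbitalRep f₀).dn_iff]
    simp [Function.mem_fixedPoints_iff.1 hz', hz z hz' f hf k hk]
  box P Q h := by
    have hP := h.left
    rw [Finite.mem_toFinset] at hP
    obtain ⟨z, hz', hzP⟩ := hP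
    have hc := isOrbitalLabelling_orbitalRep f₀
    refine ⟨_, _, K, lt_of_le_of_ne (hc.mono h.lt.le) fun heq => ?_, subset_rfl,
      fun f _ => ⟨rfl, rfl⟩, fun f hf hf' => absurd hf hf'⟩
    have := hc.up_or_dn _ _ h.lt heq
    rw [hc.up_iff, hc.dn_iff, ← hzP] at this
    rcases this with this | this
    · exact this.ne' hz'
    · exact this.ne hz'

theorem Approx.ofFixedPoints_fine {K : Set (X ≃o Y)} {f₀ : X ≃o X}
    (hfin : (Function.fixedPoints f₀).Finite) {k : X ≃o Y} (hk : k ∈ K)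
    (hz : ∀ z, f₀ z = z → ∀ f ∈ K, ∀ g ∈ K, f z = g z) :
    (Approx.ofFixedPoints hfin hk hz).Fine := by
  intro P Q h
  obtain ⟨p, q, F, hB⟩ := (Approx.ofFixedPoints hfin hk hz).box P Q h
  have hc := isOrbitalLabelling_orbitalRep f₀
  have hP := h.left
  rw [Approx.ofFixedPoints, Finite.mem_toFinset] at hP
  obtain ⟨z, hz', rfl⟩ := hP
  refine ⟨rangeFactorization (orbitalRep f₀) z, rangeFactorization (orbitalRep f₀) Q.1, F,
    ⟨lt_of_le_of_ne (hc.mono h.lt.le) fun heq => ?_, hB.subset, fun f _ => ⟨rfl, rfl⟩, hB.avoids⟩,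
    fun h' => ?_, fun h' => ?_⟩
  · have := hc.up_or_dn _ _ h.lt heq
    rw [hc.up_iff, hc.dn_iff] at this
    rcases this with this | this
    · exact this.ne' hz'
    · exact this.ne hz'
  · exact ((hc.up_iff z).1 h'.1).ne' hz'
  · exact ((hc.dn_iff z).1 h'.1).ne hz'

/-- One isomorphism `h` takes all the maps `f ∈ K` at once to conjugates `h⁻¹ f` of `f₀`. -/
theorem exists_capture [DenselyOrdered X] [DenselyOrdered Y] [Countable X] [Countable Y]
    {K : Set (X ≃o Y)} (hK : FiniteValued K) (hne : K.Nonempty) {f₀ : X ≃o X}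
    (hf₀ : PointwiseAlternating f₀) (hfin : (Function.fixedPoints f₀).Finite)
    (hz : ∀ z, f₀ z = z → ∀ f ∈ K, ∀ g ∈ K, f z = g z) :
    ∃ h : X ≃o Y, ∀ f ∈ K, ∃ u : X ≃o X, ∀ x, u (f₀ x) = h.symm (f (u x)) := by
  obtain ⟨k, hk⟩ := hne
  have hA := hf₀.alternating hfin
  have hc := isOrbitalLabelling_orbitalRep f₀
  obtain ⟨h, hh⟩ := Approx.exists_isOrbitalLabelling hK hA (Approx.ofFixedPoints hfin hk hz)
    (Approx.ofFixedPoints_fine hfin hk hz)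
    (fun f _ r => by obtain ⟨x, rfl⟩ := hc.surj r; exact hc.mono bot_le)
    (fun f _ r => by obtain ⟨x, rfl⟩ := hc.surj r; exact hc.mono le_top)
  refine ⟨h, fun f hf => ?_⟩
  obtain ⟨c, hc'⟩ := hh f hf
  exact hc.exists_conj hA hc'

end Capture

section Rat

/-- The rational line with its two ends added. Both ends are fixed points of the extension of an
automorphism, so that the ends of the line need no separate treatment. -/
abbrev ExtendedRat : Type := WithTop (WithBot ℚ)

/-- The extension of an automorphism of `ℚ` to the ends. -/
def extendAut (f : AutQ) : ExtendedRat ≃o ExtendedRat := f.withBotCongr.withTopCongr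

theorem ExtendedRat.cases (e : ExtendedRat) :
    e = ⊤ ∨ e = ⊥ ∨ ∃ q : ℚ, e = ((q : WithBot ℚ) : ExtendedRat) := by
  induction e using WithTop.recTopCoe with
  | top => exact Or.inl rfl
  | coe e =>
    induction e using WithBot.recBotCoe with
    | bot => exact Or.inr (Or.inl rfl)
    | coe q => exact Or.inr (Or.inr ⟨q, rfl⟩)

theorem extendAut_coe (f : AutQ) (q : ℚ) :
    extendAut f ((q : WithBot ℚ) : ExtendedRat) = ((f q : WithBot ℚ) : ExtendedRat) := rfl

theorem extendAut_pow_coe (f : AutQ) (n : ℕ) (q : ℚ) :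
    (extendAut f ^ n) ((q : WithBot ℚ) : ExtendedRat) =
      (((f ^ n) q : WithBot ℚ) : ExtendedRat) := by
  induction n with
  | zero => rfl
  | succ n ih => rw [pow_succ', RelIso.mul_apply, ih, extendAut_coe, pow_succ', RelIso.mul_apply]

/-- Every automorphism of the extended line is the extension of an automorphism of `ℚ`. -/
theorem exists_restrict (u : ExtendedRat ≃o ExtendedRat) :
    ∃ v : AutQ, ∀ q : ℚ, u ((q : WithBot ℚ) : ExtendedRat) = ((v q : WithBot ℚ) : ExtendedRat) := by
  have key : ∀ (u : ExtendedRat ≃o ExtendedRat) (q : ℚ), ∃ r : ℚ,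
      u ((q : WithBot ℚ) : ExtendedRat) = ((r : WithBot ℚ) : ExtendedRat) := by
    intro u q
    rcases ExtendedRat.cases (u ((q : WithBot ℚ) : ExtendedRat)) with h | h | h
    · rw [map_eq_top_iff] at h; exact absurd h (WithTop.coe_ne_top)
    · rw [map_eq_bot_iff] at h
      exact absurd (WithTop.coe_injective h) WithBot.coe_ne_bot
    · exact h
  choose v hv using key u
  choose w hw using key u.symm
  have hmono : StrictMono v := by
    intro a b hab
    have : u ((a : WithBot ℚ) : ExtendedRat) < u ((b : WithBot ℚ) : ExtendedRat) :=
      u.strictMono (by exact_mod_cast hab)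
    rw [hv, hv] at this
    exact_mod_cast this
  have hsurj : Function.Surjective v := fun q => by
    refine ⟨w q, ?_⟩
    have := hv (w q)
    rw [← hw, u.apply_symm_apply] at this
    exact_mod_cast this.symm
  exact ⟨StrictMono.orderIsoOfSurjective v hmono hsurj, hv⟩

theorem PointwiseAlternating.extendAut {f : AutQ} (hf : PointwiseAlternating f) :
    PointwiseAlternating (extendAut f) := by
  have hne : ∀ e : ExtendedRat, _root_.extendAut f e ≠ e →
      ∃ q : ℚ, e = ((q : WithBot ℚ) : ExtendedRat) := by
    intro e he
    rcases ExtendedRat.cases e with rfl | rfl | h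
    · exact absurd (map_top _) he
    · exact absurd (map_bot _) he
    · exact h
  constructor
  · intro p q hpq h
    obtain ⟨p, rfl⟩ := hne p (h p le_rfl hpq.le).ne'
    obtain ⟨q, rfl⟩ := hne q (h q hpq.le le_rfl).ne'
    obtain ⟨n, hn⟩ := hf.up p q (by exact_mod_cast hpq) fun x h1 h2 => by
      have := h ((x : WithBot ℚ) : ExtendedRat) (by exact_mod_cast h1) (by exact_mod_cast h2)
      rw [extendAut_coe] at this
      exact_mod_cast this
    refine ⟨n, ?_⟩
    rw [extendAut_pow_coe]
    exact_mod_cast hn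
  · intro p q hpq h
    obtain ⟨p, rfl⟩ := hne p (h p le_rfl hpq.le).ne
    obtain ⟨q, rfl⟩ := hne q (h q hpq.le le_rfl).ne
    obtain ⟨n, hn⟩ := hf.dn p q (by exact_mod_cast hpq) fun x h1 h2 => by
      have := h ((x : WithBot ℚ) : ExtendedRat) (by exact_mod_cast h1) (by exact_mod_cast h2)
      rw [extendAut_coe] at this
      exact_mod_cast this
    refine ⟨n, ?_⟩
    rw [extendAut_pow_coe]
    exact_mod_cast hn

/-- One translation takes all the automorphisms in `K` at once into the conjugacy class of `f₀`. -/
theorem exists_capture_aut {K : Set AutQ} (hK : FiniteValued K) {f₀ : AutQ}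
    (hf₀ : PointwiseAlternating f₀) (hfin : (Function.fixedPoints f₀).Finite)
    (hz : ∀ z, f₀ z = z → ∀ f ∈ K, ∀ g ∈ K, f z = g z) :
    ∃ h : AutQ, ∀ f ∈ K, IsConj f₀ (h⁻¹ * f) := by
  rcases K.eq_empty_or_nonempty with rfl | hne
  · exact ⟨1, fun f hf => absurd hf (notMem_empty _)⟩
  have hK' : FiniteValued (extendAut '' K) := by
    refine ⟨fun e => ?_, fun e => ?_⟩
    · rcases ExtendedRat.cases e with rfl | rfl | ⟨q, rfl⟩
      · exact (finite_singleton ⊤).subset (by rintro _ ⟨f, -, rfl⟩; exact map_top _)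
      · exact (finite_singleton ⊥).subset (by rintro _ ⟨f, -, rfl⟩; exact map_bot _)
      · refine ((hK.apply q).image fun r : ℚ => ((r : WithBot ℚ) : ExtendedRat)).subset ?_
        rintro _ ⟨_, ⟨f, hf, rfl⟩, rfl⟩
        exact ⟨f q, ⟨f, hf, rfl⟩, rfl⟩
    · rcases ExtendedRat.cases e with rfl | rfl | ⟨q, rfl⟩
      · exact (finite_singleton ⊤).subset (by rintro _ ⟨f, -, rfl⟩; exact map_top _)
      · exact (finite_singleton ⊥).subset (by rintro _ ⟨f, -, rfl⟩; exact map_bot _)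
      · refine ((hK.symm_apply q).image fun r : ℚ => ((r : WithBot ℚ) : ExtendedRat)).subset ?_
        rintro _ ⟨_, ⟨f, hf, rfl⟩, rfl⟩
        exact ⟨f.symm q, ⟨f, hf, rfl⟩, rfl⟩
  have hfin' : (Function.fixedPoints (extendAut f₀)).Finite := by
    refine (((hfin.image fun r : ℚ => ((r : WithBot ℚ) : ExtendedRat)).insert ⊤).insert ⊥).subset ?_
    intro e he
    rcases ExtendedRat.cases e with rfl | rfl | ⟨q, rfl⟩
    · exact Or.inr (Or.inl rfl)
    · exact Or.inl rfl
    · refine Or.inr (Or.inr ⟨q, ?_, rfl⟩)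
      have : extendAut f₀ ((q : WithBot ℚ) : ExtendedRat) = ((q : WithBot ℚ) : ExtendedRat) := he
      rw [extendAut_coe] at this
      exact_mod_cast this
  obtain ⟨h, hh⟩ := exists_capture hK' (hne.image _) hf₀.extendAut hfin' (by
    rintro z hz0 _ ⟨f, hf, rfl⟩ _ ⟨g, hg, rfl⟩
    rcases ExtendedRat.cases z with rfl | rfl | ⟨q, rfl⟩
    · rw [map_top, map_top]
    · rw [map_bot, map_bot]
    · rw [extendAut_coe] at hz0
      rw [extendAut_coe, extendAut_coe, hz q (by exact_mod_cast hz0) f hf g hg])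
  obtain ⟨v, hv⟩ := exists_restrict h
  refine ⟨v, fun f hf => ?_⟩
  obtain ⟨u, hu⟩ := hh _ ⟨f, hf, rfl⟩
  obtain ⟨w, hw⟩ := exists_restrict u
  rw [isConj_iff]
  refine ⟨w, ?_⟩
  rw [mul_inv_eq_iff_eq_mul, mul_assoc, eq_inv_mul_iff_mul_eq]
  ext q
  have := hu ((q : WithBot ℚ) : ExtendedRat)
  rw [extendAut_coe, hw, hw, extendAut_coe, eq_comm, h.symm_apply_eq, hv] at this
  have h2 : f (w q) = v (w (f₀ q)) := by exact_mod_cast this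
  exact h2.symm

end Rat

/-! ### Orbitals, topology and largeness in the automorphism group of the rationals -/

section Orbitals

theorem mem_orbital_iff (f : AutQ) (r x : ℚ) :
    x ∈ convexHull ℚ (range fun n : ℤ => (f ^ n) r) ↔ (orbitalSetoid f).r r x := by
  constructor
  · intro hx
    have hconv : Convex ℚ {x | (orbitalSetoid f).r r x} := by
      refine OrdConnected.convex ⟨?_⟩
      rintro a ⟨m, n, h1, h2⟩ b ⟨m', n', h3, h4⟩ c hc
      exact ⟨m, n', h1.trans hc.1, hc.2.trans h4⟩
    refine convexHull_min ?_ hconv hx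
    rintro _ ⟨n, rfl⟩
    exact ⟨n, n, le_rfl, le_rfl⟩
  · rintro ⟨m, n, h1, h2⟩
    have hord : OrdConnected (convexHull ℚ (range fun n : ℤ => (f ^ n) r)) :=
      (convex_convexHull ℚ _).ordConnected
    exact hord.out (subset_convexHull ℚ _ ⟨m, rfl⟩) (subset_convexHull ℚ _ ⟨n, rfl⟩) ⟨h1, h2⟩

theorem mem_orbitals_iff (f : AutQ) (O : Set ℚ) :
    O ∈ orbitals f ↔ ∃ r, O = {x | (orbitalSetoid f).r r x} := by
  refine exists_congr fun r => ?_
  rw [show convexHull ℚ (range fun n : ℤ => (f ^ n) r) = {x | (orbitalSetoid f).r r x} from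
    Set.ext fun x => mem_orbital_iff f r x]

theorem orbitalLT_iff (f : AutQ) (p q : ℚ) :
    OrbitalLT {x | (orbitalSetoid f).r p x} {x | (orbitalSetoid f).r q x} ↔
      orbitalRep f p < orbitalRep f q := by
  constructor
  · rintro ⟨hne, a, ha, b, hb, hab⟩
    refine lt_of_le_of_ne ?_ fun heq => hne ?_
    · rw [orbitalRep_eq f ha, orbitalRep_eq f hb]
      exact orbitalRep_monotone f hab.le
    · have h := rel_of_orbitalRep_eq f heq
      ext x
      exact ⟨fun hx => (orbitalSetoid f).trans' ((orbitalSetoid f).symm' h) hx,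
        fun hx => (orbitalSetoid f).trans' h hx⟩
  · intro h
    refine ⟨fun heq => h.ne (orbitalRep_eq f ?_), p, (orbitalSetoid f).refl' p, q,
      (orbitalSetoid f).refl' q, not_le.1 fun h' => absurd (orbitalRep_monotone f h') h.not_ge⟩
    have : q ∈ {x | (orbitalSetoid f).r p x} := heq ▸ (orbitalSetoid f).refl' q
    exact this

theorem orbitalParity_eq_one_iff (f : AutQ) (r : ℚ) :
    orbitalParity f {x | (orbitalSetoid f).r r x} = 1 ↔ r < f r := by
  unfold orbitalParity
  constructor
  · intro h
    split_ifs at h with h1 h2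
    · obtain ⟨p, hp, hp'⟩ := h1
      exact lt_apply_of_rel ((orbitalSetoid f).symm' hp) hp'
    · exact absurd h (by norm_num)
  · intro h
    rw [if_pos ⟨r, (orbitalSetoid f).refl' r, h⟩]

theorem orbitalParity_eq_neg_one_iff (f : AutQ) (r : ℚ) :
    orbitalParity f {x | (orbitalSetoid f).r r x} = -1 ↔ f r < r := by
  unfold orbitalParity
  constructor
  · intro h
    split_ifs at h with h1 h2
    obtain ⟨p, hp, hp'⟩ := h2
    exact apply_lt_of_rel ((orbitalSetoid f).symm' hp) hp'
  · intro h
    have h1 : ¬ ∃ p ∈ {x | (orbitalSetoid f).r r x}, p < f p := by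
      rintro ⟨p, hp, hp'⟩
      exact (lt_apply_of_rel ((orbitalSetoid f).symm' hp) hp').not_gt h
    rw [if_neg h1, if_pos ⟨r, (orbitalSetoid f).refl' r, h⟩]

/-- The alternation of orbitals in terms of points: an interval all of whose points are moved in the
same direction lies in a single orbital. -/
theorem hasAlternatingOrbitals_iff (f : AutQ) :
    HasAlternatingOrbitals f ↔ PointwiseAlternating f := by
  constructor
  · intro h
    have key : ∀ p q : ℚ, p < q → orbitalRep f p ≠ orbitalRep f q →
        (p < f p ∧ q < f q ∨ f p < p ∧ f q < q) →
        ∃ r, p < r ∧ r < q ∧ ¬ ((p < f p ∧ r < f r) ∨ (f p < p ∧ f r < r)) := by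
      intro p q hpq hne hs
      obtain ⟨O, hO, h1, h2, h3⟩ := h _ ((mem_orbitals_iff f _).2 ⟨p, rfl⟩) _
        ((mem_orbitals_iff f _).2 ⟨q, rfl⟩)
        ((orbitalLT_iff f p q).2 (lt_of_le_of_ne (orbitalRep_monotone f hpq.le) hne)) (by
          rw [orbitalParity_eq_one_iff, orbitalParity_eq_one_iff, orbitalParity_eq_neg_one_iff,
            orbitalParity_eq_neg_one_iff]
          exact hs)
      obtain ⟨r, rfl⟩ := (mem_orbitals_iff f _).1 hO
      rw [orbitalLT_iff] at h1 h2
      refine ⟨r, not_le.1 fun h' => absurd (orbitalRep_monotone f h') h1.not_ge,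
        not_le.1 fun h' => absurd (orbitalRep_monotone f h') h2.not_ge, ?_⟩
      rintro (⟨h4, h5⟩ | ⟨h4, h5⟩)
      · exact h3 (((orbitalParity_eq_one_iff f r).2 h5).trans
          ((orbitalParity_eq_one_iff f p).2 h4).symm)
      · exact h3 (((orbitalParity_eq_neg_one_iff f r).2 h5).trans
          ((orbitalParity_eq_neg_one_iff f p).2 h4).symm)
    have hc := isOrbitalLabelling_orbitalRep f
    constructor
    · intro p q hpq hup
      by_cases heq : orbitalRep f p = orbitalRep f q
      · exact hc.up_orbit p q hpq (Subtype.ext heq) ((hc.up_iff p).2 (hup p le_rfl hpq.le))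
      · obtain ⟨r, h1, h2, h3⟩ := key p q hpq heq
          (Or.inl ⟨hup p le_rfl hpq.le, hup q hpq.le le_rfl⟩)
        exact absurd (Or.inl ⟨hup p le_rfl hpq.le, hup r h1.le h2.le⟩) h3
    · intro p q hpq hdn
      by_cases heq : orbitalRep f p = orbitalRep f q
      · exact hc.dn_orbit p q hpq (Subtype.ext heq) ((hc.dn_iff p).2 (hdn p le_rfl hpq.le))
      · obtain ⟨r, h1, h2, h3⟩ := key p q hpq heq
          (Or.inr ⟨hdn p le_rfl hpq.le, hdn q hpq.le le_rfl⟩)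
        exact absurd (Or.inr ⟨hdn p le_rfl hpq.le, hdn r h1.le h2.le⟩) h3
  · intro h O₁ hO₁ O₂ hO₂ hlt hs
    obtain ⟨p, rfl⟩ := (mem_orbitals_iff f _).1 hO₁
    obtain ⟨q, rfl⟩ := (mem_orbitals_iff f _).1 hO₂
    rw [orbitalLT_iff] at hlt
    have hpq : p < q := not_le.1 fun h' => absurd (orbitalRep_monotone f h') hlt.not_ge
    have hrel : ¬ (orbitalSetoid f).r p q := fun h' => hlt.ne (orbitalRep_eq f h')
    rw [orbitalParity_eq_one_iff, orbitalParity_eq_one_iff, orbitalParity_eq_neg_one_iff,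
      orbitalParity_eq_neg_one_iff] at hs
    rcases hs with ⟨hp, hq⟩ | ⟨hp, hq⟩
    · obtain ⟨x, h1, h2, h3⟩ : ∃ x, p ≤ x ∧ x ≤ q ∧ ¬ x < f x := by
        by_contra hcon
        push Not at hcon
        obtain ⟨n, hn⟩ := h.up p q hpq hcon
        exact hrel ⟨0, n, hpq.le, hn.le⟩
      refine ⟨_, (mem_orbitals_iff f _).2 ⟨x, rfl⟩, ?_, ?_, ?_⟩
      · rw [orbitalLT_iff]
        exact lt_of_le_of_ne (orbitalRep_monotone f h1) fun heq =>
          h3 (lt_apply_of_rel (rel_of_orbitalRep_eq f heq) hp)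
      · rw [orbitalLT_iff]
        exact lt_of_le_of_ne (orbitalRep_monotone f h2) fun heq =>
          h3 (lt_apply_of_rel (rel_of_orbitalRep_eq f heq.symm) hq)
      · rw [(orbitalParity_eq_one_iff f p).2 hp]
        exact fun h' => h3 ((orbitalParity_eq_one_iff f x).1 h')
    · obtain ⟨x, h1, h2, h3⟩ : ∃ x, p ≤ x ∧ x ≤ q ∧ ¬ f x < x := by
        by_contra hcon
        push Not at hcon
        obtain ⟨n, hn⟩ := h.dn p q hpq hcon
        exact hrel ((orbitalSetoid f).symm' ⟨n, 0, hn.le, hpq.le⟩)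
      refine ⟨_, (mem_orbitals_iff f _).2 ⟨x, rfl⟩, ?_, ?_, ?_⟩
      · rw [orbitalLT_iff]
        exact lt_of_le_of_ne (orbitalRep_monotone f h1) fun heq =>
          h3 (apply_lt_of_rel (rel_of_orbitalRep_eq f heq) hp)
      · rw [orbitalLT_iff]
        exact lt_of_le_of_ne (orbitalRep_monotone f h2) fun heq =>
          h3 (apply_lt_of_rel (rel_of_orbitalRep_eq f heq.symm) hq)
      · rw [(orbitalParity_eq_neg_one_iff f p).2 hp]
        exact fun h' => h3 ((orbitalParity_eq_neg_one_iff f x).1 h')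

end Orbitals

section Conjugation

theorem PointwiseAlternating.conj {f : AutQ} (hf : PointwiseAlternating f) (c : AutQ) :
    PointwiseAlternating (c * f * c⁻¹) := by
  have hc : ∀ x, c (c⁻¹ x) = x := c.apply_symm_apply
  have hc' : ∀ x, c⁻¹ (c x) = x := c.symm_apply_apply
  constructor
  · intro p q hpq h
    obtain ⟨n, hn⟩ := hf.up (c⁻¹ p) (c⁻¹ q) (c⁻¹.strictMono hpq) fun x h1 h2 => by
      have := h (c x) (by rw [← hc p]; exact c.monotone h1) (by rw [← hc q]; exact c.monotone h2)
      simpa only [RelIso.mul_apply, hc', c.lt_iff_lt] using this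
    refine ⟨n, ?_⟩
    rw [conj_pow]
    have := c.strictMono hn
    rwa [hc] at this
  · intro p q hpq h
    obtain ⟨n, hn⟩ := hf.dn (c⁻¹ p) (c⁻¹ q) (c⁻¹.strictMono hpq) fun x h1 h2 => by
      have := h (c x) (by rw [← hc p]; exact c.monotone h1) (by rw [← hc q]; exact c.monotone h2)
      simpa only [RelIso.mul_apply, hc', c.lt_iff_lt] using this
    refine ⟨n, ?_⟩
    rw [conj_pow]
    have := c.strictMono hn
    rwa [hc] at this

theorem finite_fixedPoints_conj {f : AutQ} (hf : (Function.fixedPoints f).Finite) (c : AutQ) :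
    (Function.fixedPoints (c * f * c⁻¹ : AutQ)).Finite := by
  refine (hf.image c).subset fun x hx => ⟨c⁻¹ x, ?_, c.apply_symm_apply x⟩
  have : c (f (c⁻¹ x)) = x := hx
  change f (c⁻¹ x) = c⁻¹ x
  nth_rw 2 [← this]
  exact (c.symm_apply_apply _).symm

/-- The set of the automorphisms that satisfy the two conditions of the theorem. -/
def goodAut : Set AutQ := {f | PointwiseAlternating f ∧ (Function.fixedPoints f).Finite}

theorem mem_goodAut_iff (f : AutQ) :
    f ∈ goodAut ↔ HasAlternatingOrbitals f ∧ HasFinitelyManyFixedPoints f := by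
  rw [hasAlternatingOrbitals_iff]; rfl

theorem mem_goodAut_of_isConj {f g : AutQ} (h : IsConj f g) (hf : f ∈ goodAut) : g ∈ goodAut := by
  obtain ⟨c, rfl⟩ := isConj_iff.1 h
  exact ⟨hf.1.conj c, finite_fixedPoints_conj hf.2 c⟩

end Conjugation

section Topology

theorem isOpen_setOf_apply_eq (q r : ℚ) : IsOpen {f : AutQ | f q = r} := by
  refine (@isOpen_induced_iff _ _ (@Pi.topologicalSpace ℚ (fun _ => ℚ) (fun _ => ⊥)) _ _).2
    ⟨{φ : ℚ → ℚ | φ q = r}, ?_, rfl⟩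
  exact @IsOpen.preimage _ _ (@Pi.topologicalSpace ℚ (fun _ => ℚ) (fun _ => ⊥)) ⊥ _
    (@continuous_apply ℚ (fun _ => ℚ) (fun _ => ⊥) q) {r} trivial

theorem isOpen_setOf_symm_apply_eq (q r : ℚ) : IsOpen {f : AutQ | f.symm q = r} := by
  have : {f : AutQ | f.symm q = r} = {f : AutQ | f r = q} := by
    ext f
    exact (f.symm_apply_eq).trans eq_comm
  rw [this]
  exact isOpen_setOf_apply_eq r q

/-- A map into the automorphism group is continuous if all its evaluations are locally constant. -/
theorem continuous_autQ {Z : Type*} [TopologicalSpace Z] {F : Z → AutQ}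
    (h : ∀ q r, IsOpen {z | F z q = r}) : Continuous F := by
  have hpi : @Continuous Z (ℚ → ℚ) _ (@Pi.topologicalSpace ℚ (fun _ => ℚ) (fun _ => ⊥))
      fun z q => F z q := by
    refine @continuous_pi Z ℚ (fun _ => ℚ) _ (fun _ => ⊥) _ fun q => ?_
    refine @Continuous.mk _ _ _ ⊥ _ fun s _ => ?_
    have : (fun z => F z q) ⁻¹' s = ⋃ r ∈ s, {z | F z q = r} := by ext z; simp
    rw [this]
    exact isOpen_biUnion fun r _ => h q r
  rw [continuous_iff_le_induced] at hpi ⊢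
  exact hpi.trans_eq induced_compose.symm

theorem continuous_mul_left_autQ (g : AutQ) : Continuous fun f : AutQ => g * f := by
  refine continuous_autQ fun q r => ?_
  have : {f : AutQ | (g * f) q = r} = {f : AutQ | f q = g⁻¹ r} := by
    ext f
    change g (f q) = r ↔ f q = g.symm r
    rw [OrderIso.eq_symm_apply]
  rw [this]
  exact isOpen_setOf_apply_eq _ _

theorem IsCompact.finite_image_of_isOpen {Z W : Type*} [TopologicalSpace Z] {K : Set Z}
    (hK : IsCompact K) (φ : Z → W) (h : ∀ r, IsOpen {z | φ z = r}) : (φ '' K).Finite := by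
  obtain ⟨t, ht⟩ := hK.elim_finite_subcover (fun r => {z | φ z = r}) h
    fun z _ => mem_iUnion.2 ⟨φ z, rfl⟩
  refine t.finite_toSet.subset ?_
  rintro _ ⟨z, hz, rfl⟩
  obtain ⟨r, hr, hzr⟩ := mem_iUnion₂.1 (ht hz)
  exact (show φ z = r from hzr) ▸ hr

theorem IsCompact.finiteValued {K : Set AutQ} (hK : IsCompact K) : FiniteValued K :=
  ⟨fun q => hK.finite_image_of_isOpen _ (isOpen_setOf_apply_eq q),
    fun q => hK.finite_image_of_isOpen _ (isOpen_setOf_symm_apply_eq q)⟩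

end Topology

section Positive

/-- Prescribing the values at the fixed points of `f₀` defines the required open set. -/
theorem isCompactBiter_of_good {f₀ : AutQ} (hf₀ : f₀ ∈ goodAut) :
    IsCompactBiter {f | IsConj f₀ f} := by
  rintro K hK ⟨k, hk⟩
  set U : Set AutQ := ⋂ z ∈ hf₀.2.toFinset, {f : AutQ | f z = k z} with hU
  have hU' : ∀ f ∈ U, ∀ z, f₀ z = z → f z = k z := fun f hf z hz =>
    mem_iInter₂.1 hf z (hf₀.2.mem_toFinset.2 hz)
  obtain ⟨h, hh⟩ := exists_capture_aut (hK.finiteValued.mono (inter_subset_right (s := U))) hf₀.1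
    hf₀.2 (fun z hz f hf g hg => (hU' f hf.1 z hz).trans (hU' g hg.1 z hz).symm)
  refine ⟨U, h⁻¹, 1, isOpen_biInter_finset fun z _ => isOpen_setOf_apply_eq z _,
    ⟨k, mem_iInter₂.2 fun z _ => rfl, hk⟩, ?_⟩
  rintro _ ⟨f, hf, rfl⟩
  dsimp only
  rw [mul_one]
  exact hh f hf

theorem isCompactCatcher_of_good {f₀ : AutQ} (hf₀ : f₀ ∈ goodAut)
    (hfix : Function.fixedPoints f₀ = ∅) : IsCompactCatcher {f | IsConj f₀ f} := by
  intro K hK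
  obtain ⟨h, hh⟩ := exists_capture_aut hK.finiteValued hf₀.1 hf₀.2
    (fun z hz => absurd (show z ∈ Function.fixedPoints f₀ from hz)
      (by rw [hfix]; exact notMem_empty z))
  refine ⟨h⁻¹, 1, ?_⟩
  rintro _ ⟨f, hf, rfl⟩
  dsimp only
  rw [mul_one]
  exact hh f hf

/-- A map with countably many values takes finitely many of them outside a set of small measure. -/
theorem exists_finset_measure_lt {α W : Type*} [MeasurableSpace α] [Countable W] (μ : Measure α)
    [IsFiniteMeasure μ] (φ : α → W) (hφ : ∀ r, MeasurableSet {z | φ z = r}) {ε : ENNReal}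
    (hε : 0 < ε) : ∃ t : Finset W, μ {z | φ z ∉ t} < ε := by
  classical
  rcases isEmpty_or_nonempty W with hW | hW
  · refine ⟨∅, ?_⟩
    have : {z | φ z ∉ (∅ : Finset W)} = ∅ := by ext z; exact (hW.false (φ z)).elim
    rwa [this, measure_empty]
  obtain ⟨e, he⟩ := exists_surjective_nat W
  let A : ℕ → Set α := fun n => {z | φ z ∉ (Finset.range n).image e}
  have hA : Antitone A := fun m n hmn z hz h =>
    hz (Finset.image_subset_image (Finset.range_mono hmn) h)
  have hAm : ∀ n, MeasurableSet (A n) := by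
    intro n
    have : A n = (⋃ r ∈ (Finset.range n).image e, {z | φ z = r})ᶜ := by
      ext z
      simp only [A, Set.mem_ofPred_eq, mem_compl_iff, mem_iUnion, exists_prop, exists_eq_right']
    rw [this]
    exact (Finset.measurableSet_biUnion _ fun r _ => hφ r).compl
  have hempty : ⋂ n, A n = ∅ := by
    ext z
    simp only [mem_iInter, mem_empty_iff_false, iff_false, not_forall]
    obtain ⟨n, hn⟩ := he (φ z)
    exact ⟨n + 1, fun h => h (Finset.mem_image.2 ⟨n, by simp, hn⟩)⟩
  have := tendsto_measure_iInter_atTop (μ := μ) (fun n => (hAm n).nullMeasurableSet) hA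
    ⟨0, measure_ne_top _ _⟩
  rw [hempty, measure_empty] at this
  obtain ⟨n, hn⟩ := (this.eventually (gt_mem_nhds hε)).exists
  exact ⟨_, hn⟩

/-- Every probability measure on the automorphism group is positive on a set on which every point
has finitely many images and preimages, and on a finite set of points also unique images. -/
theorem exists_finiteValued_measure_pos (μ : Measure AutQ) [IsProbabilityMeasure μ] {Z : Set ℚ}
    (hZ : Z.Finite) : ∃ K : Set AutQ, FiniteValued K ∧ μ K ≠ 0 ∧
      ∀ z ∈ Z, ∀ f ∈ K, ∀ g ∈ K, f z = g z := by
  -- images and preimages of all points, as a single countable family of maps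
  let φ : ℚ ⊕ ℚ → AutQ → ℚ := fun i f => i.elim (fun q => f q) (fun q => f.symm q)
  have hφ : ∀ i r, MeasurableSet {f | φ i f = r} := by
    rintro (q | q) r
    · exact (isOpen_setOf_apply_eq q r).measurableSet
    · exact (isOpen_setOf_symm_apply_eq q r).measurableSet
  obtain ⟨ε, hε, hsum⟩ := ENNReal.exists_pos_sum_of_countable' (one_ne_zero (α := ENNReal)) (ℚ ⊕ ℚ)
  choose t ht using fun i => exists_finset_measure_lt μ (φ i) (hφ i) (hε i)
  set K : Set AutQ := {f | ∀ i, φ i f ∈ t i} with hK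
  have hKc : μ Kᶜ < 1 := by
    have : Kᶜ ⊆ ⋃ i, {f | φ i f ∉ t i} := by
      intro f hf
      obtain ⟨i, hi⟩ := not_forall.1 hf
      exact mem_iUnion.2 ⟨i, hi⟩
    exact ((measure_mono this).trans (measure_iUnion_le _)).trans_lt
      ((ENNReal.tsum_le_tsum fun i => (ht i).le).trans_lt hsum)
  have hK0 : μ K ≠ 0 := by
    intro h
    have h1 : (1 : ENNReal) ≤ μ K + μ Kᶜ := by
      rw [← measure_univ (μ := μ), ← union_compl_self K]
      exact measure_union_le _ _
    rw [h, zero_add] at h1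
    exact absurd hKc h1.not_gt
  have hKf : FiniteValued K := by
    refine ⟨fun q => (t (Sum.inl q)).finite_toSet.subset ?_,
      fun q => (t (Sum.inr q)).finite_toSet.subset ?_⟩
    · rintro _ ⟨f, hf, rfl⟩; exact hf (Sum.inl q)
    · rintro _ ⟨f, hf, rfl⟩; exact hf (Sum.inr q)
  have : Finite Z := hZ
  have hcover : K ⊆ ⋃ τ : Z → ℚ, K ∩ {f | ∀ z : Z, f z = τ z} := fun f hf =>
    mem_iUnion.2 ⟨fun z => f z, hf, fun z => rfl⟩
  obtain ⟨τ, hτ⟩ : ∃ τ : Z → ℚ, μ (K ∩ {f | ∀ z : Z, f z = τ z}) ≠ 0 := by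
    by_contra hcon
    push Not at hcon
    exact hK0 (measure_mono_null hcover (measure_iUnion_null hcon))
  exact ⟨_, hKf.mono inter_subset_left, hτ, fun z hz f hf g hg =>
    (hf.2 ⟨z, hz⟩).trans (hg.2 ⟨z, hz⟩).symm⟩

/-- A measure that vanished on all translates of the conjugacy class of `f₀` would vanish on a set
of positive measure, a translate of which lies in the class. -/
theorem not_isHaarNull_of_good {f₀ : AutQ} (hf₀ : f₀ ∈ goodAut) :
    ¬ IsHaarNull {f | IsConj f₀ f} := by
  rintro ⟨B, hB, -, μ, hμ, h0⟩
  obtain ⟨K, hK, hpos, hz⟩ := exists_finiteValued_measure_pos μ hf₀.2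
  obtain ⟨h, hh⟩ := exists_capture_aut hK hf₀.1 hf₀.2 hz
  refine hpos (measure_mono_null (fun f hf => ?_) (h0 h 1))
  exact ⟨h⁻¹ * f, hB (hh f hf), by simp⟩

end Positive

/-! ### Construction of a random automorphism -/

section Gap

/-- The distance from `x` to the finite set `S ∪ {0}`. -/
def gap (S : Finset ℚ) (x : ℚ) : ℚ :=
  (insert 0 S).inf' (Finset.insert_nonempty _ _) fun s => |x - s|

theorem gap_nonneg (S : Finset ℚ) (x : ℚ) : 0 ≤ gap S x :=
  Finset.le_inf' _ _ fun _ _ => abs_nonneg _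

theorem gap_le (S : Finset ℚ) (x : ℚ) {s : ℚ} (hs : s ∈ insert 0 S) : gap S x ≤ |x - s| :=
  Finset.inf'_le (fun s => |x - s|) hs

theorem exists_gap_eq (S : Finset ℚ) (x : ℚ) : ∃ s ∈ insert 0 S, gap S x = |x - s| :=
  Finset.exists_mem_eq_inf' _ _

theorem gap_eq_zero_iff {S : Finset ℚ} {x : ℚ} : gap S x = 0 ↔ x ∈ insert 0 S := by
  constructor
  · intro h
    obtain ⟨s, hs, hs'⟩ := exists_gap_eq S x
    rw [h, eq_comm, abs_eq_zero, sub_eq_zero] at hs'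
    rwa [hs']
  · intro h
    have := gap_le S x h
    rw [sub_self, abs_zero] at this
    exact le_antisymm this (gap_nonneg S x)

theorem gap_pos {S : Finset ℚ} {x : ℚ} (h : x ∉ insert 0 S) : 0 < gap S x :=
  (gap_nonneg S x).lt_of_ne fun h' => h (gap_eq_zero_iff.1 h'.symm)

theorem gap_le_add (S : Finset ℚ) (x y : ℚ) : gap S x ≤ gap S y + |x - y| := by
  obtain ⟨s, hs, hs'⟩ := exists_gap_eq S y
  rw [hs', add_comm]
  exact (gap_le S x hs).trans (abs_sub_le _ _ _)

theorem gap_anti {S T : Finset ℚ} (h : S ⊆ T) (x : ℚ) : gap T x ≤ gap S x :=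
  Finset.inf'_mono _ (Finset.insert_subset_insert 0 h) _

/-- The units of the successive perturbations: the `n`-th one adds one of the `2 ^ n` multiples
`i * scale (n + 1)`, `i < 2 ^ n`, of the distance to the final points. Each unit is
`4 * 2 ^ n` times the next one, so that later perturbations do not undo earlier ones. -/
def scale : ℕ → ℚ
  | 0 => 1
  | n + 1 => scale n / (4 * 2 ^ n)

theorem scale_pos : ∀ n, 0 < scale n
  | 0 => one_pos
  | n + 1 => div_pos (scale_pos n) (by positivity)

/-- The right-hand sides telescope, so that all the perturbations from the `n`-th one on add up to
at most `scale n / 3`. -/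
theorem mul_scale_succ_le {n : ℕ} (i : Fin (2 ^ n)) :
    (i : ℚ) * scale (n + 1) ≤ (scale n - scale (n + 1)) / 3 := by
  have h1 : ((i : ℕ) : ℚ) + 1 ≤ 2 ^ n := by exact_mod_cast i.2
  have h2 : (2 : ℚ) ^ n * scale (n + 1) = scale n / 4 := by
    rw [scale]; field_simp
  have h3 := mul_le_mul_of_nonneg_right h1 (scale_pos (n + 1)).le
  have h4 := scale_pos (n + 1)
  have h5 := scale_pos n
  linarith

end Gap

section Stages

/-- The space of the independent random choices: the `n`-th one has `2 ^ n` values. -/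
abbrev Choices : Type := ∀ n : ℕ, Fin (2 ^ n)

/-- An enumeration of the rational numbers. -/
def ratEnum (n : ℕ) : ℚ := (Encodable.decode (α := ℚ) n).getD 0

theorem ratEnum_encode (x : ℚ) : ratEnum (Encodable.encode x) = x := by
  rw [ratEnum, Encodable.encodek, Option.getD_some]

/-- The stages of the random construction: a map `ℚ → ℚ` together with the finite set of the points
at which its value is final. The map is perturbed by a random multiple of the distance
to that set; then the next rational number and its preimage are added to the set. -/
noncomputable def stage (ω : Choices) : ℕ → (ℚ → ℚ) × Finset ℚ
  | 0 => (id, ∅)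
  | n + 1 =>
    let F : ℚ → ℚ := fun x =>
      (stage ω n).1 x + (ω n : ℚ) * scale (n + 1) * gap (stage ω n).2 x
    (F, insert (ratEnum n) (insert (Function.invFun F (ratEnum n)) (stage ω n).2))

/-- The map of the `n`-th stage. -/
noncomputable def stageMap (ω : Choices) (n : ℕ) : ℚ → ℚ := (stage ω n).1

/-- The set of the points at which the map of the `n`-th stage is final. -/
noncomputable def stagePts (ω : Choices) (n : ℕ) : Finset ℚ := (stage ω n).2

theorem stageMap_zero (ω : Choices) (x : ℚ) : stageMap ω 0 x = x := rfl

theorem stageMap_succ (ω : Choices) (n : ℕ) (x : ℚ) : stageMap ω (n + 1) x =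
    stageMap ω n x + (ω n : ℚ) * scale (n + 1) * gap (stagePts ω n) x := rfl

theorem stagePts_succ (ω : Choices) (n : ℕ) : stagePts ω (n + 1) =
    insert (ratEnum n) (insert (Function.invFun (stageMap ω (n + 1)) (ratEnum n))
      (stagePts ω n)) := rfl

theorem stage_congr {ω ω' : Choices} {n : ℕ} (h : ∀ i < n, ω i = ω' i) :
    stage ω n = stage ω' n := by
  induction n with
  | zero => rfl
  | succ n ih =>
    rw [stage, stage, ih fun i hi => h i (by omega), h n (by omega)]

theorem stageMap_congr {ω ω' : Choices} {n : ℕ} (h : ∀ i < n, ω i = ω' i) :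
    stageMap ω n = stageMap ω' n := congrArg Prod.fst (stage_congr h)

theorem stagePts_congr {ω ω' : Choices} {n : ℕ} (h : ∀ i < n, ω i = ω' i) :
    stagePts ω n = stagePts ω' n := congrArg Prod.snd (stage_congr h)

theorem stagePts_mono (ω : Choices) : Monotone (stagePts ω) :=
  monotone_nat_of_le_succ fun n => by
    rw [stagePts_succ]
    exact (Finset.subset_insert _ _).trans (Finset.subset_insert _ _)

theorem insert_stagePts_mono (ω : Choices) {m n : ℕ} (h : m ≤ n) :
    insert 0 (stagePts ω m) ⊆ insert 0 (stagePts ω n) :=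
  Finset.insert_subset_insert 0 (stagePts_mono ω h)

theorem ratEnum_mem_stagePts (ω : Choices) (n : ℕ) : ratEnum n ∈ stagePts ω (n + 1) := by
  rw [stagePts_succ]; exact Finset.mem_insert_self _ _

theorem mem_stagePts_encode (ω : Choices) (x : ℚ) :
    x ∈ stagePts ω (Encodable.encode x + 1) := by
  have := ratEnum_mem_stagePts ω (Encodable.encode x)
  rwa [ratEnum_encode] at this

/-- The perturbations vanish at the final points. -/
theorem stageMap_eq_of_mem {ω : Choices} {m n : ℕ} (h : m ≤ n) {x : ℚ}
    (hx : x ∈ insert 0 (stagePts ω m)) : stageMap ω n x = stageMap ω m x := by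
  induction n, h using Nat.le_induction with
  | base => rfl
  | succ n hmn ih =>
    rw [stageMap_succ, gap_eq_zero_iff.2 (insert_stagePts_mono ω hmn hx), mul_zero, add_zero, ih]

theorem stageMap_apply_zero (ω : Choices) (n : ℕ) : stageMap ω n 0 = 0 := by
  rw [stageMap_eq_of_mem (Nat.zero_le n) (Finset.mem_insert_self 0 _), stageMap_zero]

theorem stageMap_le_stageMap (ω : Choices) {m n : ℕ} (h : m ≤ n) (x : ℚ) :
    stageMap ω m x ≤ stageMap ω n x := by
  induction n, h using Nat.le_induction with
  | base => rfl
  | succ n hmn ih =>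
    rw [stageMap_succ]
    have := mul_nonneg (mul_nonneg (Nat.cast_nonneg (α := ℚ) (ω n : ℕ)) (scale_pos (n + 1)).le)
      (gap_nonneg (stagePts ω n) x)
    linarith

/-- All perturbations from the `m`-th one on together amount to at most a third of the scale times
the distance to the final points. -/
theorem stageMap_le_add (ω : Choices) {m n : ℕ} (h : m ≤ n) (x : ℚ) :
    stageMap ω n x ≤ stageMap ω m x + (scale m - scale n) / 3 * gap (stagePts ω m) x := by
  induction n, h using Nat.le_induction with
  | base => simp
  | succ n hmn ih =>
    rw [stageMap_succ]
    have h1 := mul_le_mul (mul_scale_succ_le (ω n)) (gap_anti (stagePts_mono ω hmn) x)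
      (gap_nonneg _ _) ((mul_nonneg (Nat.cast_nonneg _) (scale_pos (n + 1)).le).trans
        (mul_scale_succ_le (ω n)))
    linarith

/-- The slopes of the `n`-th map deviate from `1` by at most `(1 - scale n) / 3`. -/
theorem stageMap_sub_bounds (ω : Choices) (n : ℕ) {x y : ℚ} (h : x ≤ y) :
    (1 - (1 - scale n) / 3) * (y - x) ≤ stageMap ω n y - stageMap ω n x ∧
      stageMap ω n y - stageMap ω n x ≤ (1 + (1 - scale n) / 3) * (y - x) := by
  induction n with
  | zero => simp [stageMap_zero, scale]
  | succ n ih =>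
    rw [stageMap_succ, stageMap_succ]
    set a := (ω n : ℚ) * scale (n + 1) with ha
    have ha0 : 0 ≤ a := mul_nonneg (Nat.cast_nonneg _) (scale_pos (n + 1)).le
    have h1 := mul_le_mul_of_nonneg_left (gap_le_add (stagePts ω n) x y) ha0
    have h2 := mul_le_mul_of_nonneg_left (gap_le_add (stagePts ω n) y x) ha0
    rw [abs_sub_comm, abs_of_nonneg (sub_nonneg.2 h)] at h1
    rw [abs_of_nonneg (sub_nonneg.2 h)] at h2
    have h3 := mul_le_mul_of_nonneg_right (mul_scale_succ_le (ω n)) (sub_nonneg.2 h)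
    rw [← ha] at h3
    constructor <;> linarith

theorem two_thirds_le_stageMap_sub (ω : Choices) (n : ℕ) {x y : ℚ} (h : x ≤ y) :
    2 / 3 * (y - x) ≤ stageMap ω n y - stageMap ω n x := by
  have h1 := (stageMap_sub_bounds ω n h).1
  have h2 := mul_nonneg (scale_pos n).le (sub_nonneg.2 h)
  linarith

theorem stageMap_sub_le (ω : Choices) (n : ℕ) {x y : ℚ} (h : x ≤ y) :
    stageMap ω n y - stageMap ω n x ≤ 4 / 3 * (y - x) := by
  have h1 := (stageMap_sub_bounds ω n h).2
  have h2 := mul_nonneg (scale_pos n).le (sub_nonneg.2 h)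
  linarith

/-- The maps of the stages extend to continuous maps of the reals that are locally given by
rational affine functions. This is what makes them surjective on the rationals. -/
theorem exists_real_extension (ω : Choices) (n : ℕ) : ∃ G : ℝ → ℝ, Continuous G ∧
    (∀ x : ℚ, G x = stageMap ω n x) ∧
      ∀ x, ∃ a b : ℚ, 1 - (1 - scale n) / 3 ≤ a ∧ G x = a * x + b := by
  induction n with
  | zero =>
    exact ⟨id, continuous_id, fun x => rfl, fun x => ⟨1, 0, by simp [scale], by simp⟩⟩
  | succ n ih =>
    obtain ⟨G, hG, hGx, hGa⟩ := ih
    set c : ℚ := (ω n : ℚ) * scale (n + 1) with hc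
    have hne : (insert 0 (stagePts ω n)).Nonempty := Finset.insert_nonempty _ _
    refine ⟨fun x => G x + (c : ℝ) * (insert 0 (stagePts ω n)).inf' hne fun s => |x - (s : ℝ)|,
      ?_, ?_, ?_⟩
    · refine hG.add (continuous_const.mul (Continuous.finset_inf'_apply _ fun s _ => ?_))
      fun_prop
    · intro x
      have : (insert 0 (stagePts ω n)).inf' hne (fun s => |(x : ℝ) - (s : ℝ)|) =
          (gap (stagePts ω n) x : ℚ) := by
        refine le_antisymm ?_ (Finset.le_inf' _ _ fun s hs => ?_)
        · obtain ⟨s, hs, hs'⟩ := exists_gap_eq (stagePts ω n) x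
          refine (Finset.inf'_le _ hs).trans_eq ?_
          rw [hs']; push_cast; rfl
        · have := gap_le _ x hs
          exact_mod_cast this
      dsimp only
      rw [this, stageMap_succ, hGx, hc]
      push_cast
      rfl
    · intro x
      obtain ⟨a, b, ha, hab⟩ := hGa x
      obtain ⟨s, -, hs⟩ := Finset.exists_mem_eq_inf' hne fun s : ℚ => |x - (s : ℝ)|
      have hc0 : 0 ≤ c := mul_nonneg (Nat.cast_nonneg _) (scale_pos (n + 1)).le
      have hc1 : c ≤ (scale n - scale (n + 1)) / 3 := mul_scale_succ_le (ω n)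
      dsimp only
      rw [hs, hab]
      rcases le_total 0 (x - (s : ℝ)) with h | h
      · refine ⟨a + c, b - c * s, by linarith, ?_⟩
        rw [abs_of_nonneg h]; push_cast; ring
      · refine ⟨a - c, b + c * s, by linarith, ?_⟩
        rw [abs_of_nonpos h]; push_cast; ring

theorem stageMap_surjective (ω : Choices) (n : ℕ) : Function.Surjective (stageMap ω n) := by
  intro q
  obtain ⟨G, hG, hGx, hGa⟩ := exists_real_extension ω n
  have hup : q ≤ stageMap ω n (2 * |q|) := by
    have h := two_thirds_le_stageMap_sub ω n (x := 0) (y := 2 * |q|) (by positivity)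
    rw [stageMap_apply_zero] at h
    have := le_abs_self q
    have := abs_nonneg q
    linarith
  have hdn : stageMap ω n (-(2 * |q|)) ≤ q := by
    have h := two_thirds_le_stageMap_sub ω n (x := -(2 * |q|)) (y := 0)
      (by have := abs_nonneg q; linarith)
    rw [stageMap_apply_zero] at h
    have := neg_abs_le q
    have := abs_nonneg q
    linarith
  obtain ⟨x, hx⟩ := mem_range_of_exists_le_of_exists_ge (c := (q : ℝ)) hG
    ⟨((-(2 * |q|) : ℚ) : ℝ), by rw [hGx]; exact_mod_cast hdn⟩
    ⟨((2 * |q| : ℚ) : ℝ), by rw [hGx]; exact_mod_cast hup⟩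
  obtain ⟨a, b, ha, hab⟩ := hGa x
  have ha0 : a ≠ 0 := by
    have := scale_pos n
    intro h
    rw [h] at ha
    linarith
  have hxq : x = (((q - b) / a : ℚ) : ℝ) := by
    have ha' : (a : ℝ) ≠ 0 := by exact_mod_cast ha0
    push_cast
    rw [eq_div_iff ha']
    linarith
  refine ⟨(q - b) / a, ?_⟩
  have := hGx ((q - b) / a)
  rw [← hxq, hx] at this
  exact_mod_cast this.symm

/-- Each rational number has its preimage among the final points of some stage. -/
theorem exists_mem_stagePts_eq (ω : Choices) (n : ℕ) :
    ∃ p ∈ stagePts ω (n + 1), stageMap ω (n + 1) p = ratEnum n := by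
  refine ⟨Function.invFun (stageMap ω (n + 1)) (ratEnum n), ?_,
    Function.invFun_eq (stageMap_surjective ω (n + 1) _)⟩
  rw [stagePts_succ]
  exact Finset.mem_insert_of_mem (Finset.mem_insert_self _ _)

end Stages

section Limit

/-- The limit of the stages: the value at `x` is taken from a stage at which `x` is final. -/
noncomputable def limitMap (ω : Choices) (x : ℚ) : ℚ := stageMap ω (Encodable.encode x + 1) x

theorem limitMap_eq {ω : Choices} {n : ℕ} {x : ℚ} (hx : x ∈ insert 0 (stagePts ω n)) :
    limitMap ω x = stageMap ω n x := by
  have h : x ∈ insert 0 (stagePts ω (Encodable.encode x + 1)) :=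
    Finset.mem_insert_of_mem (mem_stagePts_encode ω x)
  rcases le_total n (Encodable.encode x + 1) with h' | h'
  · exact stageMap_eq_of_mem h' hx
  · exact (stageMap_eq_of_mem h' h).symm

/-- At any finite number of points the limit agrees with some stage. -/
theorem exists_limitMap_eq (ω : Choices) (m : ℕ) (x y : ℚ) :
    ∃ n, m ≤ n ∧ limitMap ω x = stageMap ω n x ∧ limitMap ω y = stageMap ω n y := by
  refine ⟨max m (max (Encodable.encode x + 1) (Encodable.encode y + 1)), le_max_left _ _, ?_, ?_⟩
  · refine limitMap_eq (Finset.mem_insert_of_mem (stagePts_mono ω ?_ (mem_stagePts_encode ω x)))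
    exact (le_max_left _ _).trans (le_max_right _ _)
  · refine limitMap_eq (Finset.mem_insert_of_mem (stagePts_mono ω ?_ (mem_stagePts_encode ω y)))
    exact (le_max_right _ _).trans (le_max_right _ _)

theorem two_thirds_le_limitMap_sub (ω : Choices) {x y : ℚ} (h : x ≤ y) :
    2 / 3 * (y - x) ≤ limitMap ω y - limitMap ω x := by
  obtain ⟨n, -, hx, hy⟩ := exists_limitMap_eq ω 0 x y
  rw [hx, hy]
  exact two_thirds_le_stageMap_sub ω n h

theorem limitMap_sub_le (ω : Choices) {x y : ℚ} (h : x ≤ y) :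
    limitMap ω y - limitMap ω x ≤ 4 / 3 * (y - x) := by
  obtain ⟨n, -, hx, hy⟩ := exists_limitMap_eq ω 0 x y
  rw [hx, hy]
  exact stageMap_sub_le ω n h

theorem limitMap_strictMono (ω : Choices) : StrictMono (limitMap ω) := fun x y h => by
  have := two_thirds_le_limitMap_sub ω h.le
  linarith

theorem limitMap_surjective (ω : Choices) : Function.Surjective (limitMap ω) := fun y => by
  obtain ⟨p, hp, hp'⟩ := exists_mem_stagePts_eq ω (Encodable.encode y)
  refine ⟨p, ?_⟩
  rw [limitMap_eq (Finset.mem_insert_of_mem hp), hp', ratEnum_encode]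

/-- The random automorphism of `ℚ`. -/
noncomputable def randomAut (ω : Choices) : AutQ :=
  (limitMap_strictMono ω).orderIsoOfSurjective _ (limitMap_surjective ω)

theorem randomAut_apply (ω : Choices) (x : ℚ) : randomAut ω x = limitMap ω x := rfl

/-- If two sequences of choices differ for the first time at `n`, then the one that is larger there
leads to a larger automorphism, by an amount comparable to the distance to the
finitely many points that are final at the stage `n`. -/
theorem mul_gap_le_randomAut_sub {ω ω' : Choices} {n : ℕ} (h : ∀ i < n, ω i = ω' i)
    (hn : ω n < ω' n) (x : ℚ) :
    2 / 3 * scale (n + 1) * gap (stagePts ω n) x ≤ randomAut ω' x - randomAut ω x := by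
  rw [randomAut_apply, randomAut_apply]
  set N := max (n + 1) (Encodable.encode x + 1)
  have hN : ∀ ω, limitMap ω x = stageMap ω N x := fun ω =>
    limitMap_eq (Finset.mem_insert_of_mem (stagePts_mono ω (le_max_right _ _)
      (mem_stagePts_encode ω x)))
  have h1 := stageMap_le_stageMap ω' (le_max_left (n + 1) (Encodable.encode x + 1)) x
  have h2 := stageMap_le_add ω (le_max_left (n + 1) (Encodable.encode x + 1)) x
  rw [stageMap_succ] at h1 h2
  rw [← stageMap_congr h, ← stagePts_congr h] at h1
  rw [hN, hN]
  have hg := gap_nonneg (stagePts ω n) x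
  have h3 : ((ω n : ℕ) : ℚ) + 1 ≤ (ω' n : ℕ) := by exact_mod_cast hn
  have h4 := mul_le_mul_of_nonneg_right h3 (mul_nonneg (scale_pos (n + 1)).le hg)
  have h5 : (scale (n + 1) - scale N) / 3 * gap (stagePts ω (n + 1)) x ≤
      scale (n + 1) / 3 * gap (stagePts ω n) x :=
    mul_le_mul (by have := scale_pos N; linarith) (gap_anti (stagePts_mono ω n.le_succ) x)
      (gap_nonneg _ _) (by have := scale_pos (n + 1); linarith)
  change _ ≤ stageMap ω' N x - stageMap ω N x
  linarith

theorem exists_first_ne {ω ω' : Choices} (h : ω ≠ ω') :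
    ∃ n, (∀ i < n, ω i = ω' i) ∧ ω n ≠ ω' n := by
  classical
  have h' : ∃ n, ω n ≠ ω' n := by
    by_contra hc
    exact h (funext fun n => not_not.1 fun hn => hc ⟨n, hn⟩)
  exact ⟨Nat.find h', fun i hi => not_not.1 (Nat.find_min h' hi), Nat.find_spec h'⟩

/-- The value at a point depends on finitely many choices only. -/
theorem continuous_randomAut : Continuous randomAut := by
  refine continuous_autQ fun q r => ?_
  refine isOpen_iff_forall_mem_open.2 fun ω hω => ?_
  refine ⟨{ω' | ∀ i ∈ Finset.range (Encodable.encode q + 1), ω' i = ω i}, fun ω' hω' => ?_, ?_,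
    fun i _ => rfl⟩
  · have : stageMap ω' (Encodable.encode q + 1) = stageMap ω (Encodable.encode q + 1) :=
      stageMap_congr fun i hi => hω' i (Finset.mem_range.2 hi)
    have hω0 : stageMap ω (Encodable.encode q + 1) q = r := hω
    rw [← this] at hω0
    exact hω0
  · have : {ω' : Choices | ∀ i ∈ Finset.range (Encodable.encode q + 1), ω' i = ω i} =
        ⋂ i ∈ Finset.range (Encodable.encode q + 1), (fun ω' : Choices => ω' i) ⁻¹' {ω i} := by
      ext; simp
    rw [this]
    exact isOpen_biInter_finset fun i _ => (isOpen_discrete _).preimage (continuous_apply i)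

end Limit

/-! ### Measurability of the set of good automorphisms -/

section Measurability

theorem measurableSet_setOf_apply_eq (q r : ℚ) : MeasurableSet {f : AutQ | f q = r} :=
  (isOpen_setOf_apply_eq q r).measurableSet

theorem measurableSet_setOf_pow_apply_eq (n : ℕ) (q r : ℚ) :
    MeasurableSet {f : AutQ | (f ^ n) q = r} := by
  induction n generalizing q r with
  | zero => exact MeasurableSet.const (q = r)
  | succ n ih =>
    have : {f : AutQ | (f ^ (n + 1)) q = r} =
        ⋃ s, {f : AutQ | f q = s} ∩ {f : AutQ | (f ^ n) s = r} := by
      ext f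
      simp [pow_succ, RelIso.mul_apply]
    rw [this]
    exact MeasurableSet.iUnion fun s => (measurableSet_setOf_apply_eq q s).inter (ih s r)

theorem measurable_pow_apply (P : ℚ → Prop) (n : ℕ) (q : ℚ) :
    Measurable fun f : AutQ => P ((f ^ n) q) := by
  have : {f : AutQ | P ((f ^ n) q)} = ⋃ r ∈ {r | P r}, {f : AutQ | (f ^ n) q = r} := by
    ext f; simp
  refine measurableSet_setOfPred.1 ?_
  rw [this]
  exact MeasurableSet.biUnion (to_countable _) fun r _ => measurableSet_setOf_pow_apply_eq n q r

theorem measurable_apply (P : ℚ → Prop) (q : ℚ) : Measurable fun f : AutQ => P (f q) := by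
  simpa only [pow_one] using measurable_pow_apply P 1 q

theorem measurableSet_goodAut : MeasurableSet goodAut := by
  have h : goodAut = {f : AutQ |
      ((∀ p q, p < q → (∀ x, p ≤ x → x ≤ q → x < f x) → ∃ n : ℕ, q < (f ^ n) p) ∧
        ∀ p q, p < q → (∀ x, p ≤ x → x ≤ q → f x < x) → ∃ n : ℕ, (f ^ n) q < p) ∧
      ∃ T : Finset ℚ, ∀ x, x ∉ T → f x ≠ x} := by
    ext f
    refine and_congr ⟨fun h => ⟨h.up, h.dn⟩, fun h => ⟨h.1, h.2⟩⟩ ⟨fun h => ?_, ?_⟩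
    · exact ⟨h.toFinset, fun x hx hfx => hx (h.mem_toFinset.2 hfx)⟩
    · rintro ⟨T, hT⟩
      exact T.finite_toSet.subset fun x hx => by_contra fun hx' => hT x hx' hx
  rw [h, measurableSet_setOfPred]
  refine Measurable.and (Measurable.and ?_ ?_) ?_
  · refine .forall fun p => .forall fun q => .imp measurable_const (.imp ?_ ?_)
    · exact .forall fun x => .imp measurable_const (.imp measurable_const
        (measurable_apply (fun y => x < y) x))
    · exact .exists fun n => measurable_pow_apply (fun y => q < y) n p
  · refine .forall fun p => .forall fun q => .imp measurable_const (.imp ?_ ?_)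
    · exact .forall fun x => .imp measurable_const (.imp measurable_const
        (measurable_apply (fun y => y < x) x))
    · exact .exists fun n => measurable_pow_apply (fun y => y < p) n q
  · exact .exists fun T => .forall fun x => .imp measurable_const
      (measurable_apply (fun y => y ≠ x) x)

end Measurability

/-! ### The law of the random automorphism -/

section Choices

/-- The law of the random choices: they are independent and uniformly distributed. -/
noncomputable def choiceMeasure : Measure Choices :=
  Measure.infinitePi fun n => (PMF.uniformOfFintype (Fin (2 ^ n))).toMeasure

instance : IsProbabilityMeasure choiceMeasure := by
  unfold choiceMeasure; infer_instance

theorem choiceMeasure_eval_preimage (k : ℕ) (v : Fin (2 ^ k)) :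
    choiceMeasure ((fun ω => ω k) ⁻¹' {v}) = ((2 : ENNReal) ^ k)⁻¹ := by
  have h := Measure.infinitePi_map_eval
    (fun n => (PMF.uniformOfFintype (Fin (2 ^ n))).toMeasure) k
  rw [← Measure.map_apply (measurable_pi_apply k) (measurableSet_singleton v), choiceMeasure, h,
    PMF.toMeasure_apply_singleton _ _ (measurableSet_singleton v), PMF.uniformOfFintype_apply]
  simp

/-- A set in which the choices before `k` determine the `k`-th one has measure at most `2⁻ᵏ`. -/
theorem choiceMeasure_le {k : ℕ} {B : Set Choices}
    (hB : ∀ ω ∈ B, ∀ ω' ∈ B, (∀ i < k, ω i = ω' i) → ω k = ω' k) :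
    choiceMeasure B ≤ ((2 : ENNReal) ^ k)⁻¹ := by
  classical
  set R : Choices → ∀ i : Finset.range k, Fin (2 ^ (i : ℕ)) := fun ω i => ω i with hR
  have hRm : Measurable R := measurable_pi_lambda _ fun i => measurable_pi_apply _
  have hind : ProbabilityTheory.IndepFun R (fun ω : Choices => ω k) choiceMeasure := by
    have h1 : ProbabilityTheory.iIndepFun (fun i (ω : Choices) => ω i) choiceMeasure :=
      ProbabilityTheory.iIndepFun_infinitePi (X := fun i (x : Fin (2 ^ i)) => x)
        fun i => measurable_id
    have h2 := h1.indepFun_finset (Finset.range k) {k} (by simp) fun i => measurable_pi_apply i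
    exact h2.comp measurable_id
      (measurable_pi_apply (⟨k, Finset.mem_singleton_self k⟩ : ({k} : Finset ℕ)))
  let v : (∀ i : Finset.range k, Fin (2 ^ (i : ℕ))) → Fin (2 ^ k) := fun p =>
    if h : ∃ ω ∈ B, R ω = p then h.choose k else 0
  have hcover : B ⊆ ⋃ p, R ⁻¹' {p} ∩ (fun ω => ω k) ⁻¹' {v p} := by
    intro ω hω
    refine mem_iUnion.2 ⟨R ω, rfl, ?_⟩
    have h : ∃ ω' ∈ B, R ω' = R ω := ⟨ω, hω, rfl⟩
    change ω k = v (R ω)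
    simp only [v, dif_pos h]
    exact hB ω hω _ h.choose_spec.1 fun i hi =>
      (congrFun h.choose_spec.2 ⟨i, Finset.mem_range.2 hi⟩).symm
  calc choiceMeasure B
      ≤ ∑' p, choiceMeasure (R ⁻¹' {p} ∩ (fun ω => ω k) ⁻¹' {v p}) :=
        (measure_mono hcover).trans (measure_iUnion_le _)
    _ = ∑' p, choiceMeasure (R ⁻¹' {p}) * ((2 : ENNReal) ^ k)⁻¹ := by
        refine tsum_congr fun p => ?_
        rw [hind.measure_inter_preimage_eq_mul _ _ (measurableSet_singleton p)
          (measurableSet_singleton _), choiceMeasure_eval_preimage]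
    _ = ((2 : ENNReal) ^ k)⁻¹ := by
        rw [ENNReal.tsum_mul_right, tsum_fintype]
        have := sum_measure_preimage_singleton (μ := choiceMeasure) (f := R) Finset.univ
          fun p _ => hRm (measurableSet_singleton p)
        rw [this, Finset.coe_univ, preimage_univ, measure_univ, one_mul]

theorem choiceMeasure_eq_zero_of_subsingleton {B : Set Choices} (hB : B.Subsingleton) :
    choiceMeasure B = 0 := by
  have h : ∀ k : ℕ, choiceMeasure B ≤ (2⁻¹ : ENNReal) ^ k := fun k => by
    rw [← ENNReal.inv_pow]
    exact choiceMeasure_le fun ω hω ω' hω' _ => congrFun (hB hω hω') k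
  have ht := ENNReal.tendsto_pow_atTop_nhds_zero_of_lt_one (r := 2⁻¹) (by simp)
  exact le_antisymm (ge_of_tendsto' ht h) zero_le

end Choices

/-! ### Almost sure finiteness of the set of fixed points -/

section FixedPoints

/-- At a point that is not yet final, the `k`-th choice is determined by the preceding ones and by
the value of the next map. -/
theorem choiceMeasure_stageMap_eq_le (k : ℕ) (x y : ℚ) :
    choiceMeasure {ω | x ∉ insert 0 (stagePts ω k) ∧ stageMap ω (k + 1) x = y} ≤
      ((2 : ENNReal) ^ k)⁻¹ := by
  refine choiceMeasure_le ?_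
  rintro ω ⟨hx, hy⟩ ω' ⟨-, hy'⟩ h
  rw [stageMap_succ] at hy hy'
  rw [← stageMap_congr h, ← stagePts_congr h, ← hy, add_right_inj] at hy'
  have := mul_right_cancel₀ (gap_pos hx).ne' hy'
  have := mul_right_cancel₀ (scale_pos (k + 1)).ne' this
  exact Fin.ext (by exact_mod_cast this.symm)

theorem eq_or_stageMap_eq_of_mem {ω : Choices} {k : ℕ} {x : ℚ}
    (h : x ∈ insert 0 (stagePts ω (k + 1))) (h' : x ∉ insert 0 (stagePts ω k)) :
    x = ratEnum k ∨ stageMap ω (k + 1) x = ratEnum k := by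
  rw [stagePts_succ] at h
  simp only [Finset.mem_insert, not_or] at h h'
  rcases h with h | h | h | h
  · exact absurd h h'.1
  · exact Or.inl h
  · right
    rw [h]
    exact Function.invFun_eq (stageMap_surjective ω (k + 1) _)
  · exact absurd h h'.2

/-- For every automorphism `h`, the random one almost surely agrees with `h` at finitely many
points only, by the Borel–Cantelli lemma. -/
theorem ae_finite_setOf_randomAut_eq (h : AutQ) :
    ∀ᵐ ω ∂choiceMeasure, {x | randomAut ω x = h x}.Finite := by
  let A : ℚ → ℚ → ℕ → Set Choices := fun x y k =>
    {ω | x ∉ insert 0 (stagePts ω k) ∧ stageMap ω (k + 1) x = y}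
  let s : ℕ → Set Choices := fun k =>
    A (ratEnum k) (h (ratEnum k)) k ∪ A (h.symm (ratEnum k)) (ratEnum k) k
  have hs : ∀ k, choiceMeasure (s k) ≤ 2 * (2⁻¹ : ENNReal) ^ k := fun k => by
    rw [← ENNReal.inv_pow, two_mul]
    exact (measure_union_le _ _).trans
      (add_le_add (choiceMeasure_stageMap_eq_le _ _ _) (choiceMeasure_stageMap_eq_le _ _ _))
  have hsum : ∑' k, choiceMeasure (s k) ≠ ⊤ := by
    refine ne_top_of_le_ne_top ?_ (ENNReal.tsum_le_tsum hs)
    rw [ENNReal.tsum_mul_left, ENNReal.tsum_geometric, ENNReal.one_sub_inv_two, inv_inv]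
    exact ENNReal.mul_ne_top ENNReal.ofNat_ne_top ENNReal.ofNat_ne_top
  filter_upwards [ae_eventually_notMem hsum] with ω hω
  -- a point that becomes final at a step `k ≥ N` is `ratEnum k` or is mapped to `ratEnum k`
  obtain ⟨N, hN⟩ := Filter.eventually_atTop.1 hω
  refine (insert 0 (stagePts ω N)).finite_toSet.subset fun x hx => ?_
  by_contra hxN
  have hex : ∃ m, x ∈ insert 0 (stagePts ω m) :=
    ⟨_, Finset.mem_insert_of_mem (mem_stagePts_encode ω x)⟩
  classical
  obtain ⟨k, hk⟩ : ∃ k, Nat.find hex = k + 1 := by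
    refine Nat.exists_eq_succ_of_ne_zero fun h0 => hxN ?_
    have := Nat.find_spec hex
    rw [h0] at this
    exact insert_stagePts_mono ω (Nat.zero_le N) this
  have h1 : x ∈ insert 0 (stagePts ω (k + 1)) := hk ▸ Nat.find_spec hex
  have h2 : x ∉ insert 0 (stagePts ω k) := Nat.find_min hex (by omega)
  have hNk : N ≤ k := not_lt.1 fun hlt => hxN (insert_stagePts_mono ω hlt h1)
  have h3 : stageMap ω (k + 1) x = h x := (limitMap_eq h1).symm.trans hx
  refine hN k hNk ?_
  rcases eq_or_stageMap_eq_of_mem h1 h2 with rfl | h4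
  · exact Or.inl ⟨h2, h3⟩
  · have : h.symm (ratEnum k) = x := by rw [← h4, h3, h.symm_apply_apply]
    right
    rw [this]
    exact ⟨h2, h4⟩

end FixedPoints

/-! ### Almost sure alternation of orbitals -/

section Orbitals

/-- The distance to a finite set of points extends continuously to the reals, so that a sequence
of rational numbers that has a real limit and along which the distance tends to zero converges to
one of the points. -/
theorem exists_tendsto_of_gap {S : Finset ℚ} {x : ℕ → ℚ} {L : ℝ}
    (hx : Filter.Tendsto (fun k => (x k : ℝ)) Filter.atTop (nhds L)) {c C : ℚ} (hc : 0 < c)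
    (hgap : ∀ k, c * gap S (x (k + 1)) ≤ C * |x (k + 1) - x k|) :
    ∃ z, Filter.Tendsto x Filter.atTop (nhds z) ∧ z ∈ insert 0 S := by
  have hx1 := hx.comp (Filter.tendsto_add_atTop_nat 1)
  have hd : Filter.Tendsto (fun k => (C : ℝ) * |(x (k + 1) : ℝ) - x k|) Filter.atTop (nhds 0) := by
    have := ((hx1.sub hx).abs).const_mul (C : ℝ)
    rwa [sub_self, abs_zero, mul_zero] at this
  by_contra hcon
  have hpos : ∀ s ∈ insert 0 S, ∀ᶠ k in Filter.atTop,
      (C : ℝ) * |(x (k + 1) : ℝ) - x k| < c * |(x (k + 1) : ℝ) - s| := by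
    intro s hs
    have hLs : L ≠ s := by
      rintro rfl
      exact hcon ⟨s, Rat.isEmbedding_coe_real.tendsto_nhds_iff.2 hx, hs⟩
    have h1 : Filter.Tendsto (fun k => (c : ℝ) * |(x (k + 1) : ℝ) - s|) Filter.atTop
        (nhds (c * |L - s|)) := ((hx1.sub_const (s : ℝ)).abs).const_mul _
    exact hd.eventually_lt h1
      (mul_pos (by exact_mod_cast hc) (abs_pos.2 (sub_ne_zero.2 hLs)))
  obtain ⟨k, hk⟩ := ((Finset.eventually_all (insert 0 S)).2 hpos).exists
  obtain ⟨s, hs, hs'⟩ := exists_gap_eq S (x (k + 1))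
  have h1 := hgap k
  rw [hs'] at h1
  have h2 := hk s hs
  have h3 : (c : ℝ) * |(x (k + 1) : ℝ) - s| ≤ C * |(x (k + 1) : ℝ) - x k| := by exact_mod_cast h1
  exact h3.not_gt h2

theorem exists_real_tendsto_of_monotone {x : ℕ → ℚ} (hx : Monotone x) {b : ℚ} (hb : ∀ k, x k ≤ b) :
    ∃ L : ℝ, Filter.Tendsto (fun k => (x k : ℝ)) Filter.atTop (nhds L) :=
  ⟨_, tendsto_atTop_ciSup (fun _ _ h => by exact_mod_cast hx h)
    ⟨b, by rintro _ ⟨k, rfl⟩; exact Rat.cast_le.2 (hb k)⟩⟩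

theorem exists_real_tendsto_of_antitone {x : ℕ → ℚ} (hx : Antitone x) {b : ℚ} (hb : ∀ k, b ≤ x k) :
    ∃ L : ℝ, Filter.Tendsto (fun k => (x k : ℝ)) Filter.atTop (nhds L) :=
  ⟨_, tendsto_atTop_ciInf (fun _ _ h => by exact_mod_cast hx h)
    ⟨b, by rintro _ ⟨k, rfl⟩; exact Rat.cast_le.2 (hb k)⟩⟩

/-- There is at most one sequence of choices for which all points of `[p, q]` are moved up by
`h⁻¹ * randomAut ω`, and yet the orbit of `p` never leaves `[p, q]`. For two such sequences, the
orbit under the larger automorphism would converge to a rational number in `[p, q]`. -/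
theorem subsingleton_setOf_up (h : AutQ) (p q : ℚ) :
    {ω | (∀ x, p ≤ x → x ≤ q → h x < randomAut ω x) ∧
      ∀ n : ℕ, ((h⁻¹ * randomAut ω) ^ n) p ≤ q}.Subsingleton := by
  have key : ∀ ω ω' : Choices, ∀ n, (∀ i < n, ω i = ω' i) → ω n < ω' n →
      (∀ x, p ≤ x → x ≤ q → h x < randomAut ω x) →
      ¬ ∀ n : ℕ, ((h⁻¹ * randomAut ω') ^ n) p ≤ q := by
    intro ω ω' n hagree hlt hup hbd
    set x : ℕ → ℚ := fun k => ((h⁻¹ * randomAut ω') ^ k) p with hx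
    have hstep : ∀ k, h (x (k + 1)) = randomAut ω' (x k) := fun k => by
      simp only [hx, pow_succ', RelIso.mul_apply, RelIso.apply_inv_self]
    have hle : ∀ y, randomAut ω y ≤ randomAut ω' y := fun y => by
      have h1 := mul_gap_le_randomAut_sub hagree hlt y
      have h2 := mul_nonneg (mul_nonneg (by norm_num : (0 : ℚ) ≤ 2 / 3) (scale_pos (n + 1)).le)
        (gap_nonneg (stagePts ω n) y)
      linarith
    have hpx : ∀ k, p ≤ x k ∧ x k ≤ x (k + 1) := by
      intro k
      have hmono : ∀ k, p ≤ x k → x k ≤ x (k + 1) := fun k hk => by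
        refine h.le_iff_le.1 ?_
        rw [hstep]
        exact (hup _ hk (hbd k)).le.trans (hle _)
      have hp : p ≤ x k := by
        induction k with
        | zero => exact le_rfl
        | succ k ih => exact ih.trans (hmono k ih)
      exact ⟨hp, hmono k hp⟩
    have hmono : Monotone x := monotone_nat_of_le_succ fun k => (hpx k).2
    obtain ⟨L, hL⟩ := exists_real_tendsto_of_monotone hmono hbd
    -- along the orbit, the difference of the two automorphisms is at most `4 / 3` times a step of
    -- the orbit, and at least a multiple of the distance to the points that are final at stage `n`
    obtain ⟨z, hz, -⟩ := exists_tendsto_of_gap hL (S := stagePts ω n)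
      (c := 2 / 3 * scale (n + 1)) (C := 4 / 3) (by have := scale_pos (n + 1); positivity)
      fun k => by
        have h1 := mul_gap_le_randomAut_sub hagree hlt (x (k + 1))
        have h2 := hup _ (hpx (k + 1)).1 (hbd (k + 1))
        rw [hstep] at h2
        have h3 := limitMap_sub_le ω' (hpx k).2
        rw [← randomAut_apply, ← randomAut_apply] at h3
        rw [abs_of_nonneg (sub_nonneg.2 (hpx k).2)]
        linarith
    have hxz : ∀ k, x k ≤ z := hmono.ge_of_tendsto hz
    have hzq : z ≤ q := le_of_tendsto' hz hbd
    have hpz : p ≤ z := (hpx 0).1.trans (hxz 0)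
    have hlim : Filter.Tendsto (fun k => 4 / 3 * (z - x k)) Filter.atTop (nhds 0) := by
      have := (hz.const_sub z).const_mul (4 / 3)
      rwa [sub_self, mul_zero] at this
    -- the limit of the orbit is a fixed point
    have : randomAut ω' z - h z ≤ 0 := by
      refine ge_of_tendsto' hlim fun k => ?_
      have h1 := limitMap_sub_le ω' (hxz k)
      rw [← randomAut_apply, ← randomAut_apply, ← hstep] at h1
      have := h.monotone (hxz (k + 1))
      linarith
    have h1 := hup z hpz hzq
    have h2 := hle z
    linarith
  rintro ω ⟨h1, h2⟩ ω' ⟨h1', h2'⟩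
  by_contra hne
  obtain ⟨n, hn, hn'⟩ := exists_first_ne hne
  rcases lt_or_gt_of_ne hn' with hlt | hlt
  · exact key ω ω' n hn hlt h1 h2'
  · exact key ω' ω n (fun i hi => (hn i hi).symm) hlt h1' h2

/-- The counterpart of `subsingleton_setOf_up` for points that are moved down. Here the orbit under
the smaller automorphism converges. -/
theorem subsingleton_setOf_dn (h : AutQ) (p q : ℚ) :
    {ω | (∀ x, p ≤ x → x ≤ q → randomAut ω x < h x) ∧
      ∀ n : ℕ, p ≤ ((h⁻¹ * randomAut ω) ^ n) q}.Subsingleton := by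
  have key : ∀ ω ω' : Choices, ∀ n, (∀ i < n, ω i = ω' i) → ω n < ω' n →
      (∀ x, p ≤ x → x ≤ q → randomAut ω' x < h x) →
      ¬ ∀ n : ℕ, p ≤ ((h⁻¹ * randomAut ω) ^ n) q := by
    intro ω ω' n hagree hlt hdn hbd
    set x : ℕ → ℚ := fun k => ((h⁻¹ * randomAut ω) ^ k) q with hx
    have hstep : ∀ k, h (x (k + 1)) = randomAut ω (x k) := fun k => by
      simp only [hx, pow_succ', RelIso.mul_apply, RelIso.apply_inv_self]
    have hle : ∀ y, randomAut ω y ≤ randomAut ω' y := fun y => by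
      have h1 := mul_gap_le_randomAut_sub hagree hlt y
      have h2 := mul_nonneg (mul_nonneg (by norm_num : (0 : ℚ) ≤ 2 / 3) (scale_pos (n + 1)).le)
        (gap_nonneg (stagePts ω n) y)
      linarith
    have hpx : ∀ k, x k ≤ q ∧ x (k + 1) ≤ x k := by
      intro k
      have hanti : ∀ k, x k ≤ q → x (k + 1) ≤ x k := fun k hk => by
        refine h.le_iff_le.1 ?_
        rw [hstep]
        exact (hle _).trans (hdn _ (hbd k) hk).le
      have hp : x k ≤ q := by
        induction k with
        | zero => exact le_rfl
        | succ k ih => exact (hanti k ih).trans ih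
      exact ⟨hp, hanti k hp⟩
    have hanti : Antitone x := antitone_nat_of_succ_le fun k => (hpx k).2
    obtain ⟨L, hL⟩ := exists_real_tendsto_of_antitone hanti hbd
    -- along the orbit, the difference of the two automorphisms is at most `4 / 3` times a step of
    -- the orbit, and at least a multiple of the distance to the points that are final at stage `n`
    obtain ⟨z, hz, -⟩ := exists_tendsto_of_gap hL (S := stagePts ω n)
      (c := 2 / 3 * scale (n + 1)) (C := 4 / 3) (by have := scale_pos (n + 1); positivity)
      fun k => by
        have h1 := mul_gap_le_randomAut_sub hagree hlt (x (k + 1))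
        have h2 := hdn _ (hbd (k + 1)) (hpx (k + 1)).1
        rw [hstep] at h2
        have h3 := limitMap_sub_le ω (hpx k).2
        rw [← randomAut_apply, ← randomAut_apply] at h3
        rw [abs_sub_comm, abs_of_nonneg (sub_nonneg.2 (hpx k).2)]
        linarith
    have hxz : ∀ k, z ≤ x k := hanti.le_of_tendsto hz
    have hpz : p ≤ z := ge_of_tendsto' hz hbd
    have hzq : z ≤ q := (hxz 0).trans (hpx 0).1
    have hlim : Filter.Tendsto (fun k => 4 / 3 * (x k - z)) Filter.atTop (nhds 0) := by
      have := (hz.sub_const z).const_mul (4 / 3)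
      rwa [sub_self, mul_zero] at this
    -- the limit of the orbit is a fixed point
    have : h z - randomAut ω z ≤ 0 := by
      refine ge_of_tendsto' hlim fun k => ?_
      have h1 := limitMap_sub_le ω (hxz k)
      rw [← randomAut_apply, ← randomAut_apply, ← hstep] at h1
      have := h.monotone (hxz (k + 1))
      linarith
    have h1 := hdn z hpz hzq
    have h2 := hle z
    linarith
  rintro ω ⟨h1, h2⟩ ω' ⟨h1', h2'⟩
  by_contra hne
  obtain ⟨n, hn, hn'⟩ := exists_first_ne hne
  rcases lt_or_gt_of_ne hn' with hlt | hlt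
  · exact key ω ω' n hn hlt h1' h2
  · exact key ω' ω n (fun i hi => (hn i hi).symm) hlt h1 h2'

/-- Every translate of the random automorphism is almost surely good. -/
theorem ae_inv_mul_randomAut_mem_goodAut (h : AutQ) :
    ∀ᵐ ω ∂choiceMeasure, h⁻¹ * randomAut ω ∈ goodAut := by
  have hup : ∀ᵐ ω ∂choiceMeasure, ∀ p q, ¬ ((∀ x, p ≤ x → x ≤ q → h x < randomAut ω x) ∧
      ∀ n : ℕ, ((h⁻¹ * randomAut ω) ^ n) p ≤ q) :=
    ae_all_iff.2 fun p => ae_all_iff.2 fun q => measure_eq_zero_iff_ae_notMem.1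
      (choiceMeasure_eq_zero_of_subsingleton (subsingleton_setOf_up h p q))
  have hdn : ∀ᵐ ω ∂choiceMeasure, ∀ p q, ¬ ((∀ x, p ≤ x → x ≤ q → randomAut ω x < h x) ∧
      ∀ n : ℕ, p ≤ ((h⁻¹ * randomAut ω) ^ n) q) :=
    ae_all_iff.2 fun p => ae_all_iff.2 fun q => measure_eq_zero_iff_ae_notMem.1
      (choiceMeasure_eq_zero_of_subsingleton (subsingleton_setOf_dn h p q))
  filter_upwards [hup, hdn, ae_finite_setOf_randomAut_eq h] with ω h1 h2 h3
  refine ⟨⟨fun p q _ hx => ?_, fun p q _ hx => ?_⟩, h3.subset fun x hx => ?_⟩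
  · by_contra hcon
    exact h1 p q ⟨fun x hpx hxq => h.lt_symm_apply.1 (hx x hpx hxq),
      fun n => not_lt.1 fun hn => hcon ⟨n, hn⟩⟩
  · by_contra hcon
    exact h2 p q ⟨fun x hpx hxq => h.symm_apply_lt.1 (hx x hpx hxq),
      fun n => not_lt.1 fun hn => hcon ⟨n, hn⟩⟩
  · exact h.symm_apply_eq.1 hx

/-- The law of the random automorphism witnesses that the bad automorphisms form a Haar
null set. -/
theorem isHaarNull_compl_goodAut : IsHaarNull goodAutᶜ := by
  refine ⟨_, Subset.rfl, measurableSet_goodAut.compl, choiceMeasure.map randomAut,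
    Measure.isProbabilityMeasure_map continuous_randomAut.measurable.aemeasurable, fun g h => ?_⟩
  have hsub : bitranslate g goodAutᶜ h ⊆ (fun f => (g * h)⁻¹ * f) ⁻¹' goodAutᶜ := by
    rintro _ ⟨f, hf, rfl⟩ hgood
    refine hf (mem_goodAut_of_isConj ?_ hgood)
    refine isConj_iff.2 ⟨h, ?_⟩
    group
  refine measure_mono_null hsub ?_
  rw [Measure.map_apply continuous_randomAut.measurable
    ((continuous_mul_left_autQ _).measurable measurableSet_goodAut.compl)]
  exact measure_eq_zero_iff_ae_notMem.2 ((ae_inv_mul_randomAut_mem_goodAut (g * h)).mono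
    fun ω hω hω' => hω' hω)

end Orbitals

/-! ### The theorem -/

section Final

theorem IsHaarNull.mono {S T : Set AutQ} (h : S ⊆ T) (hT : IsHaarNull T) : IsHaarNull S := by
  obtain ⟨B, hB, hB'⟩ := hT
  exact ⟨B, h.trans hB, hB'⟩

theorem carrier_eq_setOf_isConj {C : ConjClasses AutQ} {f : AutQ} (hf : f ∈ C.carrier) :
    C.carrier = {g | IsConj f g} := by
  rw [ConjClasses.mem_carrier_iff_mk_eq] at hf
  subst hf
  ext g
  rw [ConjClasses.mem_carrier_iff_mk_eq, ConjClasses.mk_eq_mk_iff_isConj]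
  exact ⟨IsConj.symm, IsConj.symm⟩

theorem carrier_nonempty (C : ConjClasses AutQ) : C.carrier.Nonempty := by
  obtain ⟨f, rfl⟩ := ConjClasses.exists_rep C
  exact ⟨f, ConjClasses.mem_carrier_mk⟩

/-- A conjugacy class is good or bad as a whole. -/
theorem carrier_subset_goodAut {C : ConjClasses AutQ} {f : AutQ} (hf : f ∈ C.carrier)
    (hgood : f ∈ goodAut) : C.carrier ⊆ goodAut := by
  rw [carrier_eq_setOf_isConj hf]
  exact fun g hg => mem_goodAut_of_isConj hg hgood

theorem not_isHaarNull_carrier_iff (C : ConjClasses AutQ) :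
    ¬ IsHaarNull C.carrier ↔ ∃ f ∈ C.carrier, f ∈ goodAut := by
  constructor
  · intro h
    by_contra hcon
    exact h (isHaarNull_compl_goodAut.mono fun f hf hf' => hcon ⟨f, hf, hf'⟩)
  · rintro ⟨f, hf, hgood⟩
    rw [carrier_eq_setOf_isConj hf]
    exact not_isHaarNull_of_good hgood

theorem theorem3p2 :
    HaarAlmostEvery (fun f : AutQ => HasAlternatingOrbitals f ∧ HasFinitelyManyFixedPoints f) ∧
    (∀ C : ConjClasses AutQ,
      (¬ IsHaarNull C.carrier ↔
        ∀ f ∈ C.carrier, HasAlternatingOrbitals f ∧ HasFinitelyManyFixedPoints f) ∧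
      (¬ IsHaarNull C.carrier ↔
        ∃ f ∈ C.carrier, HasAlternatingOrbitals f ∧ HasFinitelyManyFixedPoints f)) ∧
    IsHaarNull (⋃ C ∈ {C : ConjClasses AutQ | IsHaarNull C.carrier}, C.carrier) ∧
    (∀ C : ConjClasses AutQ, ¬ IsHaarNull C.carrier → IsCompactBiter C.carrier) ∧
    (∀ C : ConjClasses AutQ, ¬ IsHaarNull C.carrier →
      (∀ f ∈ C.carrier, Function.fixedPoints f = ∅) → IsCompactCatcher C.carrier) := by
  simp only [← mem_goodAut_iff]
  refine ⟨isHaarNull_compl_goodAut, fun C => ⟨?_, not_isHaarNull_carrier_iff C⟩, ?_,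
    fun C hC => ?_, fun C hC hfix => ?_⟩
  · rw [not_isHaarNull_carrier_iff]
    refine ⟨fun ⟨f, hf, hgood⟩ => carrier_subset_goodAut hf hgood, fun h => ?_⟩
    obtain ⟨f, hf⟩ := carrier_nonempty C
    exact ⟨f, hf, h f hf⟩
  · refine isHaarNull_compl_goodAut.mono (iUnion₂_subset fun C hC f hf => ?_)
    exact fun hgood => (not_isHaarNull_carrier_iff C).2 ⟨f, hf, hgood⟩ hC
  · obtain ⟨f, hf, hgood⟩ := (not_isHaarNull_carrier_iff C).1 hC
    rw [carrier_eq_setOf_isConj hf]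
    exact isCompactBiter_of_good hgood
  · obtain ⟨f, hf, hgood⟩ := (not_isHaarNull_carrier_iff C).1 hC
    rw [carrier_eq_setOf_isConj hf]
    exact isCompactCatcher_of_good hgood (hfix f hf)

end Final
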